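/- **Setting.** Let $S$ be the forward shift on $\ell^2(\mathbb N)$ ($0\in\mathbb N$) with orthonormal basis $(x_n)$, $C^*(S)$ the Toeplitz algebra, and $P$ the orthogonal projection onto $\mathbb C x_0$. For $q\in(0,1)$ let $C_qx_n=\sqrt{1-q^{2n}}\,x_n$, $D_qx_n=q^nx_n$, and put $\pi_i(t_{jk})$, $1\le j,k\le 3$, $i=1,2$, to be the entries of $$\pi_1=\begin{pmatrix}S^*C_q&qD_q&0\\-D_q&C_qS&0\\0&0&I\end{pmatrix},\qquad \pi_2=\begin{pmatrix}I&0&0\\0&S^*C_q&qD_q\\0&-D_q&C_qS\end{pmatrix}.$$ Let $\tau_i(t_{jk})\in C(\mathbb T)$ be the image of $\pi_i(t_{jk})$ under the quotient map $C^*(S)\to C^*(S)/\mathcal K\cong C(\mathbb T)$, $S\mapsto z$, so that $\tau_1=\mathrm{diag}(\bar z,z,1)$ and $\tau_2=\mathrm{diag}(1,\bar z,z)$. The Soibelman representation is $$\Xi_q=(\pi_1\boxtimes\pi_2\boxtimes\pi_1)\boxtimes(\tau_1\boxtimes\tau_2):\ \mathbb C[SU(3)]_q\to C^*(S)^{\otimes3}\otimes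 C(\mathbb T)\otimes C(\mathbb T),$$ where $(\rho\boxtimes\rho')(t_{jk})=\sum_l\rho(t_{jl})\otimes\rho'(t_{lk})$. Put $C_j^{\omega_1}=t_{j1}$ and $C_j^{\omega_2}=q^{1-j}t_{4-j,3}^*$ for $j=1,2,3$. The target is identified with $C(\mathbb T^2,C^*(S)^{\otimes 3})$, and $\mathbb T^2$ acts on it by the right action $\beta_t(f)(z_1,z_2)=f(t_1z_1,t_2z_2)$. **The algebra $SU_0(3)$.** It is the $C^*$-algebra generated by the norm limits, as $q\to0$, of $\Xi_q(C_j^{\omega_i})^*$, $i=1,2$, $j=1,2,3$. **The 2-graph $\mathcal G$.** Its vertices are $CZ,BZ,CY,BX,AY,AX$. The blue edges, of rank $(1,0)$, with their labels, are $CZ\xrightarrow{Z}CZ$, $CZ\xrightarrow{Y}CY$, $CZ\xrightarrow{X}BX$, $BZ\xrightarrow{Z}BZ$, $BZ\xrightarrow{X}BX$, $BZ\xrightarrow{Y}AY$, $CY\xrightarrow{Y}CY$, $CY\xrightarrow{X}BX$, $BX\xrightarrow{X}BX$, $AY\xrightarrow{Y}AY$, $AY\xrightarrow{X}AX$, $AX\xrightarrow{X}AX$;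 the red edges, of rank $(0,1)$, are $CZ\xrightarrow{C}CZ$, $CZ\xrightarrow{B}BZ$, $CZ\xrightarrow{A}AY$, $CY\xrightarrow{C}CY$, $CY\xrightarrow{A}AY$, $CY\xrightarrow{B}BX$, $BZ\xrightarrow{B}BZ$, $BZ\xrightarrow{A}AY$, $BX\xrightarrow{B}BX$, $BX\xrightarrow{A}AX$, $AY\xrightarrow{A}AY$, $AX\xrightarrow{A}AX$. The category $\mathcal G$ is the path category of this graph modulo the following identification of blue-red paths with red-blue paths having the same end points. From $CZ$ or $BZ$ to $AY$: (first $Z$, then $A$) $=$ (first $B$, then $Y$), and (first $Y$, then $A$) $=$ (first $A$, then $Y$). From $CZ$ or $CY$ to $BX$: (first $Y$, then $B$) $=$ (first $C$, then $X$), and (first $X$, then $B$) $=$ (first $B$, then $X$). For every other pair of end points there is at most one path of each kind, and the two are identified. For a row-finite, locally convex $k$-graph $\Lambda$ with rank functor $\mathfrak r$, $C^*(\Lambda)$ denotes the universal $C^*$-algebra generated by projections $P_v$ ($v$ a vertex) and partial isometries $S_f$ ($f$ an arrow) such that the $P_v$ are mutually orthogonal, $S_fS_g=S_{f\circ g}$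 whenever $f\circ g$ is defined, $S_f^*S_f=P_{s(f)}$, and $P_v=\sum_{f\in v\Lambda^{\le n}}S_fS_f^*$ for all $v$ and all $n\in\mathbb N^k$. Here $v\Lambda^{\le n}$ is the set of arrows $f$ with range $v$ and $\mathfrak r(f)\le n$ such that, whenever $\mathfrak r(f)_i<n_i$, no arrow of rank $e_i$ has range $s(f)$. The gauge action of $t\in\mathbb T^k$ is the automorphism $\alpha_t$ with $\alpha_t(P_v)=P_v$ and $\alpha_t(S_f)=t^{\mathfrak r(f)}S_f$. **Proposition.** $\mathcal G$ is a row-finite, locally convex $2$-graph. The norm limits defining $SU_0(3)$ exist and are, with $z_1=z\otimes I$ and $z_2=I\otimes z$ in $C(\mathbb T)\otimes C(\mathbb T)$, $$\begin{array}{ll} \Xi_q(C^{\omega_1}_1)^*\to S\otimes I\otimes S\otimes z_1, & \Xi_q(C^{\omega_2}_1)^*\to I\otimes S\otimes I\otimes z_2,\\ \Xi_q(C^{\omega_1}_2)^*\to -(P\otimes I\otimes S+S^*\otimes S\otimes P)\otimes z_1, & \Xi_q(C^{\omega_2}_2)^*\to S\otimes P\otimes I\otimes z_2,\\ \Xi_q(C^{\omega_1}_3)^*\to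 I\otimes P\otimes P\otimes z_1, & \Xi_q(C^{\omega_2}_3)^*\to P\otimes P\otimes I\otimes z_2. \end{array}$$ There is a $*$-isomorphism $\phi:C^*(\mathcal G)\to SU_0(3)$ that intertwines the gauge action with the right action: $\phi(\alpha_t(a))=\beta_t(\phi(a))$ for all $t\in\mathbb T^2$ and $a\in C^*(\mathcal G)$. -/

import Mathlib

open CategoryTheory Filter Topology
open scoped ENNReal

noncomputable section

/-! ## Graphs of rank `k` -/

/-- The monoid `ℕ^k` viewed as a category with one object. -/
abbrev RankCat (k : ℕ) : Type := SingleObj (Multiplicative (Fin k → ℕ))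

section KGraph

variable {k : ℕ} {Λ : Type} [Category.{0} Λ]

/-- The rank of an arrow with respect to a rank functor `F : Λ ⥤ ℕ^k`. -/
def arrowRank (F : Λ ⥤ RankCat k) {u v : Λ} (f : u ⟶ v) : Fin k → ℕ :=
  Multiplicative.toAdd (show Multiplicative (Fin k → ℕ) from F.map f)

/-- `Λ` with the rank functor `F` is a graph of rank `k`: the category is countable, and every
arrow `f` of rank `a + b` is `g ∘ h` for unique arrows `g` of rank `a` and `h` of rank `b`. (In
Mathlib's notation `g ∘ h` is `h ≫ g`.) -/
def IsKGraph (F : Λ ⥤ RankCat k) : Prop :=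
  Countable Λ ∧ (∀ u v : Λ, Countable (u ⟶ v)) ∧
  ∀ (u w : Λ) (f : u ⟶ w) (a b : Fin k → ℕ), arrowRank F f = a + b →
    ∃! p : Σ v : Λ, (u ⟶ v) × (v ⟶ w),
      arrowRank F p.2.1 = b ∧ arrowRank F p.2.2 = a ∧ p.2.1 ≫ p.2.2 = f

/-- For every vertex `v` and every `n`, finitely many arrows of rank `n` have range `v`. -/
def IsRowFinite (F : Λ ⥤ RankCat k) : Prop :=
  ∀ (v : Λ) (n : Fin k → ℕ), {f : Σ u : Λ, u ⟶ v | arrowRank F f.2 = n}.Finite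

/-- There is an arrow of rank `e_i` with range `v`. -/
def ReceivesColor (F : Λ ⥤ RankCat k) (v : Λ) (i : Fin k) : Prop :=
  ∃ (u : Λ) (g : u ⟶ v), arrowRank F g = Pi.single i 1

/-- Local convexity of a graph of rank `k`. -/
def IsLocallyConvex (F : Λ ⥤ RankCat k) : Prop :=
  ∀ (i j : Fin k), i ≠ j → ∀ (u u' v : Λ) (f : u ⟶ v) (g : u' ⟶ v),
    arrowRank F f = Pi.single j 1 → arrowRank F g = Pi.single i 1 →
      ReceivesColor F u i ∧ ReceivesColor F u' j

/-- The set `v Λ^{≤ n}` of the arrows `f` with range `v` and rank at most `n` such that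
`s(f) Λ^{e_i}` is empty whenever the `i`-th coordinate of the rank of `f` is less than `n i`. -/
def arrowsLE (F : Λ ⥤ RankCat k) (v : Λ) (n : Fin k → ℕ) : Set (Σ u : Λ, u ⟶ v) :=
  {f | arrowRank F f.2 ≤ n ∧ ∀ i, arrowRank F f.2 i < n i → ¬ ReceivesColor F f.1 i}

/-- A family of projections `P v` and partial isometries `S f` in a C⋆-algebra `B` that satisfies
the Cuntz-Krieger relations. The arrow `f : u ⟶ v` has source `u` and range `v`. -/
structure CKFamily (F : Λ ⥤ RankCat k) (B : Type) [NonUnitalCStarAlgebra B] where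
  P : Λ → B
  S : ∀ {u v : Λ}, (u ⟶ v) → B
  isProj : ∀ v, IsStarProjection (P v)
  isPartialIsometry : ∀ {u v : Λ} (f : u ⟶ v), S f * star (S f) * S f = S f
  ck1 : ∀ v w, v ≠ w → P v * P w = 0
  ck2 : ∀ {u v w : Λ} (g : u ⟶ v) (f : v ⟶ w), S f * S g = S (g ≫ f)
  ck3 : ∀ {u v : Λ} (f : u ⟶ v), star (S f) * S f = P u
  ck4 : ∀ (v : Λ) (n : Fin k → ℕ), P v = ∑ᶠ f ∈ arrowsLE F v n, S f.2 * star (S f.2)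

/-- A C⋆-algebra together with a Cuntz-Krieger family in it. -/
structure CKRep (F : Λ ⥤ RankCat k) : Type 1 where
  carrier : Type
  [inst : NonUnitalCStarAlgebra carrier]
  fam : CKFamily F carrier

attribute [instance] CKRep.inst

/-- The C⋆-algebra of all bounded elements of the product of the C⋆-algebras underlying all
Cuntz-Krieger families. -/
abbrev CKProduct (F : Λ ⥤ RankCat k) : Type 1 := lp (fun R : CKRep F => R.carrier) ∞

theorem CKFamily.norm_P_le {F : Λ ⥤ RankCat k} {B : Type} [NonUnitalCStarAlgebra B]
    (T : CKFamily F B) (v : Λ) : ‖T.P v‖ ≤ 1 := (T.isProj v).norm_le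

theorem CKFamily.norm_S_le {F : Λ ⥤ RankCat k} {B : Type} [NonUnitalCStarAlgebra B]
    (T : CKFamily F B) {u v : Λ} (f : u ⟶ v) : ‖T.S f‖ ≤ 1 := by
  have h := CStarRing.norm_star_mul_self (x := T.S f)
  rw [T.ck3] at h
  nlinarith [T.norm_P_le u, norm_nonneg (T.S f)]

/-- The universal projection of a vertex. -/
def univP (F : Λ ⥤ RankCat k) (v : Λ) : CKProduct F :=
  ⟨fun R => R.fam.P v, memℓp_infty ⟨1, by rintro _ ⟨R, rfl⟩; exact R.fam.norm_P_le v⟩⟩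

/-- The universal partial isometry of an arrow. -/
def univS (F : Λ ⥤ RankCat k) {u v : Λ} (f : u ⟶ v) : CKProduct F :=
  ⟨fun R => R.fam.S f, memℓp_infty ⟨1, by rintro _ ⟨R, rfl⟩; exact R.fam.norm_S_le f⟩⟩

/-- The universal projections and partial isometries. -/
def univGenerators (F : Λ ⥤ RankCat k) : Set (CKProduct F) :=
  {x | (∃ v, x = univP F v) ∨ ∃ (u v : Λ) (f : u ⟶ v), x = univS F f}

/-- The C⋆-algebra `C⋆(Λ)` of a graph of rank `k`: the universal C⋆-algebra for the Cuntz-Krieger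
relations, realized as the C⋆-algebra generated by the families `(P v)` and `(S f)` taken in all
Cuntz-Krieger families at once (C⋆-algebras in `Type` suffice, since `Λ` is countable). Every Cuntz-Krieger family is the image of the universal one under
the corresponding coordinate projection. -/
def graphCStar (F : Λ ⥤ RankCat k) : NonUnitalStarSubalgebra ℂ (CKProduct F) :=
  (NonUnitalStarAlgebra.adjoin ℂ (univGenerators F)).topologicalClosure

/-- The monomial `t^n = ∏ t_i ^ n_i`. -/
def torusMonomial (t : Fin k → Circle) (n : Fin k → ℕ) : Circle := ∏ i, t i ^ n i

theorem torusMonomial_add (t : Fin k → Circle) (m n : Fin k → ℕ) :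
    torusMonomial t (m + n) = torusMonomial t m * torusMonomial t n := by
  simp [torusMonomial, pow_add, Finset.prod_mul_distrib]

theorem arrowRank_comp (F : Λ ⥤ RankCat k) {u v w : Λ} (g : u ⟶ v) (f : v ⟶ w) :
    arrowRank F (g ≫ f) = arrowRank F f + arrowRank F g := by
  unfold arrowRank
  rw [F.map_comp]
  rfl

theorem circle_mul_conj (z : Circle) : (z : ℂ) * (starRingEnd ℂ) (z : ℂ) = 1 := by
  rw [Complex.mul_conj]; simp

theorem circle_conj_mul (z : Circle) : (starRingEnd ℂ) (z : ℂ) * (z : ℂ) = 1 := by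
  rw [mul_comm, circle_mul_conj]

/-- The Cuntz-Krieger family `P v`, `t^(rank f) S f`. -/
def CKFamily.twist {F : Λ ⥤ RankCat k} {B : Type} [NonUnitalCStarAlgebra B]
    (T : CKFamily F B) (t : Fin k → Circle) : CKFamily F B where
  P := T.P
  S f := (torusMonomial t (arrowRank F f) : ℂ) • T.S f
  isProj := T.isProj
  isPartialIsometry f := by
    simp only [star_smul, smul_mul_assoc, mul_smul_comm, smul_smul, T.isPartialIsometry]
    congr 1
    simp [circle_conj_mul]
  ck1 := T.ck1
  ck2 g f := by
    simp only [smul_mul_assoc, mul_smul_comm, smul_smul, T.ck2, arrowRank_comp, torusMonomial_add]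
    simp [mul_comm]
  ck3 f := by
    simp only [star_smul, smul_mul_assoc, mul_smul_comm, smul_smul, T.ck3]
    simp [circle_mul_conj]
  ck4 v n := by
    rw [T.ck4 v n]
    simp only [star_smul, smul_mul_assoc, mul_smul_comm, smul_smul]
    simp [circle_conj_mul]

/-- The twist of a Cuntz-Krieger family, with its C⋆-algebra. -/
def CKRep.twist {F : Λ ⥤ RankCat k} (R : CKRep F) (t : Fin k → Circle) : CKRep F :=
  ⟨R.carrier, R.fam.twist t⟩

theorem CKFamily.twist_one {F : Λ ⥤ RankCat k} {B : Type} [NonUnitalCStarAlgebra B]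
    (T : CKFamily F B) : T.twist 1 = T := by
  cases T
  simp [CKFamily.twist, torusMonomial]

theorem CKFamily.twist_mul {F : Λ ⥤ RankCat k} {B : Type} [NonUnitalCStarAlgebra B]
    (T : CKFamily F B) (s t : Fin k → Circle) : (T.twist s).twist t = T.twist (s * t) := by
  cases T
  simp [CKFamily.twist, torusMonomial, mul_pow, Finset.prod_mul_distrib, smul_smul, mul_comm]

theorem CKRep.twist_one {F : Λ ⥤ RankCat k} (R : CKRep F) : R.twist 1 = R :=
  congrArg (CKRep.mk R.carrier) R.fam.twist_one

theorem CKRep.twist_mul {F : Λ ⥤ RankCat k} (R : CKRep F) (s t : Fin k → Circle) :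
    (R.twist s).twist t = R.twist (s * t) :=
  congrArg (CKRep.mk R.carrier) (R.fam.twist_mul s t)

/-- The action of the torus on the product over all Cuntz-Krieger families by twisting. -/
def gaugeProduct (F : Λ ⥤ RankCat k) (t : Fin k → Circle) :
    CKProduct F →⋆ₙₐ[ℂ] CKProduct F where
  toFun x := ⟨fun R => x (R.twist t), memℓp_infty ⟨‖x‖, by
    rintro _ ⟨R, rfl⟩; exact lp.norm_apply_le_norm (by simp) x (R.twist t)⟩⟩
  map_smul' _ _ := rfl
  map_zero' := rfl
  map_add' _ _ := rfl
  map_mul' _ _ := rfl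
  map_star' _ := rfl

theorem gaugeProduct_univP (F : Λ ⥤ RankCat k) (t : Fin k → Circle) (v : Λ) :
    gaugeProduct F t (univP F v) = univP F v := rfl

theorem gaugeProduct_univS (F : Λ ⥤ RankCat k) (t : Fin k → Circle) {u v : Λ} (f : u ⟶ v) :
    gaugeProduct F t (univS F f) = (torusMonomial t (arrowRank F f) : ℂ) • univS F f := rfl

theorem gaugeProduct_one (F : Λ ⥤ RankCat k) (x : CKProduct F) : gaugeProduct F 1 x = x := by
  apply lp.ext
  funext R
  have h : ∀ R' : CKRep F, R' = R → HEq (x R') (x R) := by rintro _ rfl; rfl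
  exact eq_of_heq (h _ R.twist_one)

theorem gaugeProduct_mul (F : Λ ⥤ RankCat k) (s t : Fin k → Circle) (x : CKProduct F) :
    gaugeProduct F s (gaugeProduct F t x) = gaugeProduct F (s * t) x := by
  apply lp.ext
  funext R
  have h : ∀ R₁ R₂ : CKRep F, R₁ = R₂ → HEq (x R₁) (x R₂) := by rintro _ _ rfl; rfl
  exact eq_of_heq (h _ _ (R.twist_mul s t))

theorem gaugeProduct_mem (F : Λ ⥤ RankCat k) (t : Fin k → Circle) {x : CKProduct F}
    (hx : x ∈ graphCStar F) : gaugeProduct F t x ∈ graphCStar F := by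
  have hcont : Continuous (gaugeProduct F t) := by
    refine AddMonoidHomClass.continuous_of_bound (gaugeProduct F t) 1 fun y => ?_
    rw [one_mul]
    exact lp.norm_le_of_forall_le (norm_nonneg y)
      fun R => lp.norm_apply_le_norm (by simp) y (R.twist t)
  have hle : NonUnitalStarAlgebra.adjoin ℂ (univGenerators F) ≤
      (graphCStar F).comap (gaugeProduct F t) := by
    refine NonUnitalStarAlgebra.adjoin_le ?_
    rintro y (⟨v, rfl⟩ | ⟨u, v, f, rfl⟩)
    · change gaugeProduct F t (univP F v) ∈ graphCStar F
      rw [gaugeProduct_univP]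
      exact NonUnitalStarSubalgebra.le_topologicalClosure _
        (NonUnitalStarAlgebra.subset_adjoin ℂ _ (Or.inl ⟨v, rfl⟩))
    · change gaugeProduct F t (univS F f) ∈ graphCStar F
      rw [gaugeProduct_univS]
      have hf : univS F f ∈ graphCStar F := NonUnitalStarSubalgebra.le_topologicalClosure _
        (NonUnitalStarAlgebra.subset_adjoin ℂ _ (Or.inr ⟨u, v, f, rfl⟩))
      exact SMulMemClass.smul_mem _ hf
  have hcl : IsClosed (gaugeProduct F t ⁻¹' (graphCStar F : Set (CKProduct F))) :=
    (NonUnitalStarSubalgebra.isClosed_topologicalClosure _).preimage hcont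
  exact closure_minimal (fun y hy => hle hy) hcl hx

/-- The gauge action `α_t` on `C⋆(Λ)`: it fixes the projections `P v` and maps `S f` to
`t^(rank f) S f`. -/
def gaugeAction (F : Λ ⥤ RankCat k) (t : Fin k → Circle) :
    graphCStar F ≃⋆ₐ[ℂ] graphCStar F where
  toFun x := ⟨gaugeProduct F t x, gaugeProduct_mem F t x.2⟩
  invFun x := ⟨gaugeProduct F t⁻¹ x, gaugeProduct_mem F t⁻¹ x.2⟩
  left_inv x := Subtype.ext <| by
    change gaugeProduct F t⁻¹ (gaugeProduct F t x) = x
    rw [gaugeProduct_mul, inv_mul_cancel, gaugeProduct_one]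
  right_inv x := Subtype.ext <| by
    change gaugeProduct F t (gaugeProduct F t⁻¹ x) = x
    rw [gaugeProduct_mul, mul_inv_cancel, gaugeProduct_one]
  map_mul' _ _ := rfl
  map_add' _ _ := rfl
  map_star' _ := rfl
  map_smul' _ _ := rfl

end KGraph

/-! ## The 2-graph -/

/-- The six vertices. -/
inductive SUVertex : Type
  | CZ | BZ | CY | BX | AY | AX
  deriving DecidableEq

/-- The two colors of edges. -/
inductive SUColor : Type
  | blue | red
  deriving DecidableEq

/-- The labels of edges: red edges carry `A`, `B`, `C` and blue edges carry `X`, `Y`, `Z`. -/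
inductive SULabel : Type
  | A | B | C | X | Y | Z
  deriving DecidableEq

/-- There is at most one edge of each color from one vertex to another; this is its label. -/
def edgeLabel : SUColor → SUVertex → SUVertex → Option SULabel
  | .blue, .CZ, .CZ => some .Z
  | .blue, .CZ, .CY => some .Y
  | .blue, .CZ, .BX => some .X
  | .blue, .BZ, .BZ => some .Z
  | .blue, .BZ, .BX => some .X
  | .blue, .BZ, .AY => some .Y
  | .blue, .CY, .CY => some .Y
  | .blue, .CY, .BX => some .X
  | .blue, .BX, .BX => some .X
  | .blue, .AY, .AY => some .Y
  | .blue, .AY, .AX => some .X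
  | .blue, .AX, .AX => some .X
  | .red, .CZ, .CZ => some .C
  | .red, .CZ, .BZ => some .B
  | .red, .CZ, .AY => some .A
  | .red, .CY, .CY => some .C
  | .red, .CY, .AY => some .A
  | .red, .CY, .BX => some .B
  | .red, .BZ, .BZ => some .B
  | .red, .BZ, .AY => some .A
  | .red, .BX, .BX => some .B
  | .red, .BX, .AX => some .A
  | .red, .AY, .AY => some .A
  | .red, .AX, .AX => some .A
  | _, _, _ => none

/-- An edge from `u` to `v`: a color and the label of the edge of that color. -/
structure SUEdge (u v : SUVertex) : Type where
  color : SUColor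
  label : SULabel
  isEdge : edgeLabel color u v = some label

instance : Quiver SUVertex := ⟨SUEdge⟩

/-- The prescribed commutation for those pairs of vertices that are joined by two paths of the
form blue-red and by two paths of the form red-blue. The arguments are the end points, the labels
of the blue edge and the red edge of a blue-red path (the blue edge is traversed first), and the
labels of the red edge and the blue edge of a red-blue path (the red edge is traversed first). -/
inductive AmbiguousSquare : SUVertex → SUVertex → SULabel → SULabel → SULabel → SULabel → Prop
  | CZ_AY_ZA : AmbiguousSquare .CZ .AY .Z .A .B .Y
  | CZ_AY_YA : AmbiguousSquare .CZ .AY .Y .A .A .Y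
  | BZ_AY_ZA : AmbiguousSquare .BZ .AY .Z .A .B .Y
  | BZ_AY_YA : AmbiguousSquare .BZ .AY .Y .A .A .Y
  | CZ_BX_YB : AmbiguousSquare .CZ .BX .Y .B .C .X
  | CZ_BX_XB : AmbiguousSquare .CZ .BX .X .B .B .X
  | CY_BX_YB : AmbiguousSquare .CY .BX .Y .B .C .X
  | CY_BX_XB : AmbiguousSquare .CY .BX .X .B .B .X

/-- The pairs of vertices that are joined by two blue-red paths. -/
def IsAmbiguousPair (u w : SUVertex) : Prop :=
  (u = .CZ ∧ w = .AY) ∨ (u = .BZ ∧ w = .AY) ∨ (u = .CZ ∧ w = .BX) ∨ (u = .CY ∧ w = .BX)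

/-- The commuting squares: a blue-red path is identified with a red-blue path with the same end
points, according to the prescription for the ambiguous pairs of vertices. -/
inductive SUSquare : HomRel (Paths SUVertex)
  | comm {u v v' w : SUVertex} (b : u ⟶ v) (r : v ⟶ w) (r' : u ⟶ v') (b' : v' ⟶ w)
      (hb : b.color = .blue) (hr : r.color = .red)
      (hr' : r'.color = .red) (hb' : b'.color = .blue)
      (h : IsAmbiguousPair u w → AmbiguousSquare u w b.label r.label r'.label b'.label) :
      SUSquare ((Paths.of SUVertex).map b ≫ (Paths.of SUVertex).map r)
        ((Paths.of SUVertex).map r' ≫ (Paths.of SUVertex).map b')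

/-- The category of the 2-graph: paths of edges modulo the commuting squares. -/
abbrev SUGraph : Type := CategoryTheory.Quotient SUSquare

/-- Blue edges have rank `(1, 0)` and red edges have rank `(0, 1)`. -/
def colorRank : SUColor → Fin 2 → ℕ
  | .blue => ![1, 0]
  | .red => ![0, 1]

/-- The rank functor on paths. -/
def pathRank : Paths SUVertex ⥤ RankCat 2 :=
  Paths.lift
    { obj := fun _ => SingleObj.star _
      map := fun e => Multiplicative.ofAdd (colorRank e.color) }

/-- The rank functor of the 2-graph. -/
def suRank : SUGraph ⥤ RankCat 2 :=
  CategoryTheory.Quotient.lift SUSquare pathRank (by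
    rintro _ _ _ _ ⟨b, r, r', b', hb, hr, hr', hb', -⟩
    change Multiplicative.ofAdd (colorRank r.color) * (Multiplicative.ofAdd (colorRank b.color) * 1) =
      Multiplicative.ofAdd (colorRank b'.color) * (Multiplicative.ofAdd (colorRank r'.color) * 1)
    rw [hb, hr, hr', hb', mul_one, mul_one, mul_comm])

/-! ## Operators on `ℓ²` -/

/-- The Hilbert space `ℓ²(ι)`. -/
abbrev L2 (ι : Type) : Type := lp (fun _ : ι => ℂ) 2

theorem L2.sum_sq_le {ι : Type} (f : L2 ι) (s : Finset ι) : ∑ i ∈ s, ‖f i‖ ^ 2 ≤ ‖f‖ ^ 2 := by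
  have h := lp.sum_rpow_le_norm_rpow (p := 2) (by norm_num) f s
  simpa using h

theorem L2.norm_le {ι : Type} (f : L2 ι) {C : ℝ} (hC : 0 ≤ C)
    (h : ∀ s : Finset ι, ∑ i ∈ s, ‖f i‖ ^ 2 ≤ C ^ 2) : ‖f‖ ≤ C :=
  lp.norm_le_of_forall_sum_le (p := 2) (by norm_num) hC fun s => by simpa using h s

theorem L2.mem {ι : Type} {f : ι → ℂ} {C : ℝ}
    (h : ∀ s : Finset ι, ∑ i ∈ s, ‖f i‖ ^ 2 ≤ C) : Memℓp f 2 :=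
  memℓp_gen' (C := C) fun s => by simpa using h s

/-- A bounded operator given by the coordinates of its values. -/
def opOfCoord {ι κ : Type} (T : L2 ι →ₗ[ℂ] (κ → ℂ)) (C : ℝ) (hC : 0 ≤ C)
    (h : ∀ (f : L2 ι) (s : Finset κ), ∑ i ∈ s, ‖T f i‖ ^ 2 ≤ (C * ‖f‖) ^ 2) :
    L2 ι →L[ℂ] L2 κ :=
  LinearMap.mkContinuous
    { toFun := fun f => ⟨T f, L2.mem (h f)⟩
      map_add' := fun f g => Subtype.ext (T.map_add f g)
      map_smul' := fun c f => Subtype.ext (T.map_smul c f) }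
    C (fun f => L2.norm_le _ (by positivity) (h f))

/-- The diagonal operator `x_n ↦ w_n x_n` on `ℓ²(ℕ)`. -/
def diagOp (w : ℕ → ℝ) (hw : ∀ n, |w n| ≤ 1) : L2 ℕ →L[ℂ] L2 ℕ :=
  opOfCoord
    { toFun := fun f n => (w n : ℂ) * f n
      map_add' := fun f g => by funext n; simp [mul_add]
      map_smul' := fun c f => by funext n; simp [mul_left_comm] }
    1 zero_le_one (fun f s => by
      rw [one_mul]
      refine le_trans (Finset.sum_le_sum fun n _ => ?_) (f.sum_sq_le s)
      have h1 : ‖(w n : ℂ)‖ ≤ 1 := by simpa using hw n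
      have h2 : ‖(w n : ℂ) * f n‖ ≤ ‖f n‖ := by
        rw [norm_mul]; exact mul_le_of_le_one_left (norm_nonneg _) h1
      exact pow_le_pow_left₀ (norm_nonneg _) h2 2)

/-- The forward shift `S x_n = x_{n+1}` on `ℓ²(ℕ)`. -/
def shiftOp : L2 ℕ →L[ℂ] L2 ℕ :=
  opOfCoord
    { toFun := fun f n => if n = 0 then 0 else f (n - 1)
      map_add' := fun f g => by funext n; by_cases h : n = 0 <;> simp [h]
      map_smul' := fun c f => by funext n; by_cases h : n = 0 <;> simp [h] }
    1 zero_le_one (fun f s => by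
      rw [one_mul]
      change ∑ n ∈ s, ‖(if n = 0 then 0 else f (n - 1) : ℂ)‖ ^ 2 ≤ ‖f‖ ^ 2
      calc ∑ n ∈ s, ‖(if n = 0 then 0 else f (n - 1) : ℂ)‖ ^ 2
          = ∑ n ∈ s.filter (· ≠ 0), ‖f (n - 1)‖ ^ 2 := by
            rw [Finset.sum_filter]
            refine Finset.sum_congr rfl fun n _ => ?_
            by_cases h : n = 0 <;> simp [h]
        _ = ∑ n ∈ (s.filter (· ≠ 0)).image (· - 1), ‖f n‖ ^ 2 := by
            rw [Finset.sum_image]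
            intro a ha b hb hab
            have ha' := (Finset.mem_filter.mp ha).2
            have hb' := (Finset.mem_filter.mp hb).2
            simp only at hab
            omega
        _ ≤ ‖f‖ ^ 2 := f.sum_sq_le _)

/-- The operator `C_q x_n = √(1 - q^{2n}) x_n`. -/
def opC (q : Set.Ioo (0 : ℝ) 1) : L2 ℕ →L[ℂ] L2 ℕ :=
  diagOp (fun n => Real.sqrt (1 - (q : ℝ) ^ (2 * n))) fun n => by
    have h := pow_nonneg q.2.1.le (2 * n)
    rw [abs_of_nonneg (Real.sqrt_nonneg _)]
    exact Real.sqrt_le_one.mpr (by linarith)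

/-- The operator `D_q x_n = q^n x_n`. -/
def opD (q : Set.Ioo (0 : ℝ) 1) : L2 ℕ →L[ℂ] L2 ℕ :=
  diagOp (fun n => (q : ℝ) ^ n) fun n => by
    rw [abs_of_nonneg (pow_nonneg q.2.1.le n)]
    exact pow_le_one₀ q.2.1.le q.2.2.le

/-- The orthogonal projection `P` onto the span of `x_0`. -/
def opP : L2 ℕ →L[ℂ] L2 ℕ :=
  diagOp (fun n => if n = 0 then 1 else 0) fun n => by by_cases h : n = 0 <;> simp [h]

/-- The restriction of `f ∈ ℓ²(J)`, `J ≃ κ × ℕ`, to the fibre over `a ∈ κ`. -/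
def fibre {J κ : Type} (e : J ≃ κ × ℕ) (f : L2 J) (a : κ) : L2 ℕ :=
  ⟨fun n => f (e.symm (a, n)), L2.mem (C := ‖f‖ ^ 2) fun s => by
    have h := f.sum_sq_le (s.map
      ⟨fun n => e.symm (a, n), fun m n hmn => by simpa using hmn⟩)
    rwa [Finset.sum_map] at h⟩

theorem sum_norm_fibre_le {J κ : Type} (e : J ≃ κ × ℕ) (f : L2 J) (K : Finset κ) :
    ∑ a ∈ K, ‖fibre e f a‖ ^ 2 ≤ ‖f‖ ^ 2 := by
  have hs : ∀ a, HasSum (fun n => ‖f (e.symm (a, n))‖ ^ 2) (‖fibre e f a‖ ^ 2) := fun a => by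
    have h := lp.hasSum_norm (p := 2) (by norm_num) (fibre e f a)
    simp only [ENNReal.toReal_ofNat, Real.rpow_ofNat] at h
    exact h
  have h := hasSum_sum (s := K) fun a _ => hs a
  refine le_of_tendsto h (Eventually.of_forall fun N => ?_)
  change ∑ n ∈ N, ∑ a ∈ K, ‖f (e.symm (a, n))‖ ^ 2 ≤ _
  rw [Finset.sum_comm, ← Finset.sum_product' K N (fun a n => ‖f (e.symm (a, n))‖ ^ 2)]
  have h2 := f.sum_sq_le ((K ×ˢ N).map e.symm.toEmbedding)
  rwa [Finset.sum_map] at h2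

/-- For `J ≃ κ × ℕ`, so that `ℓ²(J) = ℓ²(κ) ⊗ ℓ²(ℕ)`, the operator `I ⊗ T` on `ℓ²(J)`. -/
def onFibres {J κ : Type} (e : J ≃ κ × ℕ) (T : L2 ℕ →L[ℂ] L2 ℕ) : L2 J →L[ℂ] L2 J :=
  opOfCoord
    { toFun := fun f j => T (fibre e f (e j).1) (e j).2
      map_add' := fun f g => by
        funext j
        have h : fibre e (f + g) (e j).1 = fibre e f (e j).1 + fibre e g (e j).1 := rfl
        rw [h, T.map_add]; rfl
      map_smul' := fun c f => by
        funext j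
        have h : fibre e (c • f) (e j).1 = c • fibre e f (e j).1 := rfl
        rw [h, T.map_smul]; rfl }
    ‖T‖ (norm_nonneg _) (fun f s => by
      classical
      change ∑ j ∈ s, ‖T (fibre e f (e j).1) (e j).2‖ ^ 2 ≤ _
      have hsub : s.map e.toEmbedding ⊆
          ((s.map e.toEmbedding).image Prod.fst) ×ˢ ((s.map e.toEmbedding).image Prod.snd) :=
        Finset.subset_product
      calc ∑ j ∈ s, ‖T (fibre e f (e j).1) (e j).2‖ ^ 2
          = ∑ p ∈ s.map e.toEmbedding, ‖T (fibre e f p.1) p.2‖ ^ 2 := by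
            rw [Finset.sum_map]; rfl
        _ ≤ ∑ p ∈ ((s.map e.toEmbedding).image Prod.fst) ×ˢ
              ((s.map e.toEmbedding).image Prod.snd), ‖T (fibre e f p.1) p.2‖ ^ 2 :=
            Finset.sum_le_sum_of_subset_of_nonneg hsub fun _ _ _ => by positivity
        _ = ∑ a ∈ (s.map e.toEmbedding).image Prod.fst,
              ∑ n ∈ (s.map e.toEmbedding).image Prod.snd, ‖T (fibre e f a) n‖ ^ 2 :=
            Finset.sum_product' _ _ (fun a n => ‖T (fibre e f a) n‖ ^ 2)
        _ ≤ ∑ a ∈ (s.map e.toEmbedding).image Prod.fst, (‖T‖ * ‖fibre e f a‖) ^ 2 := by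
            refine Finset.sum_le_sum fun a _ => ((T (fibre e f a)).sum_sq_le _).trans ?_
            exact pow_le_pow_left₀ (norm_nonneg _) (T.le_opNorm _) 2
        _ = ‖T‖ ^ 2 * ∑ a ∈ (s.map e.toEmbedding).image Prod.fst, ‖fibre e f a‖ ^ 2 := by
            simp only [mul_pow, Finset.mul_sum]
        _ ≤ ‖T‖ ^ 2 * ‖f‖ ^ 2 :=
            mul_le_mul_of_nonneg_left (sum_norm_fibre_le e f _) (by positivity)
        _ = (‖T‖ * ‖f‖) ^ 2 := by ring)

/-! ## The Soibelman representation and its limit -/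

/-- The bounded operators on `ℓ²(ℕ) ⊗ ℓ²(ℕ) ⊗ ℓ²(ℕ) = ℓ²(ℕ × ℕ × ℕ)`. -/
abbrev OpThree : Type := L2 (ℕ × ℕ × ℕ) →L[ℂ] L2 (ℕ × ℕ × ℕ)

/-- `T ⊗ I ⊗ I`. -/
def legOne (T : L2 ℕ →L[ℂ] L2 ℕ) : OpThree :=
  onFibres ⟨fun x => ((x.2.1, x.2.2), x.1), fun y => (y.2, y.1.1, y.1.2), fun _ => rfl,
    fun _ => rfl⟩ T

/-- `I ⊗ T ⊗ I`. -/
def legTwo (T : L2 ℕ →L[ℂ] L2 ℕ) : OpThree :=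
  onFibres ⟨fun x => ((x.1, x.2.2), x.2.1), fun y => (y.1.1, y.2, y.1.2), fun _ => rfl,
    fun _ => rfl⟩ T

/-- `I ⊗ I ⊗ T`. -/
def legThree (T : L2 ℕ →L[ℂ] L2 ℕ) : OpThree :=
  onFibres ⟨fun x => ((x.1, x.2.1), x.2.2), fun y => (y.1.1, y.1.2, y.2), fun _ => rfl,
    fun _ => rfl⟩ T

/-- `T₁ ⊗ T₂ ⊗ T₃`. -/
def tensorThree (T₁ T₂ T₃ : L2 ℕ →L[ℂ] L2 ℕ) : OpThree := legOne T₁ * legTwo T₂ * legThree T₃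

/-- The torus `𝕋²`. -/
abbrev Torus : Type := Fin 2 → Circle

/-- The continuous functions `𝕋² → B(ℓ²(ℕ)^{⊗3})`. This C⋆-algebra contains
`C⋆(S)^{⊗3} ⊗ C(𝕋) ⊗ C(𝕋)`, identified with the continuous functions `𝕋² → C⋆(S)^{⊗3}`. -/
abbrev Ambient : Type := C(Torus, OpThree)

instance : CStarAlgebra OpThree := inferInstance

instance : CStarAlgebra Ambient := inferInstance

/-- The constant function with value `T`, i.e. `T ⊗ I ⊗ I` with `T` in the first three tensor
factors. -/
def constOp (T : OpThree) : Ambient := ContinuousMap.const Torus T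

/-- The coordinate function `z_i` on the torus, times the identity. -/
def coordFun (i : Fin 2) : Ambient :=
  ⟨fun z => ((z i : Circle) : ℂ) • (1 : OpThree), by fun_prop⟩

/-- The matrix `(π₁(t_{jk}))`. -/
def piOne (q : Set.Ioo (0 : ℝ) 1) : Matrix (Fin 3) (Fin 3) (L2 ℕ →L[ℂ] L2 ℕ) :=
  !![star shiftOp * opC q, ((q : ℝ) : ℂ) • opD q, 0;
     -opD q, opC q * shiftOp, 0;
     0, 0, 1]

/-- The matrix `(π₂(t_{jk}))`. -/
def piTwo (q : Set.Ioo (0 : ℝ) 1) : Matrix (Fin 3) (Fin 3) (L2 ℕ →L[ℂ] L2 ℕ) :=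
  !![1, 0, 0;
     0, star shiftOp * opC q, ((q : ℝ) : ℂ) • opD q;
     0, -opD q, opC q * shiftOp]

/-- The matrix `(τ₁(t_{jk}))` in the first torus coordinate: the image of `(π₁(t_{jk}))` under the
quotient map `C⋆(S) → C(𝕋)`, `S ↦ z`, by the compact operators. -/
def tauOne : Matrix (Fin 3) (Fin 3) Ambient :=
  !![star (coordFun 0), 0, 0;
     0, coordFun 0, 0;
     0, 0, 1]

/-- The matrix `(τ₂(t_{jk}))` in the second torus coordinate: the image of `(π₂(t_{jk}))` under
the quotient map `C⋆(S) → C(𝕋)`, `S ↦ z`, by the compact operators. -/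
def tauTwo : Matrix (Fin 3) (Fin 3) Ambient :=
  !![1, 0, 0;
     0, star (coordFun 1), 0;
     0, 0, coordFun 1]

/-- The matrix `(Ξ_q(t_{jk}))` of the images of the generators of `ℂ[SU(3)]_q` under the Soibelman
representation `Ξ_q = (π₁ ⊠ π₂ ⊠ π₁) ⊠ (τ₁ ⊠ τ₂)`. Since the comultiplication is
`Δ(t_{jk}) = ∑ₗ t_{jl} ⊗ t_{lk}`, the box product is the product of the matrices with entries in
the respective tensor factors. -/
def soibelman (q : Set.Ioo (0 : ℝ) 1) : Matrix (Fin 3) (Fin 3) Ambient :=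
  (piOne q).map (fun T => constOp (legOne T)) * (piTwo q).map (fun T => constOp (legTwo T)) *
    (piOne q).map (fun T => constOp (legThree T)) * (tauOne * tauTwo)

/-- The images of the generators under the Soibelman representation. With `j = 0, 1, 2` for the
index `j + 1`: index `0` gives `C_{j+1}^{ω₁} = t_{j+1,1}`, and index `1` gives
`C_{j+1}^{ω₂} = q^{-j} t_{3-j,3}^*`. -/
def soibelmanGen (q : Set.Ioo (0 : ℝ) 1) (i : Fin 2) (j : Fin 3) : Ambient :=
  if i = 0 then soibelman q j 0
  else (((q : ℝ) : ℂ) ^ (j : ℕ))⁻¹ • star (soibelman q j.rev 2)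

/-- The filter `q → 0` on `(0, 1)`. -/
def qToZero : Filter (Set.Ioo (0 : ℝ) 1) := comap (fun q => (q : ℝ)) (𝓝 0)

/-- The set of the norm limits, as `q → 0`, of the adjoints of the images of the generators. -/
def limitGenerators : Set Ambient :=
  {L | ∃ (i : Fin 2) (j : Fin 3), Tendsto (fun q => star (soibelmanGen q i j)) qToZero (𝓝 L)}

/-- The C⋆-algebra `SU₀(3)`: the norm closure of the ⋆-algebra generated by the limits. -/
def SUZero : NonUnitalStarSubalgebra ℂ Ambient :=
  (NonUnitalStarAlgebra.adjoin ℂ limitGenerators).topologicalClosure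

/-- The right action `β_t` of the torus, `β_t(f)(z) = f(t z)`. -/
def rightAction (t : Torus) (f : Ambient) : Ambient :=
  f.comp ⟨fun z => t * z, continuous_const.mul continuous_id⟩

/-- The explicit form of the limits. -/
def limitOp : Fin 2 → Fin 3 → Ambient :=
  ![![coordFun 0 * constOp (tensorThree shiftOp 1 shiftOp),
      -(coordFun 0 * constOp (tensorThree opP 1 shiftOp +
        tensorThree (star shiftOp) shiftOp opP)),
      coordFun 0 * constOp (tensorThree 1 opP opP)],
    ![coordFun 1 * constOp (tensorThree 1 shiftOp 1),
      coordFun 1 * constOp (tensorThree shiftOp opP 1),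
      coordFun 1 * constOp (tensorThree opP opP 1)]]

end

/-! Up to a sign and a factor `z₁` or `z₂`, each of the six limits permutes basis vectors of `ℓ²(ℕ ×
ℕ × ℕ)` partially. These partial maps are the labels `X`, `Y`, `Z` (blue) and `A`, `B`, `C` (red).
Every point of `ℕ × ℕ × ℕ` is in the range of exactly one blue and exactly one red label, and these
two labels name the vertex to which the point belongs. The edges thereby act on points, every point
has a unique predecessor of each color, and the prescribed squares are those on which the two
composites agree. So the category acts on points (`pointAction`).

This action carries the combinatorics. Blue-red and red-blue paths can be swapped, so factorizations
exist; an arrow of given rank with given range is determined by a single value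
(`arrow_eq_of_pointAction_eq`), so they are unique. Since points have preimages of every rank
(`exists_pointAction_eq`), the images of the arrows of rank `n` into `v` partition the points of
`v`. That is the last Cuntz-Krieger relation for the operators `z^(rank f)` times the partial
permutation of `f` (`suFamily`).

The family and the limits generate the same algebra. Vertex projections are built from the initial
projections of the labels (`constOp_vertexProj_mem`), compressing a label between two vertices gives
an edge or zero (`cut_label_apply`), and conversely a label is the sum of its edges.

Injectivity is the gauge-invariant uniqueness theorem `IsCKFamily.norm_map_eq`, here for finitely
many vertices and no sources. A homomorphism that is nonzero on the vertex projections is isometric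
in degree zero, because that part is a union of finite-dimensional algebras whose matrix
coefficients are multiples of vertex projections. Averaging over roots of unity bounds each
homogeneous component, which loses only a factor polynomial in the degree; applying this to high
powers of `star x * x` removes the factor. The right action on `SU₀(3)` supplies the compatible
torus action.

For the limits, `D_q → P` and `C_q → I - P` in norm with error at most `q`, and the shift absorbs `I
- P`. -/

noncomputable section

/-! ## Cuntz-Krieger families of graphs of rank `k` without sources -/

section GaugeUniqueness

variable {k : ℕ} {Λ : Type} [Category.{0} Λ]

/-- The Cuntz-Krieger relations for a graph of rank `k` in which every vertex receives arrows of
every rank, in a C⋆-algebra of any universe. -/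
structure IsCKFamily (F : Λ ⥤ RankCat k) {A : Type*} [NonUnitalCStarAlgebra A] (P : Λ → A)
    (S : ∀ ⦃u v : Λ⦄, (u ⟶ v) → A) : Prop where
  isProj : ∀ v, IsStarProjection (P v)
  isPartialIsometry : ∀ ⦃u v : Λ⦄ (f : u ⟶ v), S f * star (S f) * S f = S f
  ck1 : ∀ v w, v ≠ w → P v * P w = 0
  ck2 : ∀ ⦃u v w : Λ⦄ (g : u ⟶ v) (f : v ⟶ w), S f * S g = S (g ≫ f)
  ck3 : ∀ ⦃u v : Λ⦄ (f : u ⟶ v), star (S f) * S f = P u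
  ck4 : ∀ (v : Λ) (n : Fin k → ℕ) (s : Finset (Σ u : Λ, u ⟶ v)),
    (∀ f, f ∈ s ↔ arrowRank F f.2 = n) → P v = ∑ f ∈ s, S f.2 * star (S f.2)

/-- A rank strictly below `n` in some coordinate would require a source that receives no edge of
that color. So the last relation becomes a finite sum over the arrows of rank exactly `n`. -/
theorem arrowsLE_eq_of_receivesColor {F : Λ ⥤ RankCat k} (hF : ∀ v i, ReceivesColor F v i)
    (v : Λ) (n : Fin k → ℕ) : arrowsLE F v n = {f : Σ u : Λ, u ⟶ v | arrowRank F f.2 = n} := by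
  ext f
  constructor
  · rintro ⟨h1, h2⟩
    funext i
    by_contra hne
    exact h2 i (lt_of_le_of_ne (h1 i) hne) (hF _ _)
  · intro h
    have h' : arrowRank F f.2 = n := h
    exact ⟨h'.le, fun i hi => absurd hi (by rw [h']; exact lt_irrefl _)⟩

theorem CKFamily.isCKFamily {F : Λ ⥤ RankCat k} (hF : ∀ v i, ReceivesColor F v i)
    {B : Type} [NonUnitalCStarAlgebra B] (T : CKFamily F B) :
    IsCKFamily F T.P (fun _ _ f => T.S f) where
  isProj := T.isProj
  isPartialIsometry _ _ f := T.isPartialIsometry f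
  ck1 := T.ck1
  ck2 _ _ _ g f := T.ck2 g f
  ck3 _ _ f := T.ck3 f
  ck4 v n s hs := by
    have hs' : arrowsLE F v n = (s : Set (Σ u : Λ, u ⟶ v)) := by
      rw [arrowsLE_eq_of_receivesColor hF]
      ext f
      exact (hs f).symm
    rw [T.ck4 v n, hs', finsum_mem_coe_finset]

theorem CKProduct.ext {F : Λ ⥤ RankCat k} {x y : CKProduct F} (h : ∀ R, x R = y R) : x = y :=
  lp.ext (funext h)

/-- The relations hold in every coordinate of the product. `CKFamily` itself does not apply, since
the product lives in `Type 1`. -/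
theorem isCKFamily_univ {F : Λ ⥤ RankCat k} (hF : ∀ v i, ReceivesColor F v i) :
    IsCKFamily F (univP F) (fun _ _ f => univS F f) where
  isProj v := ⟨CKProduct.ext fun R => (R.fam.isProj v).isIdempotentElem,
    CKProduct.ext fun R => (R.fam.isProj v).isSelfAdjoint⟩
  isPartialIsometry _ _ f := CKProduct.ext fun R => R.fam.isPartialIsometry f
  ck1 v w h := CKProduct.ext fun R => R.fam.ck1 v w h
  ck2 _ _ _ g f := CKProduct.ext fun R => R.fam.ck2 g f
  ck3 _ _ f := CKProduct.ext fun R => R.fam.ck3 f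
  ck4 v n s hs := CKProduct.ext fun R => by
    rw [lp.coeFn_sum, Finset.sum_apply]
    exact (R.fam.isCKFamily hF).ck4 v n s hs

namespace IsCKFamily

variable {F : Λ ⥤ RankCat k} {A : Type*} [NonUnitalCStarAlgebra A] {P : Λ → A}
  {S : ∀ ⦃u v : Λ⦄, (u ⟶ v) → A}


/-- The relations do not mention identities. With `e = S (𝟙 v)` idempotent and `star e * e = P v`
one gets `P v * e = P v`, so `star (e - P v) * (e - P v) = 0` and the C⋆-identity applies. -/
theorem map_id (h : IsCKFamily F P S) (v : Λ) : S (𝟙 v) = P v := by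
  have h1 : S (𝟙 v) * S (𝟙 v) = S (𝟙 v) := by rw [h.ck2, Category.comp_id]
  have h2 := h.ck3 (𝟙 v)
  have h3 : P v * S (𝟙 v) = P v := by
    rw [← h2, mul_assoc, h1]
  have h4 : star (S (𝟙 v)) * P v = P v := by
    have := congrArg star h3
    rwa [star_mul, (h.isProj v).isSelfAdjoint.star_eq] at this
  rw [← sub_eq_zero, ← CStarRing.star_mul_self_eq_zero_iff, star_sub, sub_mul, mul_sub, mul_sub,
    (h.isProj v).isSelfAdjoint.star_eq, h2, h3, h4, (h.isProj v).isIdempotentElem.eq]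
  abel

theorem P_mul_S (h : IsCKFamily F P S) {u v : Λ} (f : u ⟶ v) : P v * S f = S f := by
  rw [← h.map_id, h.ck2, Category.comp_id]

theorem S_mul_P (h : IsCKFamily F P S) {u v : Λ} (f : u ⟶ v) : S f * P u = S f := by
  rw [← h.map_id, h.ck2, Category.id_comp]

theorem star_S_mul_P (h : IsCKFamily F P S) {u v : Λ} (f : u ⟶ v) :
    star (S f) * P v = star (S f) := by
  have := congrArg star (h.P_mul_S f)
  rwa [star_mul, (h.isProj v).isSelfAdjoint.star_eq] at this

theorem P_mul_star_S (h : IsCKFamily F P S) {u v : Λ} (f : u ⟶ v) :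
    P u * star (S f) = star (S f) := by
  have := congrArg star (h.S_mul_P f)
  rwa [star_mul, (h.isProj u).isSelfAdjoint.star_eq] at this

theorem star_S_mul_S_of_ne_range (h : IsCKFamily F P S) {u u' v v' : Λ} (f : u ⟶ v)
    (g : u' ⟶ v') (hv : v ≠ v') : star (S f) * S g = 0 := by
  rw [← h.star_S_mul_P, ← h.P_mul_S g, mul_assoc, ← mul_assoc (P v), h.ck1 v v' hv, zero_mul,
    mul_zero]

/-- Different arrows of the same rank have orthogonal ranges. -/
theorem star_S_mul_S_of_ne (h : IsCKFamily F P S) (hfin : IsRowFinite F) {v : Λ}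
    (f g : Σ u : Λ, u ⟶ v) (hr : arrowRank F f.2 = arrowRank F g.2) (hne : f ≠ g) :
    star (S f.2) * S g.2 = 0 := by
  classical
  let _ := CStarAlgebra.spectralOrder A
  have := CStarAlgebra.spectralOrderedRing A
  set s := (hfin v (arrowRank F g.2)).toFinset with hs
  have hmem : ∀ e, e ∈ s ↔ arrowRank F e.2 = arrowRank F g.2 := fun e => by simp [hs]
  -- Compressing the last relation by `S g` writes `P g.1` as a sum of positive elements. The term
  -- `e = g` already equals `P g.1`, so every other term vanishes.
  have h1 : P g.1 = ∑ e ∈ s, star (star (S e.2) * S g.2) * (star (S e.2) * S g.2) := by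
    calc P g.1 = star (S g.2) * (P v * S g.2) := by rw [h.P_mul_S, h.ck3]
      _ = _ := by
        rw [h.ck4 v _ s hmem, Finset.sum_mul, Finset.mul_sum]
        refine Finset.sum_congr rfl fun e _ => ?_
        simp only [star_mul, star_star, mul_assoc]
  rw [← Finset.add_sum_erase s _ ((hmem g).2 rfl), h.ck3,
    (h.isProj g.1).isSelfAdjoint.star_eq, (h.isProj g.1).isIdempotentElem.eq,
    left_eq_add, Finset.sum_eq_zero_iff_of_nonneg fun _ _ => star_mul_self_nonneg _] at h1
  exact CStarRing.star_mul_self_eq_zero_iff _ |>.1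
    (h1 f (Finset.mem_erase.2 ⟨hne, (hmem f).2 hr⟩))

end IsCKFamily

/-! ### Products of generators, graded by degree -/

/-- The products `S f * star (S g)` of degree `d`, where the degree is the difference of the
ranks. -/
def degreeGenerators (F : Λ ⥤ RankCat k) {A : Type*} [NonUnitalCStarAlgebra A]
    (S : ∀ ⦃u v : Λ⦄, (u ⟶ v) → A) (d : Fin k → ℤ) : Set A :=
  {x | ∃ (s v w : Λ) (f : s ⟶ v) (g : s ⟶ w),
    (∀ i, (arrowRank F f i : ℤ) - arrowRank F g i = d i) ∧ x = S f * star (S g)}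

/-- The span of the products `S f * star (S g)` of degree `d`. -/
def degreeSpace (F : Λ ⥤ RankCat k) {A : Type*} [NonUnitalCStarAlgebra A]
    (S : ∀ ⦃u v : Λ⦄, (u ⟶ v) → A) (d : Fin k → ℤ) : Submodule ℂ A :=
  Submodule.span ℂ (degreeGenerators F S d)

theorem Submodule.mul_mem_of_span {A : Type*} [NonUnitalCStarAlgebra A] {s t : Set A}
    {W : Submodule ℂ A} (hst : ∀ x ∈ s, ∀ y ∈ t, x * y ∈ W) {x y : A}
    (hx : x ∈ Submodule.span ℂ s) (hy : y ∈ Submodule.span ℂ t) : x * y ∈ W := by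
  have h1 : ∀ a ∈ s, a * y ∈ W := fun a ha => by
    induction hy using Submodule.span_induction with
    | mem b hb => exact hst a ha b hb
    | zero => rw [mul_zero]; exact W.zero_mem
    | add b c _ _ hb hc => rw [mul_add]; exact W.add_mem hb hc
    | smul r b _ hb => rw [mul_smul_comm]; exact W.smul_mem r hb
  induction hx using Submodule.span_induction with
  | mem b hb => exact h1 b hb
  | zero => rw [zero_mul]; exact W.zero_mem
  | add b c _ _ hb hc => rw [add_mul]; exact W.add_mem hb hc
  | smul r b _ hb => rw [smul_mul_assoc]; exact W.smul_mem r hb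

theorem Submodule.star_mem_of_span {A : Type*} [NonUnitalCStarAlgebra A] {s : Set A}
    {W : Submodule ℂ A} (hs : ∀ x ∈ s, star x ∈ W) {x : A}
    (hx : x ∈ Submodule.span ℂ s) : star x ∈ W := by
  induction hx using Submodule.span_induction with
  | mem b hb => exact hs b hb
  | zero => rw [star_zero]; exact W.zero_mem
  | add b c _ _ hb hc => rw [star_add]; exact W.add_mem hb hc
  | smul r b _ hb => rw [star_smul]; exact W.smul_mem _ hb

namespace IsCKFamily

variable {F : Λ ⥤ RankCat k} {A : Type*} [NonUnitalCStarAlgebra A] {P : Λ → A}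
  {S : ∀ ⦃u v : Λ⦄, (u ⟶ v) → A}

/-- Factor `l` as `l1` after `l2` with `l1` of the rank of `f`. If `l1 = f`, the product cancels to
`S l2`; otherwise the ranges of `f` and `l1` are orthogonal. -/
theorem star_S_mul_S_comp (h : IsCKFamily F P S) (hk : IsKGraph F) (hfin : IsRowFinite F)
    {u v w : Λ} (f : u ⟶ v) (l : w ⟶ v) (m : Fin k → ℕ)
    (hm : arrowRank F l = arrowRank F f + m) :
    star (S f) * S l = 0 ∨ ∃ l' : w ⟶ u, arrowRank F l' = m ∧ star (S f) * S l = S l' := by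
  obtain ⟨⟨x, l2, l1⟩, ⟨h2, h1, h3⟩, -⟩ := hk.2.2 w v l _ _ hm
  dsimp only at h1 h2 h3
  by_cases hc : (⟨u, f⟩ : Σ u : Λ, u ⟶ v) = ⟨x, l1⟩
  · cases hc
    exact Or.inr ⟨l2, h2, by rw [← h3, ← h.ck2, ← mul_assoc, h.ck3, h.P_mul_S]⟩
  · refine Or.inl ?_
    rw [← h3, ← h.ck2, ← mul_assoc, h.star_S_mul_S_of_ne hfin ⟨u, f⟩ ⟨x, l1⟩ h1.symm hc, zero_mul]

/-- In `S f * star (S g) * S f' * star (S g')` insert `P w = ∑ S l * star (S l)` over the arrows `l`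
of rank `r(g) + r(f')`. A term survives only if `l` is both `g` after some `a` and `f'` after some
`b`; it then equals `S (a ≫ f) * star (S (b ≫ g'))`. Taking the sum of the two ranks makes both
factorizations available at once. -/
theorem degreeGenerators_mul (h : IsCKFamily F P S) (hk : IsKGraph F) (hfin : IsRowFinite F)
    {d e : Fin k → ℤ} {x y : A} (hx : x ∈ degreeGenerators F S d)
    (hy : y ∈ degreeGenerators F S e) : x * y ∈ degreeSpace F S (d + e) := by
  obtain ⟨s, v, w, f, g, hd, rfl⟩ := hx
  obtain ⟨s', v', w', f', g', he, rfl⟩ := hy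
  rw [mul_assoc, ← mul_assoc (star (S g))]
  by_cases hw : w = v'
  swap
  · rw [h.star_S_mul_S_of_ne_range g f' hw, zero_mul, mul_zero]
    exact Submodule.zero_mem _
  subst hw
  have h1 := h.ck4 w (arrowRank F g + arrowRank F f')
    (hfin w (arrowRank F g + arrowRank F f')).toFinset (fun e => by simp)
  rw [← h.P_mul_S f', h1, Finset.sum_mul, Finset.mul_sum, Finset.sum_mul, Finset.mul_sum]
  refine Submodule.sum_mem _ fun l hl => ?_
  have hl' : arrowRank F l.2 = arrowRank F g + arrowRank F f' := by simpa using hl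
  obtain h2 | ⟨a, ha, h2⟩ := h.star_S_mul_S_comp hk hfin g l.2 _ hl'
  · rw [mul_assoc (S l.2), ← mul_assoc (star (S g)), h2]
    simp
  obtain h3 | ⟨b, hb, h3⟩ := h.star_S_mul_S_comp hk hfin f' l.2 (arrowRank F g) (by rw [hl', add_comm])
  · have h4 : star (S l.2) * S f' = 0 := by
      have := congrArg star h3
      rwa [star_mul, star_star, star_zero] at this
    rw [mul_assoc (S l.2), h4]
    simp
  have h4 : star (S l.2) * S f' = star (S b) := by
    have := congrArg star h3
    rwa [star_mul, star_star] at this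
  refine Submodule.subset_span ⟨l.1, v, w', a ≫ f, b ≫ g', fun i => ?_, ?_⟩
  · rw [arrowRank_comp, arrowRank_comp, ha, hb, Pi.add_apply d e, ← hd, ← he]
    simp only [Pi.add_apply, Nat.cast_add]
    ring
  · rw [mul_assoc (S l.2), h4, ← mul_assoc (star (S g)), h2, ← h.ck2, ← h.ck2, star_mul]
    simp only [mul_assoc]

theorem degreeSpace_mul (h : IsCKFamily F P S) (hk : IsKGraph F) (hfin : IsRowFinite F)
    {d e : Fin k → ℤ} {x y : A} (hx : x ∈ degreeSpace F S d)
    (hy : y ∈ degreeSpace F S e) : x * y ∈ degreeSpace F S (d + e) :=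
  Submodule.mul_mem_of_span (fun _ ha _ hb => h.degreeGenerators_mul hk hfin ha hb) hx hy

end IsCKFamily

theorem degreeGenerators_star {F : Λ ⥤ RankCat k} {A : Type*} [NonUnitalCStarAlgebra A]
    {S : ∀ ⦃u v : Λ⦄, (u ⟶ v) → A} {d : Fin k → ℤ} {x : A} (hx : x ∈ degreeGenerators F S d) :
    star x ∈ degreeGenerators F S (-d) := by
  obtain ⟨s, v, w, f, g, hd, rfl⟩ := hx
  exact ⟨s, w, v, g, f, fun i => by rw [Pi.neg_apply, ← hd]; ring, by rw [star_mul, star_star]⟩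

theorem degreeSpace_star {F : Λ ⥤ RankCat k} {A : Type*} [NonUnitalCStarAlgebra A]
    {S : ∀ ⦃u v : Λ⦄, (u ⟶ v) → A} {d : Fin k → ℤ} {x : A} (hx : x ∈ degreeSpace F S d) :
    star x ∈ degreeSpace F S (-d) :=
  Submodule.star_mem_of_span (fun _ ha => Submodule.subset_span (degreeGenerators_star ha)) hx

/-! ### Degree zero: an increasing union of finite-dimensional algebras -/

/-- The span of the products `S f * star (S g)` with `f` and `g` of rank `n`. -/
def levelSpace (F : Λ ⥤ RankCat k) {A : Type*} [NonUnitalCStarAlgebra A]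
    (S : ∀ ⦃u v : Λ⦄, (u ⟶ v) → A) (n : Fin k → ℕ) : Submodule ℂ A :=
  Submodule.span ℂ {x | ∃ (s v w : Λ) (f : s ⟶ v) (g : s ⟶ w),
    arrowRank F f = n ∧ arrowRank F g = n ∧ x = S f * star (S g)}

theorem finiteDimensional_levelSpace [Finite Λ] {F : Λ ⥤ RankCat k} (hfin : IsRowFinite F)
    {A : Type*} [NonUnitalCStarAlgebra A] (S : ∀ ⦃u v : Λ⦄, (u ⟶ v) → A) (n : Fin k → ℕ) :
    FiniteDimensional ℂ (levelSpace F S n) := by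
  have h1 : (⋃ v, (fun f : Σ u : Λ, u ⟶ v => S f.2) '' {f | arrowRank F f.2 = n}).Finite :=
    Set.finite_iUnion fun v => (hfin v n).image _
  refine FiniteDimensional.span_of_finite ℂ
    ((h1.image2 (fun x y => x * star y) h1).subset ?_)
  rintro _ ⟨s, v, w, f, g, hf, hg, rfl⟩
  exact ⟨_, Set.mem_iUnion.2 ⟨v, ⟨s, f⟩, hf, rfl⟩, _, Set.mem_iUnion.2 ⟨w, ⟨s, g⟩, hg, rfl⟩, rfl⟩

namespace IsCKFamily

variable {F : Λ ⥤ RankCat k} {A : Type*} [NonUnitalCStarAlgebra A] {P : Λ → A}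
  {S : ∀ ⦃u v : Λ⦄, (u ⟶ v) → A}

theorem star_S_mul_S (h : IsCKFamily F P S) (hfin : IsRowFinite F) {u u' v v' : Λ} (f : u ⟶ v)
    (g : u' ⟶ v') (hr : arrowRank F f = arrowRank F g) :
    star (S f) * S g = 0 ∨ ∃ _ : u = u', star (S f) * S g = P u := by
  by_cases hv : v = v'
  swap
  · exact Or.inl (h.star_S_mul_S_of_ne_range f g hv)
  subst hv
  by_cases hc : (⟨u, f⟩ : Σ u : Λ, u ⟶ v) = ⟨u', g⟩
  · cases hc
    exact Or.inr ⟨rfl, h.ck3 f⟩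
  · exact Or.inl (h.star_S_mul_S_of_ne hfin ⟨u, f⟩ ⟨u', g⟩ hr hc)

theorem levelSpace_mul (h : IsCKFamily F P S) (hfin : IsRowFinite F) {n : Fin k → ℕ} {x y : A}
    (hx : x ∈ levelSpace F S n) (hy : y ∈ levelSpace F S n) : x * y ∈ levelSpace F S n := by
  refine Submodule.mul_mem_of_span ?_ hx hy
  rintro _ ⟨s, v, w, f, g, hf, hg, rfl⟩ _ ⟨s', v', w', f', g', hf', hg', rfl⟩
  rw [mul_assoc, ← mul_assoc (star (S g))]
  obtain h1 | ⟨rfl, h1⟩ := h.star_S_mul_S hfin g f' (hg.trans hf'.symm)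
  · rw [h1, zero_mul, mul_zero]
    exact Submodule.zero_mem _
  · rw [h1, h.P_mul_star_S]
    exact Submodule.subset_span ⟨s, v, w', f, g', hf, hg', rfl⟩

/-- Inserting the last relation at the common source gives `S f * star (S g) = ∑ S (l ≫ f) * star (S
(l ≫ g))` over the arrows `l` of rank `m`. Hence any two levels lie in a common one. -/
theorem levelSpace_mono (h : IsCKFamily F P S) (hfin : IsRowFinite F) (n m : Fin k → ℕ) :
    levelSpace F S n ≤ levelSpace F S (n + m) := by
  refine Submodule.span_le.2 ?_
  rintro _ ⟨s, v, w, f, g, hf, hg, rfl⟩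
  have h1 := h.ck4 s m (hfin s m).toFinset (fun e => by simp)
  rw [← h.S_mul_P f, h1, Finset.mul_sum, Finset.sum_mul]
  refine Submodule.sum_mem _ fun l hl => ?_
  have hl' : arrowRank F l.2 = m := by simpa using hl
  refine Submodule.subset_span ⟨l.1, v, w, l.2 ≫ f, l.2 ≫ g, ?_, ?_, ?_⟩
  · rw [arrowRank_comp, hf, hl']
  · rw [arrowRank_comp, hg, hl']
  · rw [← h.ck2, ← h.ck2, star_mul]
    simp only [mul_assoc]

theorem exists_mem_levelSpace (h : IsCKFamily F P S) (hfin : IsRowFinite F) {x : A}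
    (hx : x ∈ degreeSpace F S 0) : ∃ n, x ∈ levelSpace F S n := by
  induction hx using Submodule.span_induction with
  | mem b hb =>
    obtain ⟨s, v, w, f, g, hd, rfl⟩ := hb
    refine ⟨arrowRank F f, Submodule.subset_span ⟨s, v, w, f, g, rfl, ?_, rfl⟩⟩
    funext i
    have := hd i
    rw [Pi.zero_apply] at this
    omega
  | zero => exact ⟨0, Submodule.zero_mem _⟩
  | add b c _ _ hb hc =>
    obtain ⟨n, hn⟩ := hb
    obtain ⟨m, hm⟩ := hc
    refine ⟨n + m, Submodule.add_mem _ (h.levelSpace_mono hfin n m hn) ?_⟩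
    rw [add_comm]
    exact h.levelSpace_mono hfin m n hm
  | smul r b _ hb =>
    obtain ⟨n, hn⟩ := hb
    exact ⟨n, Submodule.smul_mem _ r hn⟩

/-- The C⋆-algebra spanned by the products `S f * star (S g)` with `f` and `g` of rank `n`. -/
def levelAlgebra (h : IsCKFamily F P S) (hfin : IsRowFinite F) (n : Fin k → ℕ) :
    NonUnitalStarSubalgebra ℂ A where
  __ := levelSpace F S n
  mul_mem' hx hy := h.levelSpace_mul hfin hx hy
  star_mem' hx := Submodule.star_mem_of_span (fun x hx => by
    obtain ⟨s, v, w, f, g, hf, hg, rfl⟩ := hx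
    exact Submodule.subset_span ⟨s, w, v, g, f, hg, hf, by rw [star_mul, star_star]⟩) hx

/-- The matrix coefficients of an element of level `n` are multiples of vertex projections. -/
theorem star_S_mul_mul_S_mem (h : IsCKFamily F P S) (hfin : IsRowFinite F) {n : Fin k → ℕ} {x : A}
    (hx : x ∈ levelSpace F S n) {u u' v v' : Λ} (f : u ⟶ v) (g : u' ⟶ v')
    (hf : arrowRank F f = n) (hg : arrowRank F g = n) :
    star (S f) * x * S g ∈ Submodule.span ℂ {P u} := by
  induction hx using Submodule.span_induction with
  | mem b hb =>
    obtain ⟨s, w, w', a, b, ha, hb, rfl⟩ := hb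
    rw [← mul_assoc, mul_assoc]
    obtain h1 | ⟨rfl, h1⟩ := h.star_S_mul_S hfin f a (hf.trans ha.symm)
    · simp [h1]
    obtain h2 | ⟨rfl, h2⟩ := h.star_S_mul_S hfin b g (hb.trans hg.symm)
    · simp [h2]
    · rw [h1, h2, (h.isProj u).isIdempotentElem.eq]
      exact Submodule.mem_span_singleton_self _
  | zero => simp
  | add b c _ _ hb hc => rw [mul_add, add_mul]; exact Submodule.add_mem _ hb hc
  | smul r b _ hb => rw [mul_smul_comm, smul_mul_assoc]; exact Submodule.smul_mem _ r hb

theorem sum_P_mul [Fintype Λ] (h : IsCKFamily F P S) {n : Fin k → ℕ} {x : A}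
    (hx : x ∈ levelSpace F S n) : (∑ v, P v) * x = x := by
  classical
  induction hx using Submodule.span_induction with
  | mem b hb =>
    obtain ⟨s, v, w, f, g, hf, hg, rfl⟩ := hb
    rw [Finset.sum_mul, Finset.sum_eq_single v, ← mul_assoc, h.P_mul_S]
    · intro v' _ hv'
      rw [← h.P_mul_S f, ← mul_assoc, ← mul_assoc, h.ck1 _ _ hv', zero_mul, zero_mul]
    · simp
  | zero => rw [mul_zero]
  | add b c _ _ hb hc => rw [mul_add, hb, hc]
  | smul r b _ hb => rw [mul_smul_comm, hb]

/-- The sum of the vertex projections is a unit for the level, and it equals `∑ S m * star (S m)`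
over all arrows of rank `n`. Inserting it on both sides recovers `x` from its matrix coefficients.
-/
theorem eq_zero_of_forall_star_S_mul_mul_S [Finite Λ] (h : IsCKFamily F P S)
    (hfin : IsRowFinite F) {n : Fin k → ℕ} {x : A} (hx : x ∈ levelSpace F S n)
    (h0 : ∀ (u u' v v' : Λ) (f : u ⟶ v) (g : u' ⟶ v'), arrowRank F f = n → arrowRank F g = n →
      star (S f) * x * S g = 0) : x = 0 := by
  have := Fintype.ofFinite Λ
  have hsa : star (∑ v, P v) = ∑ v, P v := by
    rw [star_sum]
    exact Finset.sum_congr rfl fun v _ => (h.isProj v).isSelfAdjoint.star_eq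
  have h1 : x * (∑ v, P v) = x := by
    have h2 := h.sum_P_mul ((h.levelAlgebra hfin n).star_mem' hx)
    have h3 := congrArg star h2
    rwa [star_mul, star_star, hsa] at h3
  have h4 : ∀ v, x * P v = 0 := fun v => by
    rw [h.ck4 v n (hfin v n).toFinset (fun e => by simp), Finset.mul_sum]
    refine Finset.sum_eq_zero fun l hl => ?_
    rw [← h.sum_P_mul hx, ← mul_assoc, Finset.sum_mul, Finset.sum_mul, Finset.sum_mul]
    refine Finset.sum_eq_zero fun w _ => ?_
    rw [h.ck4 w n (hfin w n).toFinset (fun e => by simp), Finset.sum_mul, Finset.sum_mul,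
      Finset.sum_mul]
    refine Finset.sum_eq_zero fun m hm => ?_
    rw [mul_assoc (S m.2), mul_assoc (S m.2),
      h0 _ _ _ _ m.2 l.2 (by simpa using hm) (by simpa using hl), mul_zero, zero_mul]
  rw [← h1, Finset.mul_sum]
  exact Finset.sum_eq_zero fun v _ => h4 v

/-- A matrix coefficient of an element of the kernel is `c • P u` with `c • π (P u) = 0`, hence `c =
0`. So `π` is injective on each level. -/
theorem norm_map_of_mem_degreeSpace_zero [Finite Λ] (h : IsCKFamily F P S) (hfin : IsRowFinite F)
    {B : Type*} [NonUnitalCStarAlgebra B] (π : A →⋆ₙₐ[ℂ] B) (hπ : ∀ v, π (P v) ≠ 0) {x : A}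
    (hx : x ∈ degreeSpace F S 0) : ‖π x‖ = ‖x‖ := by
  obtain ⟨n, hn⟩ := h.exists_mem_levelSpace hfin hx
  -- A finite-dimensional level is closed, hence a C⋆-algebra, on which an injective ⋆-homomorphism
  -- is isometric.
  have := finiteDimensional_levelSpace hfin S n
  have hcl : IsClosed (h.levelAlgebra hfin n : Set A) :=
    (levelSpace F S n).closed_of_finiteDimensional
  let ψ : h.levelAlgebra hfin n →⋆ₙₐ[ℂ] B :=
    π.comp (NonUnitalStarSubalgebraClass.subtype (h.levelAlgebra hfin n))
  have hψ : Function.Injective ψ := by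
    rw [injective_iff_map_eq_zero]
    rintro ⟨y, hy⟩ hy0
    have hy0' : π y = 0 := hy0
    refine Subtype.ext (h.eq_zero_of_forall_star_S_mul_mul_S hfin hy fun u u' v v' f g hf hg => ?_)
    obtain ⟨c, hc⟩ := Submodule.mem_span_singleton.1 (h.star_S_mul_mul_S_mem hfin hy f g hf hg)
    have h1 : c • π (P u) = 0 := by
      rw [← map_smul, hc, map_mul, map_mul, hy0', mul_zero, zero_mul]
    rw [← hc, (smul_eq_zero.1 h1).resolve_right (hπ u), zero_smul]
  exact NonUnitalStarAlgHom.norm_map ψ hψ ⟨x, hn⟩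

end IsCKFamily
-- Homogeneous components and gauge-invariant uniqueness
/-- The degrees with coordinates of absolute value at most `N`. -/
def degreeBox (k N : ℕ) : Finset (Fin k → ℤ) :=
  Finset.Icc (fun _ => -(N : ℤ)) (fun _ => (N : ℤ))

theorem mem_degreeBox {N : ℕ} {d : Fin k → ℤ} : d ∈ degreeBox k N ↔ ∀ i, |d i| ≤ N := by
  simp only [degreeBox, Finset.mem_Icc, Pi.le_def, abs_le, forall_and]

theorem card_degreeBox (k N : ℕ) : (degreeBox k N).card = (2 * N + 1) ^ k := by
  rw [degreeBox, Pi.card_Icc]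
  simp only [Int.card_Icc, Finset.prod_const, Finset.card_univ, Fintype.card_fin]
  congr 1
  omega

/-- Orthogonality of the characters of the group of `M`-th roots of unity. -/
theorem sum_zpow_primitiveRoot {M : ℕ} {ζ : ℂ} (hζ : IsPrimitiveRoot ζ M) {e : ℤ}
    (he : |e| < M) : ∑ j : Fin M, (ζ ^ (j : ℕ)) ^ e = if e = 0 then (M : ℂ) else 0 := by
  split_ifs with h0
  · simp [h0]
  have h1 : ζ ^ e ≠ 1 := fun h1 => by
    have := (hζ.zpow_eq_one_iff_dvd e).1 h1
    exact h0 (Int.eq_zero_of_abs_lt_dvd this he)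
  have h2 : ∀ j : Fin M, (ζ ^ (j : ℕ)) ^ e = (ζ ^ e) ^ (j : ℕ) := fun j => by
    rw [← zpow_natCast, ← zpow_natCast, ← zpow_mul, ← zpow_mul, mul_comm]
  rw [Finset.sum_congr rfl fun j _ => h2 j, Fin.sum_univ_eq_sum_range (fun j => (ζ ^ e) ^ j),
    geom_sum_eq h1, ← zpow_natCast, ← zpow_mul, mul_comm, zpow_mul, zpow_natCast, hζ.pow_eq_one]
  simp

theorem sum_prod_zpow_primitiveRoot {M : ℕ} {ζ : ℂ} (hζ : IsPrimitiveRoot ζ M) {e : Fin k → ℤ}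
    (he : ∀ i, |e i| < M) :
    ∑ j : Fin k → Fin M, ∏ i, (ζ ^ (j i : ℕ)) ^ e i = if e = 0 then (M : ℂ) ^ k else 0 := by
  classical
  rw [← Fintype.piFinset_univ, ← Finset.prod_univ_sum (fun _ => Finset.univ)
    (fun i (j : Fin M) => (ζ ^ (j : ℕ)) ^ e i)]
  simp only [sum_zpow_primitiveRoot hζ (he _)]
  split_ifs with h0
  · simp [h0]
  · obtain ⟨i, hi⟩ := Function.ne_iff.1 h0
    exact Finset.prod_eq_zero (Finset.mem_univ i) (if_neg hi)

/-- A homogeneous component of a finite sum is bounded by the sum. -/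
theorem norm_component_le {B : Type*} [NonUnitalCStarAlgebra B]
    (β : (Fin k → Circle) → B →⋆ₙₐ[ℂ] B) {N : ℕ} (c : (Fin k → ℤ) → B)
    (hc : ∀ t d, β t (c d) = (∏ i, (t i : ℂ) ^ d i) • c d) {d : Fin k → ℤ}
    (hd : d ∈ degreeBox k N) : ‖c d‖ ≤ ‖∑ e ∈ degreeBox k N, c e‖ := by
  -- Two degrees in the box differ by at most `2 * N < M` in each coordinate, so the `M`-th roots of
  -- unity separate them.
  set M := 2 * N + 1 with hM
  set y := ∑ e ∈ degreeBox k N, c e with hy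
  have hζ : IsPrimitiveRoot (Complex.exp (2 * Real.pi * Complex.I / M)) M :=
    Complex.isPrimitiveRoot_exp M (by omega)
  set ζ := Complex.exp (2 * Real.pi * Complex.I / M)
  have hζ1 : ‖ζ‖ = 1 := hζ.norm'_eq_one (by omega)
  have hζ0 : ζ ≠ 0 := fun h0 => by simp [h0] at hζ1
  let τ : (Fin k → Fin M) → Fin k → Circle := fun j i =>
    ⟨ζ ^ (j i : ℕ), mem_sphere_zero_iff_norm.2 (by rw [norm_pow, hζ1, one_pow])⟩
  -- Fourier inversion on the finite group of `M`-th roots of unity to the power `k`. A finite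
  -- average in place of an integral needs no continuity of `β`, and each of its `M ^ k` terms has
  -- norm at most `‖y‖`.
  have key : ((M : ℂ) ^ k) • c d = ∑ j, (∏ i, (ζ ^ (j i : ℕ)) ^ (-d i)) • β (τ j) y := by
    simp only [hy, map_sum, hc, Finset.smul_sum, smul_smul, ← Finset.prod_mul_distrib]
    rw [Finset.sum_comm]
    have h1 : ∀ e ∈ degreeBox k N,
        ∑ j : Fin k → Fin M, (∏ i, (ζ ^ (j i : ℕ)) ^ (-d i) * ((τ j i : Circle) : ℂ) ^ e i) • c e
          = if e = d then ((M : ℂ) ^ k) • c e else 0 := fun e he => by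
      rw [← Finset.sum_smul]
      have h2 : ∀ j : Fin k → Fin M, ∏ i, (ζ ^ (j i : ℕ)) ^ (-d i) * ((τ j i : Circle) : ℂ) ^ e i =
          ∏ i, (ζ ^ (j i : ℕ)) ^ ((e - d) i) := fun j => by
        refine Finset.prod_congr rfl fun i _ => ?_
        change (ζ ^ (j i : ℕ)) ^ (-d i) * (ζ ^ (j i : ℕ)) ^ e i = _
        rw [← zpow_add₀ (pow_ne_zero _ hζ0), Pi.sub_apply, neg_add_eq_sub]
      rw [Finset.sum_congr rfl fun j _ => h2 j, sum_prod_zpow_primitiveRoot hζ]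
      · simp only [sub_eq_zero, ite_smul, zero_smul]
      · intro i
        have h3 := abs_le.1 (mem_degreeBox.1 hd i)
        have h4 := abs_le.1 (mem_degreeBox.1 he i)
        rw [Pi.sub_apply, abs_lt]
        push_cast [hM]
        omega
    rw [Finset.sum_congr rfl h1, Finset.sum_ite_eq' (degreeBox k N) d, if_pos hd]
  have hM0 : (0 : ℝ) < (M : ℝ) ^ k := by positivity
  have h5 : (M : ℝ) ^ k * ‖c d‖ ≤ (M : ℝ) ^ k * ‖y‖ := by
    calc (M : ℝ) ^ k * ‖c d‖ = ‖((M : ℂ) ^ k) • c d‖ := by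
          rw [norm_smul, norm_pow, Complex.norm_natCast]
      _ ≤ ∑ j : Fin k → Fin M, ‖y‖ := by
          rw [key]
          refine norm_sum_le_of_le _ fun j _ => ?_
          rw [norm_smul, norm_prod]
          simp only [norm_zpow, norm_pow, hζ1, one_pow, one_zpow, Finset.prod_const_one, one_mul]
          exact NonUnitalStarAlgHom.norm_apply_le (β (τ j)) y
      _ = (M : ℝ) ^ k * ‖y‖ := by simp
  exact le_of_mul_le_mul_left h5 hM0

/-- The span of the products `S f * star (S g)` with degree in a box. -/
def boxSpace (F : Λ ⥤ RankCat k) {A : Type*} [NonUnitalCStarAlgebra A]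
    (S : ∀ ⦃u v : Λ⦄, (u ⟶ v) → A) (N : ℕ) : Submodule ℂ A :=
  Submodule.span ℂ {x | ∃ d ∈ degreeBox k N, x ∈ degreeGenerators F S d}

theorem degreeSpace_le_boxSpace {F : Λ ⥤ RankCat k} {A : Type*} [NonUnitalCStarAlgebra A]
    {S : ∀ ⦃u v : Λ⦄, (u ⟶ v) → A} {N : ℕ} {d : Fin k → ℤ} (hd : d ∈ degreeBox k N) :
    degreeSpace F S d ≤ boxSpace F S N :=
  Submodule.span_mono fun _ hx => ⟨d, hd, hx⟩

theorem boxSpace_mono {F : Λ ⥤ RankCat k} {A : Type*} [NonUnitalCStarAlgebra A]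
    {S : ∀ ⦃u v : Λ⦄, (u ⟶ v) → A} {N N' : ℕ} (h : N ≤ N') : boxSpace F S N ≤ boxSpace F S N' := by
  refine Submodule.span_mono ?_
  rintro x ⟨d, hd, hx⟩
  exact ⟨d, mem_degreeBox.2 fun i => (mem_degreeBox.1 hd i).trans (by exact_mod_cast h), hx⟩

theorem exists_components {F : Λ ⥤ RankCat k} {A : Type*} [NonUnitalCStarAlgebra A]
    {S : ∀ ⦃u v : Λ⦄, (u ⟶ v) → A} {N : ℕ} {x : A} (hx : x ∈ boxSpace F S N) :
    ∃ c : (Fin k → ℤ) → A, (∀ d, c d ∈ degreeSpace F S d) ∧ x = ∑ d ∈ degreeBox k N, c d := by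
  classical
  induction hx using Submodule.span_induction with
  | mem b hb =>
    obtain ⟨d, hd, hb⟩ := hb
    refine ⟨Pi.single d b, fun e => ?_, ?_⟩
    · by_cases he : e = d
      · subst he
        rw [Pi.single_eq_same]
        exact Submodule.subset_span hb
      · rw [Pi.single_eq_of_ne he]
        exact Submodule.zero_mem _
    · rw [Finset.sum_pi_single', if_pos hd]
  | zero => exact ⟨0, fun d => Submodule.zero_mem _, by simp⟩
  | add b b' _ _ hb hb' =>
    obtain ⟨c, hc, rfl⟩ := hb
    obtain ⟨c', hc', rfl⟩ := hb'
    exact ⟨c + c', fun d => Submodule.add_mem _ (hc d) (hc' d), by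
      simp [Finset.sum_add_distrib]⟩
  | smul r b _ hb =>
    obtain ⟨c, hc, rfl⟩ := hb
    exact ⟨r • c, fun d => Submodule.smul_mem _ r (hc d), by simp [Finset.smul_sum]⟩

theorem boxSpace_star {F : Λ ⥤ RankCat k} {A : Type*} [NonUnitalCStarAlgebra A]
    {S : ∀ ⦃u v : Λ⦄, (u ⟶ v) → A} {N : ℕ} {x : A} (hx : x ∈ boxSpace F S N) :
    star x ∈ boxSpace F S N := by
  refine Submodule.star_mem_of_span ?_ hx
  rintro y ⟨d, hd, hy⟩
  refine Submodule.subset_span ⟨-d, mem_degreeBox.2 fun i => ?_, degreeGenerators_star hy⟩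
  rw [Pi.neg_apply, abs_neg]
  exact mem_degreeBox.1 hd i

/-- Numbers whose powers grow at most polynomially are at most `1`. -/
theorem le_of_pow_two_pow_le {a b : ℝ} (hb : 0 ≤ b) (k N : ℕ)
    (h : ∀ m : ℕ, a ^ 2 ^ m ≤ ((2 * (2 ^ m * N) + 1 : ℕ) : ℝ) ^ k * b ^ 2 ^ m) : a ≤ b := by
  by_contra! hlt
  have ha0 : 0 < a := hb.trans_lt hlt
  set r := b / a with hr
  have hr0 : 0 ≤ r := by positivity
  have hr1 : r < 1 := (div_lt_one ha0).2 hlt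
  -- Dividing by `a ^ n` with `n = 2 ^ m` leaves `1 ≤ (2 * N + 1) ^ k * (n ^ k * r ^ n)`, whose
  -- right side tends to `0` because `r < 1`.
  have h1 : ∀ m : ℕ, 1 ≤ (2 * N + 1 : ℝ) ^ k * (((2 ^ m : ℕ) : ℝ) ^ k * r ^ 2 ^ m) := fun m => by
    have h2 : (a ^ 2 ^ m : ℝ) ≠ 0 := by positivity
    have h3 : ((2 * (2 ^ m * N) + 1 : ℕ) : ℝ) ≤ (2 * N + 1) * ((2 ^ m : ℕ) : ℝ) := by
      have : (1 : ℝ) ≤ 2 ^ m := one_le_pow₀ (by norm_num)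
      push_cast
      nlinarith
    rw [hr, div_pow, ← mul_assoc, ← mul_pow, ← mul_div_assoc, le_div_iff₀ (by positivity), one_mul]
    exact (h m).trans (by gcongr)
  have h4 : Tendsto (fun n : ℕ => (n : ℝ) ^ k * r ^ n) atTop (𝓝 0) :=
    tendsto_pow_const_mul_const_pow_of_abs_lt_one k (by rwa [abs_of_nonneg hr0])
  have h5 := (h4.comp (tendsto_pow_atTop_atTop_of_one_lt (by norm_num : (1 : ℕ) < 2))).const_mul
    ((2 * N + 1 : ℝ) ^ k)
  rw [mul_zero] at h5
  exact absurd (ge_of_tendsto' h5 h1) (by norm_num)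

namespace IsCKFamily

variable {F : Λ ⥤ RankCat k} {A : Type*} [NonUnitalCStarAlgebra A] {P : Λ → A}
  {S : ∀ ⦃u v : Λ⦄, (u ⟶ v) → A}

theorem boxSpace_mul (h : IsCKFamily F P S) (hk : IsKGraph F) (hfin : IsRowFinite F)
    {N M : ℕ} {x y : A} (hx : x ∈ boxSpace F S N) (hy : y ∈ boxSpace F S M) :
    x * y ∈ boxSpace F S (N + M) := by
  refine Submodule.mul_mem_of_span ?_ hx hy
  rintro a ⟨d, hd, ha⟩ b ⟨e, he, hb⟩
  refine degreeSpace_le_boxSpace (mem_degreeBox.2 fun i => ?_)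
    (h.degreeGenerators_mul hk hfin ha hb)
  rw [Pi.add_apply, Nat.cast_add]
  exact (abs_add_le _ _).trans (add_le_add (mem_degreeBox.1 hd i) (mem_degreeBox.1 he i))

theorem P_mem_degreeSpace (h : IsCKFamily F P S) (v : Λ) : P v ∈ degreeSpace F S 0 :=
  Submodule.subset_span ⟨v, v, v, 𝟙 v, 𝟙 v, fun i => by simp, by
    rw [h.map_id, (h.isProj v).isSelfAdjoint.star_eq, (h.isProj v).isIdempotentElem.eq]⟩

theorem S_mem_degreeSpace (h : IsCKFamily F P S) {u v : Λ} (f : u ⟶ v) :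
    S f ∈ degreeSpace F S (fun i => arrowRank F f i) :=
  Submodule.subset_span ⟨u, v, u, f, 𝟙 u, fun i => by
    have : arrowRank F (𝟙 u) = 0 := by
      unfold arrowRank
      rw [F.map_id]
      rfl
    simp [this], by
    rw [h.map_id, (h.isProj u).isSelfAdjoint.star_eq, h.S_mul_P]⟩

theorem exists_mem_boxSpace_of_mem_adjoin (h : IsCKFamily F P S) (hk : IsKGraph F)
    (hfin : IsRowFinite F) {x : A}
    (hx : x ∈ NonUnitalStarAlgebra.adjoin ℂ
      {x | (∃ v, x = P v) ∨ ∃ (u v : Λ) (f : u ⟶ v), x = S f}) : ∃ N, x ∈ boxSpace F S N := by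
  induction hx using NonUnitalStarAlgebra.adjoin_induction with
  | mem b hb =>
    obtain ⟨v, rfl⟩ | ⟨u, v, f, rfl⟩ := hb
    · exact ⟨0, degreeSpace_le_boxSpace (mem_degreeBox.2 fun i => by simp) (h.P_mem_degreeSpace v)⟩
    · refine ⟨∑ i, arrowRank F f i, degreeSpace_le_boxSpace (mem_degreeBox.2 fun i => ?_)
        (h.S_mem_degreeSpace f)⟩
      rw [Nat.abs_cast, Nat.cast_le]
      exact Finset.single_le_sum (f := arrowRank F f) (fun _ _ => Nat.zero_le _) (Finset.mem_univ i)
  | zero => exact ⟨0, Submodule.zero_mem _⟩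
  | add b b' _ _ hb hb' =>
    obtain ⟨N, hN⟩ := hb
    obtain ⟨M, hM⟩ := hb'
    exact ⟨N + M, Submodule.add_mem _ (boxSpace_mono (by omega) hN) (boxSpace_mono (by omega) hM)⟩
  | mul b b' _ _ hb hb' =>
    obtain ⟨N, hN⟩ := hb
    obtain ⟨M, hM⟩ := hb'
    exact ⟨N + M, h.boxSpace_mul hk hfin hN hM⟩
  | smul r b _ hb =>
    obtain ⟨N, hN⟩ := hb
    exact ⟨N, Submodule.smul_mem _ r hN⟩
  | star b _ hb =>
    obtain ⟨N, hN⟩ := hb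
    exact ⟨N, boxSpace_star hN⟩

/-- For a homogeneous component `c d` the element `star (c d) * c d` has degree zero, so `π`
preserves its norm and hence that of `c d`. Averaging gives `‖π (c d)‖ ≤ ‖π x‖`, and the box
contains `(2 * N + 1) ^ k` degrees. -/
theorem norm_le_card_mul_norm_map [Finite Λ] (h : IsCKFamily F P S) (hk : IsKGraph F)
    (hfin : IsRowFinite F) {B : Type*} [NonUnitalCStarAlgebra B] (π : A →⋆ₙₐ[ℂ] B)
    (hπ : ∀ v, π (P v) ≠ 0) (β : (Fin k → Circle) → B →⋆ₙₐ[ℂ] B)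
    (hβ : ∀ t (u v : Λ) (f : u ⟶ v),
      β t (π (S f)) = (torusMonomial t (arrowRank F f) : ℂ) • π (S f))
    {N : ℕ} {x : A} (hx : x ∈ boxSpace F S N) : ‖x‖ ≤ ((2 * N + 1 : ℕ) : ℝ) ^ k * ‖π x‖ := by
  obtain ⟨c, hc, rfl⟩ := exists_components hx
  have h1 : ∀ t d, β t (π (c d)) = (∏ i, (t i : ℂ) ^ d i) • π (c d) := fun t d => by
    have hcd := hc d
    generalize c d = y at hcd ⊢
    induction hcd using Submodule.span_induction with
    | mem b hb =>
      obtain ⟨s, v, w, f, g, hd, rfl⟩ := hb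
      simp only [map_mul, map_star, hβ, star_smul, smul_mul_assoc, mul_smul_comm, smul_smul]
      congr 1
      simp only [torusMonomial, ← hd]
      have hs : ∀ z : Circle, star (z : ℂ) = (z : ℂ)⁻¹ := fun z =>
        (Circle.coe_inv_eq_conj z).symm
      have h2 : ∀ n : Fin k → ℕ, ((∏ i, t i ^ n i : Circle) : ℂ) = ∏ i, (t i : ℂ) ^ n i := fun n =>
        map_prod Circle.coeHom (fun i => t i ^ n i) Finset.univ
      rw [hs, h2, h2, ← Finset.prod_inv_distrib, ← Finset.prod_mul_distrib]
      refine Finset.prod_congr rfl fun i _ => ?_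
      rw [zpow_sub₀ (Circle.coe_ne_zero _), zpow_natCast, zpow_natCast, mul_comm, div_eq_mul_inv]
    | zero => simp
    | add b b' _ _ hb hb' => rw [map_add, map_add, hb, hb', smul_add]
    | smul r b _ hb => rw [map_smul, map_smul, hb, smul_comm]
  have h2 : ∀ d ∈ degreeBox k N, ‖c d‖ ≤ ‖π (∑ d ∈ degreeBox k N, c d)‖ := fun d hd => by
    have h3 : ‖π (star (c d) * c d)‖ = ‖star (c d) * c d‖ :=
      h.norm_map_of_mem_degreeSpace_zero hfin π hπ (by
        have := h.degreeSpace_mul hk hfin (degreeSpace_star (hc d)) (hc d)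
        rwa [neg_add_cancel] at this)
    rw [map_mul, map_star, CStarRing.norm_star_mul_self, CStarRing.norm_star_mul_self] at h3
    rw [← (mul_self_inj (norm_nonneg _) (norm_nonneg _)).1 h3, map_sum]
    exact norm_component_le β (fun d => π (c d)) h1 hd
  calc ‖∑ d ∈ degreeBox k N, c d‖ ≤ ∑ d ∈ degreeBox k N, ‖π (∑ d ∈ degreeBox k N, c d)‖ :=
        norm_sum_le_of_le _ h2
    _ = _ := by rw [Finset.sum_const, card_degreeBox, nsmul_eq_mul]; push_cast; rfl

/-- The gauge-invariant uniqueness theorem: on the ⋆-algebra generated by a Cuntz-Krieger family,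
a ⋆-homomorphism that does not vanish on the vertex projections and admits a compatible gauge
action is isometric. -/
theorem norm_map_eq [Finite Λ] (h : IsCKFamily F P S) (hk : IsKGraph F)
    (hfin : IsRowFinite F) {B : Type*} [NonUnitalCStarAlgebra B] (π : A →⋆ₙₐ[ℂ] B)
    (hπ : ∀ v, π (P v) ≠ 0) (β : (Fin k → Circle) → B →⋆ₙₐ[ℂ] B)
    (hβ : ∀ t (u v : Λ) (f : u ⟶ v),
      β t (π (S f)) = (torusMonomial t (arrowRank F f) : ℂ) • π (S f))
    {x : A} (hx : x ∈ NonUnitalStarAlgebra.adjoin ℂ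
      {x | (∃ v, x = P v) ∨ ∃ (u v : Λ) (f : u ⟶ v), x = S f}) : ‖π x‖ = ‖x‖ := by
  refine le_antisymm (NonUnitalStarAlgHom.norm_apply_le π x) ?_
  obtain ⟨N, hN⟩ := h.exists_mem_boxSpace_of_mem_adjoin hk hfin hx
  -- Squaring `m` times doubles the box each time, while the norm of a self-adjoint element is
  -- squared exactly. The polynomial factor thus becomes negligible against the power `2 ^ m`.
  have key : ∀ (m N : ℕ) (y : A), IsSelfAdjoint y → y ∈ boxSpace F S N →
      ‖y‖ ^ 2 ^ m ≤ ((2 * (2 ^ m * N) + 1 : ℕ) : ℝ) ^ k * ‖π y‖ ^ 2 ^ m := by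
    intro m
    induction m with
    | zero =>
      intro N y _ hy
      simpa using h.norm_le_card_mul_norm_map hk hfin π hπ β hβ hy
    | succ m ih =>
      intro N y hy hyN
      have h1 := ih (N + N) (y * y) (by
        rw [IsSelfAdjoint, star_mul, hy.star_eq]) (h.boxSpace_mul hk hfin hyN hyN)
      have hπy : IsSelfAdjoint (π y) := hy.map π
      rw [map_mul, hy.norm_mul_self, hπy.norm_mul_self, ← pow_mul, ← pow_mul, ← pow_succ'] at h1
      rwa [pow_succ 2 m, mul_assoc, two_mul N, ← pow_succ]
  -- The bound for self-adjoint elements is applied to `star x * x`, which lies in the box of size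
  -- `N + N`.
  have h2 := fun m => key m (N + N) (star x * x) (IsSelfAdjoint.star_mul_self x)
    (h.boxSpace_mul hk hfin (boxSpace_star hN) hN)
  have h3 := le_of_pow_two_pow_le (norm_nonneg _) k (N + N) h2
  rw [map_mul, map_star, CStarRing.norm_star_mul_self, CStarRing.norm_star_mul_self] at h3
  exact (mul_self_le_mul_self_iff (norm_nonneg _) (norm_nonneg _)).2 h3

end IsCKFamily
end GaugeUniqueness

/-! ## The action of the 2-graph on `ℕ × ℕ × ℕ` -/

/-- The vertex to which a point of `ℕ × ℕ × ℕ` belongs. -/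
def pointVertex : ℕ × ℕ × ℕ → SUVertex
  | (0, 0, 0) => .CZ
  | (_ + 1, 0, 0) => .BZ
  | (0, 0, _ + 1) => .CY
  | (_ + 1, 0, _ + 1) => .BX
  | (0, _ + 1, _) => .AY
  | (_ + 1, _ + 1, 0) => .AY
  | (_ + 1, _ + 1, _ + 1) => .AX

/-- The action of an edge with a given label on the points that belong to its source. -/
def labelMap : SULabel → ℕ × ℕ × ℕ → ℕ × ℕ × ℕ
  | .X, (a, b, c) => (a + 1, b, c + 1)
  | .Y, (0, b, c) => (0, b, c + 1)
  -- This is the summand `S* ⊗ S ⊗ P`: at the sources of `Y` a positive first coordinate forces `c =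
  -- 0`.
  | .Y, (a + 1, b, c) => (a, b + 1, c)
  | .Z, p => p
  | .A, (a, b, c) => (a, b + 1, c)
  | .B, (a, b, c) => (a + 1, b, c)
  | .C, p => p

/-- The unique preimage of a point under the edges of a given color. -/
def pointPred : SUColor → ℕ × ℕ × ℕ → ℕ × ℕ × ℕ
  | .blue, (a + 1, b, c + 1) => (a, b, c)
  | .blue, (0, b, c + 1) => (0, b, c)
  | .blue, (a, b + 1, 0) => (a + 1, b, 0)
  | .blue, (a, 0, 0) => (a, 0, 0)
  | .red, (a, b + 1, c) => (a, b, c)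
  | .red, (a + 1, 0, c) => (a, 0, c)
  | .red, (0, 0, c) => (0, 0, c)

theorem pointVertex_labelMap {col : SUColor} {l : SULabel} {p : ℕ × ℕ × ℕ} {v : SUVertex}
    (h : edgeLabel col (pointVertex p) v = some l) : pointVertex (labelMap l p) = v := by
  obtain ⟨_ | a, _ | b, _ | c⟩ := p <;> cases col <;> cases v <;>
    simp [pointVertex, edgeLabel] at h <;> subst h <;>
    -- `Y` lowers the first coordinate `a + 1` to `a`, which may be zero, so the vertex of the image
    -- is found only after a further split.
    first | rfl | (cases a <;> rfl)

theorem pointPred_labelMap {col : SUColor} {l : SULabel} {p : ℕ × ℕ × ℕ} {v : SUVertex}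
    (h : edgeLabel col (pointVertex p) v = some l) : pointPred col (labelMap l p) = p := by
  obtain ⟨_ | a, _ | b, _ | c⟩ := p <;> cases col <;> cases v <;>
    simp [pointVertex, edgeLabel] at h <;> subst h <;>
    first | rfl | (cases a <;> rfl)

theorem exists_labelMap_pointPred (col : SUColor) (p : ℕ × ℕ × ℕ) :
    ∃ l, edgeLabel col (pointVertex (pointPred col p)) (pointVertex p) = some l ∧
      labelMap l (pointPred col p) = p := by
  obtain ⟨_ | _ | a, _ | _ | b, _ | _ | c⟩ := p <;> cases col <;>
    exact ⟨_, rfl, rfl⟩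

/-- This is a check on each vertex. For an ambiguous pair of end points the two pairings of paths
act differently on points, and `h` admits only the one on which the composites agree. -/
theorem labelMap_comm {p : ℕ × ℕ × ℕ} {v v' w : SUVertex} {lb lr lr' lb' : SULabel}
    (hb : edgeLabel .blue (pointVertex p) v = some lb) (hr : edgeLabel .red v w = some lr)
    (hr' : edgeLabel .red (pointVertex p) v' = some lr') (hb' : edgeLabel .blue v' w = some lb')
    (h : IsAmbiguousPair (pointVertex p) w → AmbiguousSquare (pointVertex p) w lb lr lr' lb') :
    labelMap lr (labelMap lb p) = labelMap lb' (labelMap lr' p) := by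
  obtain ⟨_ | a, _ | b, _ | c⟩ := p <;>
  cases v <;> simp [pointVertex, edgeLabel] at hb <;> subst hb <;>
  cases w <;> simp [edgeLabel] at hr <;> subst hr <;>
  cases v' <;> simp [pointVertex, edgeLabel] at hr' <;> subst hr' <;>
  simp [edgeLabel] at hb' <;> subst hb' <;>
  first
  | rfl
  | (exfalso; simp [IsAmbiguousPair, pointVertex] at h; cases h)

/-- This is the existence of factorizations in rank `(1, 1)`. The middle vertex of the swapped path
is found by trying all six; at an ambiguous pair `constructor` selects the prescribed square. -/
theorem exists_swap_blue_red {y x v : SUVertex} {lb lr : SULabel}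
    (hb : edgeLabel .blue y x = some lb) (hr : edgeLabel .red x v = some lr) :
    ∃ y' lr' lb', edgeLabel .red y y' = some lr' ∧ edgeLabel .blue y' v = some lb' ∧
      (IsAmbiguousPair y v → AmbiguousSquare y v lb lr lr' lb') := by
  cases y <;> cases x <;> simp [edgeLabel] at hb <;> subst hb <;>
  cases v <;> simp [edgeLabel] at hr <;> subst hr <;>
  first
  | (refine ⟨.CZ, _, _, rfl, rfl, fun h => ?_⟩; first | constructor | (simp [IsAmbiguousPair] at h; done))
  | (refine ⟨.BZ, _, _, rfl, rfl, fun h => ?_⟩; first | constructor | (simp [IsAmbiguousPair] at h; done))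
  | (refine ⟨.CY, _, _, rfl, rfl, fun h => ?_⟩; first | constructor | (simp [IsAmbiguousPair] at h; done))
  | (refine ⟨.BX, _, _, rfl, rfl, fun h => ?_⟩; first | constructor | (simp [IsAmbiguousPair] at h; done))
  | (refine ⟨.AY, _, _, rfl, rfl, fun h => ?_⟩; first | constructor | (simp [IsAmbiguousPair] at h; done))
  | (refine ⟨.AX, _, _, rfl, rfl, fun h => ?_⟩; first | constructor | (simp [IsAmbiguousPair] at h; done))

theorem exists_swap_red_blue {y x v : SUVertex} {lr lb : SULabel}
    (hr : edgeLabel .red y x = some lr) (hb : edgeLabel .blue x v = some lb) :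
    ∃ y' lb' lr', edgeLabel .blue y y' = some lb' ∧ edgeLabel .red y' v = some lr' ∧
      (IsAmbiguousPair y v → AmbiguousSquare y v lb' lr' lr lb) := by
  cases y <;> cases x <;> simp [edgeLabel] at hr <;> subst hr <;>
  cases v <;> simp [edgeLabel] at hb <;> subst hb <;>
  first
  | (refine ⟨.CZ, _, _, rfl, rfl, fun h => ?_⟩; first | constructor | (simp [IsAmbiguousPair] at h; done))
  | (refine ⟨.BZ, _, _, rfl, rfl, fun h => ?_⟩; first | constructor | (simp [IsAmbiguousPair] at h; done))
  | (refine ⟨.CY, _, _, rfl, rfl, fun h => ?_⟩; first | constructor | (simp [IsAmbiguousPair] at h; done))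
  | (refine ⟨.BX, _, _, rfl, rfl, fun h => ?_⟩; first | constructor | (simp [IsAmbiguousPair] at h; done))
  | (refine ⟨.AY, _, _, rfl, rfl, fun h => ?_⟩; first | constructor | (simp [IsAmbiguousPair] at h; done))
  | (refine ⟨.AX, _, _, rfl, rfl, fun h => ?_⟩; first | constructor | (simp [IsAmbiguousPair] at h; done))

/-- The action of the 2-graph on the points of `ℕ × ℕ × ℕ`. -/
def pointAction : SUGraph ⥤ Type :=
  CategoryTheory.Quotient.lift SUSquare
    (Paths.lift
      { obj := fun v => {p : ℕ × ℕ × ℕ // pointVertex p = v}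
        map := fun {u v} (e : SUEdge u v) => ↾ fun x => ⟨labelMap e.label x.1,
          pointVertex_labelMap (by rw [x.2]; exact e.isEdge)⟩ })
    (by
      rintro _ _ _ _ ⟨b, r, r', b', hb, hr, hr', hb', h⟩
      rw [Functor.map_comp, Functor.map_comp]
      erw [Paths.lift_toPath, Paths.lift_toPath, Paths.lift_toPath, Paths.lift_toPath]
      ext p
      have hp : pointVertex p.1 = _ := p.2
      exact Subtype.ext (labelMap_comm (by rw [hp, ← hb]; exact b.isEdge) (hr ▸ r.isEdge)
        (by rw [hp, ← hr']; exact r'.isEdge) (hb' ▸ b'.isEdge) (by rw [hp]; exact h)))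

/-! ## Unique factorization in the 2-graph -/

/-- The coordinate of the rank that counts the edges of a given color. -/
def colorIndex : SUColor → Fin 2
  | .blue => 0
  | .red => 1

theorem colorRank_eq_single (col : SUColor) : colorRank col = Pi.single (colorIndex col) 1 := by
  cases col <;> (funext i; fin_cases i <;> rfl)

theorem exists_colorIndex_eq (i : Fin 2) : ∃ col, colorIndex col = i := by
  fin_cases i
  · exact ⟨.blue, rfl⟩
  · exact ⟨.red, rfl⟩

/-- An edge as an arrow of the 2-graph. -/
def edgeArrow {u v : SUVertex} (e : SUEdge u v) : (⟨u⟩ : SUGraph) ⟶ ⟨v⟩ :=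
  (CategoryTheory.Quotient.functor SUSquare).map ((Paths.of SUVertex).map e)

theorem SUEdge.ext_of_color {u v : SUVertex} {e e' : SUEdge u v} (h : e.color = e'.color) :
    e = e' := by
  obtain ⟨c, l, h1⟩ := e
  obtain ⟨c', l', h2⟩ := e'
  obtain rfl : c = c' := h
  obtain rfl : l = l' := Option.some.inj (h1.symm.trans h2)
  rfl

theorem arrowRank_id {k : ℕ} {Λ : Type} [Category.{0} Λ] (F : Λ ⥤ RankCat k) (v : Λ) :
    arrowRank F (𝟙 v) = 0 := by
  unfold arrowRank
  rw [F.map_id]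
  rfl

theorem arrowRank_edgeArrow {u v : SUVertex} (e : SUEdge u v) :
    arrowRank suRank (edgeArrow e) = colorRank e.color :=
  add_zero (colorRank e.color)

theorem arrowRank_comp_edgeArrow {u v : SUGraph} {w : SUVertex} (g : u ⟶ ⟨w⟩)
    (e : SUEdge w v.as) : arrowRank suRank (show u ⟶ v from g ≫ edgeArrow e) =
      colorRank e.color + arrowRank suRank g :=
  (arrowRank_comp suRank g (edgeArrow e)).trans
    (congrArg (· + arrowRank suRank g) (arrowRank_edgeArrow e))

theorem SUGraph.arrow_induction {u : SUGraph} {motive : ∀ {v : SUGraph}, (u ⟶ v) → Prop}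
    (id : motive (𝟙 u))
    (comp : ∀ {w v : SUVertex} (f : u ⟶ ⟨w⟩) (e : SUEdge w v), motive f → motive (f ≫ edgeArrow e))
    {v : SUGraph} (f : u ⟶ v) : motive f := by
  obtain ⟨u⟩ := u
  obtain ⟨v⟩ := v
  obtain ⟨p, rfl⟩ := (CategoryTheory.Quotient.functor SUSquare).map_surjective f
  induction p using Paths.induction_fixed_source with
  | id => exact id
  | comp p q hp => exact comp _ q hp

theorem exists_swap_edges {u v w : SUVertex} (e : SUEdge u v) (e' : SUEdge v w)
    (h : e.color ≠ e'.color) : ∃ (v' : SUVertex) (g : SUEdge u v') (g' : SUEdge v' w),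
      g'.color = e.color ∧ edgeArrow e ≫ edgeArrow e' = edgeArrow g ≫ edgeArrow g' := by
  obtain ⟨c, l, he⟩ := e
  obtain ⟨c', l', he'⟩ := e'
  cases c <;> cases c'
  · exact absurd rfl h
  · obtain ⟨v', lr, lb, h1, h2, h3⟩ := exists_swap_blue_red he he'
    exact ⟨v', ⟨.red, lr, h1⟩, ⟨.blue, lb, h2⟩, rfl,
      CategoryTheory.Quotient.sound SUSquare (SUSquare.comm (u := u) (v := v) (v' := v') (w := w)
        ⟨.blue, l, he⟩ ⟨.red, l', he'⟩ ⟨.red, lr, h1⟩ ⟨.blue, lb, h2⟩ rfl rfl rfl rfl h3)⟩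
  · obtain ⟨v', lb, lr, h1, h2, h3⟩ := exists_swap_red_blue he he'
    exact ⟨v', ⟨.blue, lb, h1⟩, ⟨.red, lr, h2⟩, rfl,
      (CategoryTheory.Quotient.sound SUSquare (SUSquare.comm (u := u) (v := v') (v' := v) (w := w)
        ⟨.blue, lb, h1⟩ ⟨.red, lr, h2⟩ ⟨.red, l, he⟩ ⟨.blue, l', he'⟩ rfl rfl rfl rfl h3)).symm⟩
  · exact absurd rfl h

/-- An arrow that contains an edge of a given color ends with an edge of that color. -/
theorem exists_eq_comp_edgeArrow {u v : SUGraph} (f : u ⟶ v) (col : SUColor)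
    (h : arrowRank suRank f (colorIndex col) ≠ 0) :
    ∃ (w : SUVertex) (g : u ⟶ ⟨w⟩) (e : SUEdge w v.as), e.color = col ∧ f = g ≫ edgeArrow e := by
  induction f using SUGraph.arrow_induction with
  | id => exact absurd (by rw [arrowRank_id]; rfl) h
  | @comp w v f e ih =>
    by_cases hc : e.color = col
    · exact ⟨w, f, e, hc, rfl⟩
    have hf : arrowRank suRank f (colorIndex col) ≠ 0 := by
      rw [arrowRank_comp, arrowRank_edgeArrow, Pi.add_apply, colorRank_eq_single] at h
      rwa [Pi.single_eq_of_ne (by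
        intro h2
        apply hc
        revert h2
        cases e.color <;> cases col <;> simp [colorIndex]), zero_add] at h
    obtain ⟨x, g, e', he', rfl⟩ := ih hf
    -- By induction `f` ends with an edge of color `col`. Swapping it with the last edge `e`, which
    -- has the other color, moves it to the end.
    obtain ⟨y, a, b, hb, hab⟩ := exists_swap_edges e' e (by rw [he']; exact Ne.symm hc)
    exact ⟨y, g ≫ edgeArrow a, b, hb.trans he', by rw [Category.assoc, hab, Category.assoc]⟩

theorem eq_id_of_arrowRank_eq_zero {u v : SUGraph} (f : u ⟶ v) (h : arrowRank suRank f = 0) :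
    (⟨u, f⟩ : Σ u, u ⟶ v) = ⟨v, 𝟙 v⟩ := by
  induction f using SUGraph.arrow_induction with
  | id => rfl
  | comp f e _ =>
    rw [arrowRank_comp, arrowRank_edgeArrow, colorRank_eq_single] at h
    have := congrFun h (colorIndex e.color)
    simp at this

theorem exists_eq_add_single {n : Fin 2 → ℕ} (h : n ≠ 0) :
    ∃ (col : SUColor) (m : Fin 2 → ℕ), n = colorRank col + m := by
  obtain ⟨i, hi⟩ := Function.ne_iff.1 h
  obtain ⟨col, rfl⟩ := exists_colorIndex_eq i
  refine ⟨col, n - colorRank col, (add_tsub_cancel_of_le fun j => ?_).symm⟩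
  rw [colorRank_eq_single]
  by_cases hj : j = colorIndex col
  · subst hj
    rw [Pi.single_eq_same]
    exact Nat.one_le_iff_ne_zero.2 hi
  · rw [Pi.single_eq_of_ne hj]
    exact Nat.zero_le _

/-- A nonzero rank has a positive coordinate, from which the rank of an edge can be split off; the
total of the coordinates decreases. -/
theorem rank_induction {motive : (Fin 2 → ℕ) → Prop} (zero : motive 0)
    (add : ∀ (col : SUColor) (m : Fin 2 → ℕ), motive m → motive (colorRank col + m))
    (n : Fin 2 → ℕ) : motive n := by
  have : ∀ (N : ℕ) (n : Fin 2 → ℕ), ∑ i, n i = N → motive n := by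
    intro N
    induction N with
    | zero =>
      intro n hn
      have : n = 0 := funext fun i => by
        simpa using (Finset.sum_eq_zero_iff.1 hn) i (Finset.mem_univ i)
      rwa [this]
    | succ N ih =>
      intro n hn
      obtain ⟨col, m, rfl⟩ := exists_eq_add_single (n := n) (by rintro rfl; simp at hn)
      refine add col m (ih m ?_)
      simp only [Pi.add_apply, Finset.sum_add_distrib, colorRank_eq_single, Finset.sum_pi_single',
        Finset.mem_univ, if_true] at hn
      omega
  exact this _ n rfl

theorem exists_eq_comp_of_arrowRank {u v : SUGraph} {f : u ⟶ v} {col : SUColor} {m : Fin 2 → ℕ}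
    (h : arrowRank suRank f = colorRank col + m) :
    ∃ (w : SUVertex) (g : u ⟶ ⟨w⟩) (e : SUEdge w v.as), e.color = col ∧ arrowRank suRank g = m ∧
      f = g ≫ edgeArrow e := by
  obtain ⟨w, g, e, he, rfl⟩ := exists_eq_comp_edgeArrow f col (by
    rw [h, colorRank_eq_single]
    simp)
  refine ⟨w, g, e, he, ?_, rfl⟩
  have h2 := (arrowRank_comp_edgeArrow g e).symm.trans h
  rw [he] at h2
  exact add_left_cancel h2

/-- Arrows of the same rank are equal if they have a common value on points. -/
theorem arrow_eq_of_pointAction_eq (n : Fin 2 → ℕ) : ∀ {u u' v : SUGraph} (f : u ⟶ v) (f' : u' ⟶ v)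
    (x : pointAction.obj u) (x' : pointAction.obj u'), arrowRank suRank f = n →
      arrowRank suRank f' = n → (pointAction.map f x).1 = (pointAction.map f' x').1 →
      (⟨u, f⟩ : Σ u, u ⟶ v) = ⟨u', f'⟩ ∧ x.1 = x'.1 := by
  induction n using rank_induction with
  | zero =>
    intro u u' v f f' x x' hf hf' h
    cases eq_id_of_arrowRank_eq_zero f hf
    cases eq_id_of_arrowRank_eq_zero f' hf'
    rw [pointAction.map_id] at h
    exact ⟨rfl, h⟩
  | add col m ih =>
    intro u u' v f f' x x' hf hf' h
    obtain ⟨w, g, e, he, hg, rfl⟩ := exists_eq_comp_of_arrowRank hf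
    obtain ⟨w', g', e', he', hg', rfl⟩ := exists_eq_comp_of_arrowRank hf'
    rw [pointAction.map_comp, pointAction.map_comp] at h
    change labelMap e.label (pointAction.map g x).1 = labelMap e'.label (pointAction.map g' x').1 at h
    have h1 : pointVertex (pointAction.map g x).1 = w := (pointAction.map g x).2
    have h1' : pointVertex (pointAction.map g' x').1 = w' := (pointAction.map g' x').2
    -- Both last edges have color `col`, and `pointPred col` inverts every edge of that color. The
    -- intermediate points therefore agree; so do their vertices, and an edge is determined by its
    -- color and end points.
    have h2 : (pointAction.map g x).1 = (pointAction.map g' x').1 := by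
      have h5 := pointPred_labelMap (col := col) (l := e.label) (p := (pointAction.map g x).1)
        (v := v.as) (by rw [h1, ← he]; exact e.isEdge)
      have h5' := pointPred_labelMap (col := col) (l := e'.label) (p := (pointAction.map g' x').1)
        (v := v.as) (by rw [h1', ← he']; exact e'.isEdge)
      rw [← h5, h, h5']
    obtain rfl : w = w' := by rw [← h1, ← h1', h2]
    obtain ⟨h3, h4⟩ := ih g g' x x' hg hg' h2
    cases h3
    obtain rfl := SUEdge.ext_of_color (he.trans he'.symm)
    exact ⟨rfl, h4⟩

/-- Every point is the image of a point under an arrow of any given rank. -/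
theorem exists_pointAction_eq (n : Fin 2 → ℕ) : ∀ {v : SUGraph} (y : pointAction.obj v),
    ∃ (u : SUGraph) (f : u ⟶ v) (x : pointAction.obj u), arrowRank suRank f = n ∧
      pointAction.map f x = y := by
  induction n using rank_induction with
  | zero => exact fun {v} y => ⟨v, 𝟙 v, y, arrowRank_id _ _, by rw [pointAction.map_id]; rfl⟩
  | add col m ih =>
    rintro v ⟨p, hp⟩
    obtain rfl : v = ⟨pointVertex p⟩ := by
      rw [show pointVertex p = v.as from hp]
    obtain ⟨l, h1, h2⟩ := exists_labelMap_pointPred col p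
    obtain ⟨u, f, x, hf, hx⟩ := @ih ⟨pointVertex (pointPred col p)⟩ ⟨pointPred col p, rfl⟩
    let e : SUEdge (pointVertex (pointPred col p)) (pointVertex p) := ⟨col, l, h1⟩
    refine ⟨u, f ≫ edgeArrow e, x, ?_, ?_⟩
    · rw [arrowRank_comp, arrowRank_edgeArrow, hf]
    · rw [pointAction.map_comp]
      change pointAction.map (edgeArrow e) (pointAction.map f x) = _
      rw [hx]
      exact Subtype.ext h2

/-- The edges that make up `a` are split off one by one at the range end, in any order of colors,
since an arrow can be made to end with any color that occurs in its rank. -/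
theorem exists_factorization {a : Fin 2 → ℕ} : ∀ {b : Fin 2 → ℕ} {u w : SUGraph} (f : u ⟶ w),
    arrowRank suRank f = a + b → ∃ p : Σ v : SUGraph, (u ⟶ v) × (v ⟶ w),
      arrowRank suRank p.2.1 = b ∧ arrowRank suRank p.2.2 = a ∧ p.2.1 ≫ p.2.2 = f := by
  induction a using rank_induction with
  | zero =>
    intro b u w f hf
    exact ⟨⟨w, f, 𝟙 w⟩, by simpa using hf, arrowRank_id _ _, Category.comp_id f⟩
  | add col m ih =>
    intro b u w f hf
    rw [add_assoc] at hf
    obtain ⟨x, g, e, he, hg, rfl⟩ := exists_eq_comp_of_arrowRank hf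
    obtain ⟨⟨v, g1, g2⟩, h1, h2, h3⟩ := ih g hg
    refine ⟨⟨v, g1, g2 ≫ edgeArrow e⟩, h1, ?_, ?_⟩
    · dsimp only at h2
      exact (arrowRank_comp_edgeArrow g2 e).trans (by rw [h2, he])
    · dsimp only at h3 ⊢
      rw [← Category.assoc, h3]

/-! ### Finiteness and the axioms of a 2-graph -/

instance : Finite SUVertex :=
  Finite.of_surjective (fun i : Fin 6 => match i with
    | 0 => SUVertex.CZ | 1 => .BZ | 2 => .CY | 3 => .BX | 4 => .AY | 5 => .AX) fun v => by
    cases v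
    exacts [⟨0, rfl⟩, ⟨1, rfl⟩, ⟨2, rfl⟩, ⟨3, rfl⟩, ⟨4, rfl⟩, ⟨5, rfl⟩]

instance : Finite SUColor :=
  Finite.of_surjective (fun i : Bool => match i with | true => SUColor.blue | false => .red)
    fun v => by
      cases v
      exacts [⟨true, rfl⟩, ⟨false, rfl⟩]

instance (u v : SUVertex) : Finite (SUEdge u v) :=
  Finite.of_injective SUEdge.color fun _ _ h => SUEdge.ext_of_color h

instance : Finite SUGraph :=
  Finite.of_injective (β := SUVertex) (fun v : SUGraph => v.as) fun u v h => by
    cases u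
    cases v
    exact congrArg _ h

theorem isRowFinite_suRank : IsRowFinite suRank := by
  intro v n
  induction n using rank_induction generalizing v with
  | zero =>
    refine (Set.finite_singleton (⟨v, 𝟙 v⟩ : Σ u, u ⟶ v)).subset ?_
    rintro ⟨u, f⟩ hf
    exact eq_id_of_arrowRank_eq_zero f hf
  | add col m ih =>
    have hE : ∀ w : SUVertex, Finite (SUEdge w v.as) := fun w => inferInstanceAs
      (Finite (SUEdge w (show SUVertex from v.as)))
    have h1 : (⋃ (w : SUVertex) (e : SUEdge w v.as),
        (fun f : Σ u : SUGraph, u ⟶ ⟨w⟩ => (⟨f.1, f.2 ≫ edgeArrow e⟩ : Σ u, u ⟶ v)) ''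
          {f | arrowRank suRank f.2 = m}).Finite :=
      Set.finite_iUnion fun w => Set.finite_iUnion fun e => (ih ⟨w⟩).image _
    refine h1.subset ?_
    rintro ⟨u, f⟩ hf
    obtain ⟨w, g, e, -, hg, h2⟩ := exists_eq_comp_of_arrowRank hf
    exact Set.mem_iUnion.2 ⟨w, Set.mem_iUnion.2 ⟨e, ⟨u, g⟩, hg, congrArg (Sigma.mk u) h2.symm⟩⟩

/-- Every vertex contains a point, and every point has a preimage of each rank. Absence of sources
also makes local convexity immediate. -/
theorem receivesColor_suRank (v : SUGraph) (i : Fin 2) : ReceivesColor suRank v i := by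
  obtain ⟨col, rfl⟩ := exists_colorIndex_eq i
  have h1 : ∃ p, pointVertex p = v.as := by
    obtain ⟨v⟩ := v
    cases v
    exacts [⟨(0, 0, 0), rfl⟩, ⟨(1, 0, 0), rfl⟩, ⟨(0, 0, 1), rfl⟩, ⟨(1, 0, 1), rfl⟩,
      ⟨(0, 1, 0), rfl⟩, ⟨(1, 1, 1), rfl⟩]
  obtain ⟨p, hp⟩ := h1
  obtain ⟨u, f, -, hf, -⟩ := exists_pointAction_eq (colorRank col) (v := v) ⟨p, hp⟩
  exact ⟨u, f, by rw [hf, colorRank_eq_single]⟩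

theorem isLocallyConvex_suRank : IsLocallyConvex suRank :=
  fun i j _ u u' _ _ _ _ _ => ⟨receivesColor_suRank u i, receivesColor_suRank u' j⟩

theorem nonempty_pointAction (v : SUGraph) : Nonempty (pointAction.obj v) := by
  obtain ⟨v⟩ := v
  cases v
  exacts [⟨⟨(0, 0, 0), rfl⟩⟩, ⟨⟨(1, 0, 0), rfl⟩⟩, ⟨⟨(0, 0, 1), rfl⟩⟩, ⟨⟨(1, 0, 1), rfl⟩⟩,
      ⟨⟨(0, 1, 0), rfl⟩⟩, ⟨⟨(1, 1, 1), rfl⟩⟩]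

/-- For uniqueness, two factorizations of an arrow are evaluated at one point. The final factors
have a common value, so they agree and so do the intermediate points; then the initial factors agree
as well. -/
theorem isKGraph_suRank : IsKGraph suRank := by
  refine ⟨inferInstance, fun u v => ?_, fun u w f a b hf => ?_⟩
  · have h1 : (⋃ n, {f : Σ u : SUGraph, u ⟶ v | arrowRank suRank f.2 = n}).Countable :=
      Set.countable_iUnion fun n => (isRowFinite_suRank v n).countable
    have h2 : Countable (Σ u : SUGraph, u ⟶ v) :=
      Set.countable_univ_iff.1 (h1.mono fun f _ => Set.mem_iUnion.2 ⟨arrowRank suRank f.2, rfl⟩)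
    exact Function.Injective.countable (f := fun f : u ⟶ v => (⟨u, f⟩ : Σ u : SUGraph, u ⟶ v))
      fun f g h => eq_of_heq (Sigma.mk.inj h).2
  · obtain ⟨p, hp⟩ := exists_factorization f hf
    refine ⟨p, hp, ?_⟩
    obtain ⟨v, g, h⟩ := p
    obtain ⟨hg, hh, rfl⟩ := hp
    rintro ⟨v', g', h'⟩ ⟨hg', hh', he⟩
    dsimp only at hg hh hg' hh' he
    obtain ⟨x⟩ := nonempty_pointAction u
    have h1 : (pointAction.map h (pointAction.map g x)).1 =
        (pointAction.map h' (pointAction.map g' x)).1 := by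
      have h2 : (pointAction.map (g ≫ h) x) = (pointAction.map (g' ≫ h') x) := by rw [he]
      rw [pointAction.map_comp, pointAction.map_comp] at h2
      exact congrArg Subtype.val h2
    obtain ⟨h3, h4⟩ := arrow_eq_of_pointAction_eq a h h' _ _ hh hh' h1
    cases h3
    obtain ⟨h5, -⟩ := arrow_eq_of_pointAction_eq b g g' x x hg hg' h4
    cases h5
    rfl

/-! ## Operators on `ℓ²` that permute basis vectors -/

theorem norm_opOfCoord_le {ι κ : Type} (T : L2 ι →ₗ[ℂ] (κ → ℂ)) (C : ℝ) (hC : 0 ≤ C)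
    (h : ∀ (f : L2 ι) (s : Finset κ), ∑ i ∈ s, ‖T f i‖ ^ 2 ≤ (C * ‖f‖) ^ 2) :
    ‖opOfCoord T C hC h‖ ≤ C :=
  LinearMap.mkContinuous_norm_le _ hC _

theorem L2.op_ext {ι κ : Type} {T T' : L2 ι →L[ℂ] L2 κ} (h : ∀ f i, T f i = T' f i) : T = T' :=
  ContinuousLinearMap.ext fun f => lp.ext (funext (h f))

/-- The partial isometry of `ℓ²(J)` that maps the basis vector `x_p` to `x_{f p}` if `f p` is
defined and to `0` otherwise. -/
def partialPerm {J : Type} (f : PEquiv J J) : L2 J →L[ℂ] L2 J :=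
  opOfCoord
    -- Moving `x_q` to `x_{f q}` means that the coordinate of the image at `p` is that of `ξ` at the
    -- preimage of `p`.
    { toFun := fun ξ p => (f.symm p).elim 0 ξ
      map_add' := fun ξ η => by
        funext p
        change (f.symm p).elim 0 (ξ + η) = (f.symm p).elim 0 ξ + (f.symm p).elim 0 η
        cases f.symm p
        · exact (add_zero 0).symm
        · rfl
      map_smul' := fun c ξ => by
        funext p
        change (f.symm p).elim 0 (c • ξ) = c * (f.symm p).elim 0 ξ
        cases f.symm p
        · exact (mul_zero c).symm
        · rfl }
    1 zero_le_one (fun ξ s => by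
      classical
      rw [one_mul]
      change ∑ p ∈ s, ‖(f.symm p).elim 0 ξ‖ ^ 2 ≤ ‖ξ‖ ^ 2
      calc ∑ p ∈ s, ‖(f.symm p).elim 0 ξ‖ ^ 2
          = ∑ p ∈ s.filter (fun p => (f.symm p).isSome), ‖ξ ((f.symm p).getD p)‖ ^ 2 := by
            rw [Finset.sum_filter]
            refine Finset.sum_congr rfl fun p _ => ?_
            cases h : f.symm p <;> simp
        _ = ∑ q ∈ (s.filter (fun p => (f.symm p).isSome)).image (fun p => (f.symm p).getD p),
              ‖ξ q‖ ^ 2 := by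
            rw [Finset.sum_image]
            intro p hp p' hp' h
            obtain ⟨q, hq⟩ := Option.isSome_iff_exists.1 (Finset.mem_filter.1 hp).2
            obtain ⟨q', hq'⟩ := Option.isSome_iff_exists.1 (Finset.mem_filter.1 hp').2
            simp only [hq, hq', Option.getD_some] at h
            subst h
            exact f.symm.inj hq hq'
        _ ≤ ‖ξ‖ ^ 2 := ξ.sum_sq_le _)

theorem partialPerm_apply {J : Type} (f : PEquiv J J) (ξ : L2 J) (p : J) :
    partialPerm f ξ p = (f.symm p).elim 0 ξ := rfl

theorem partialPerm_mul {J : Type} (f g : PEquiv J J) :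
    partialPerm g * partialPerm f = partialPerm (f.trans g) :=
  L2.op_ext fun ξ p => by
    change partialPerm g (partialPerm f ξ) p = _
    rw [partialPerm_apply, partialPerm_apply, PEquiv.symm_trans_rev]
    change _ = ((g.symm p).bind f.symm).elim 0 ξ
    cases g.symm p <;> rfl

theorem L2.inner_single_one {J : Type} [DecidableEq J] (p : J) (ξ : L2 J) :
    inner ℂ (lp.single 2 p (1 : ℂ) : L2 J) ξ = ξ p := by
  rw [lp.inner_single_left]
  simp

/-- The coordinate of the adjoint's value at `p` is the inner product of `partialPerm f x_p` with
`ξ`, and `partialPerm f x_p` is a basis vector or zero. -/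
theorem star_partialPerm {J : Type} (f : PEquiv J J) :
    star (partialPerm f) = partialPerm f.symm := by
  classical
  refine L2.op_ext fun ξ p => ?_
  have h1 : partialPerm f (lp.single 2 p (1 : ℂ)) =
      (f p).elim 0 (fun q => (lp.single 2 q (1 : ℂ) : L2 J)) := by
    refine lp.ext (funext fun q => ?_)
    rw [partialPerm_apply]
    cases h : f.symm q with
    | none =>
      cases h' : f p with
      | none => rfl
      | some q' =>
        have hne : q ≠ q' := by
          rintro rfl
          rw [f.eq_some_iff.2 h'] at h
          cases h
        exact (lp.single_apply_ne (E := fun _ : J => ℂ) 2 q' (1 : ℂ) hne).symm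
    | some p' =>
      have h2 : f p' = some q := f.eq_some_iff.1 h
      by_cases hp : p' = p
      · subst hp
        rw [h2]
        exact (lp.single_apply_self (E := fun _ : J => ℂ) 2 p' (1 : ℂ)).trans (lp.single_apply_self (E := fun _ : J => ℂ) 2 q (1 : ℂ)).symm
      · refine (lp.single_apply_ne (E := fun _ : J => ℂ) 2 p (1 : ℂ) hp).trans ?_
        cases h' : f p with
        | none => rfl
        | some q' =>
          have hne : q ≠ q' := by
            rintro rfl
            exact hp (f.inj h2 h')
          exact (lp.single_apply_ne (E := fun _ : J => ℂ) 2 q' (1 : ℂ) hne).symm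
  rw [← L2.inner_single_one p (star (partialPerm f) ξ), ContinuousLinearMap.star_eq_adjoint,
    ContinuousLinearMap.adjoint_inner_right, h1, partialPerm_apply, PEquiv.symm_symm]
  cases f p with
  | none => exact inner_zero_left _
  | some q => exact L2.inner_single_one q ξ

/-- The inner product of `ℓ²(J)` is the sum of the inner products over the fibres, and `I ⊗ T` acts
as `T` on each fibre. -/
theorem star_onFibres {J κ : Type} (e : J ≃ κ × ℕ) (T : L2 ℕ →L[ℂ] L2 ℕ) :
    star (onFibres e T) = onFibres e (star T) := by
  have key : ∀ ξ η : L2 J, HasSum (fun a => inner ℂ (fibre e ξ a) (fibre e η a)) (inner ℂ ξ η) := by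
    intro ξ η
    have h1 : HasSum (fun x : κ × ℕ => inner ℂ (ξ (e.symm x)) (η (e.symm x))) (inner ℂ ξ η) :=
      e.symm.hasSum_iff.2 (lp.hasSum_inner (𝕜 := ℂ) ξ η)
    exact h1.prod_fiberwise fun a => lp.hasSum_inner (fibre e ξ a) (fibre e η a)
  have hf : ∀ (T : L2 ℕ →L[ℂ] L2 ℕ) (ξ : L2 J) (a : κ), fibre e (onFibres e T ξ) a = T (fibre e ξ a) := by
    intro T ξ a
    refine lp.ext (funext fun n => ?_)
    change T (fibre e ξ (e (e.symm (a, n))).1) (e (e.symm (a, n))).2 = _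
    rw [Equiv.apply_symm_apply]
  rw [ContinuousLinearMap.star_eq_adjoint, eq_comm, ContinuousLinearMap.eq_adjoint_iff]
  intro ξ η
  refine HasSum.unique (key (onFibres e (star T) ξ) η) ?_
  have h2 := key ξ (onFibres e T η)
  simp only [hf] at h2 ⊢
  simpa only [ContinuousLinearMap.star_eq_adjoint, ContinuousLinearMap.adjoint_inner_left] using h2

/-! ## Operators on the three tensor factors and their limits -/

theorem norm_onFibres_le {J κ : Type} (e : J ≃ κ × ℕ) (T : L2 ℕ →L[ℂ] L2 ℕ) :
    ‖onFibres e T‖ ≤ ‖T‖ :=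
  norm_opOfCoord_le _ _ _ _

/-- The operators `I ⊗ T` as a linear map in `T`. -/
def onFibresLinear {J κ : Type} (e : J ≃ κ × ℕ) :
    (L2 ℕ →L[ℂ] L2 ℕ) →L[ℂ] (L2 J →L[ℂ] L2 J) :=
  LinearMap.mkContinuous
    { toFun := onFibres e
      map_add' := fun _ _ => rfl
      map_smul' := fun _ _ => rfl } 1 fun T => by
    rw [one_mul]
    exact norm_onFibres_le e T

theorem continuous_legOne : Continuous legOne := (onFibresLinear _).continuous

theorem continuous_legTwo : Continuous legTwo := (onFibresLinear _).continuous

theorem continuous_legThree : Continuous legThree := (onFibresLinear _).continuous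

theorem continuous_constOp : Continuous constOp := ContinuousMap.continuous_const'

/-! ### Norm limits of the diagonal operators -/

theorem norm_diagOp_sub_le {w w' : ℕ → ℝ} (hw : ∀ n, |w n| ≤ 1) (hw' : ∀ n, |w' n| ≤ 1) {C : ℝ}
    (hC : 0 ≤ C) (h : ∀ n, |w n - w' n| ≤ C) : ‖diagOp w hw - diagOp w' hw'‖ ≤ C := by
  refine ContinuousLinearMap.opNorm_le_bound _ hC fun f => L2.norm_le _ (by positivity) fun s => ?_
  calc ∑ n ∈ s, ‖((diagOp w hw - diagOp w' hw') f) n‖ ^ 2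
      ≤ ∑ n ∈ s, C ^ 2 * ‖f n‖ ^ 2 := Finset.sum_le_sum fun n _ => by
        have h1 : ((diagOp w hw - diagOp w' hw') f) n = ((w n - w' n : ℝ) : ℂ) * f n := by
          change (w n : ℂ) * f n - (w' n : ℂ) * f n = _
          push_cast
          ring
        rw [h1, norm_mul, mul_pow, Complex.norm_real, Real.norm_eq_abs]
        gcongr
        exact h n
    _ ≤ (C * ‖f‖) ^ 2 := by
        rw [← Finset.mul_sum, mul_pow]
        exact mul_le_mul_of_nonneg_left (f.sum_sq_le s) (by positivity)

theorem tendsto_qToZero : Tendsto (fun q : Set.Ioo (0 : ℝ) 1 => (q : ℝ)) qToZero (𝓝 0) :=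
  tendsto_comap

/-- This makes limits as `q → 0` unique, so that `limitGenerators` contains nothing beyond the six
computed limits. -/
instance : qToZero.NeBot := by
  refine comap_neBot fun t ht => ?_
  obtain ⟨ε, hε, h⟩ := Metric.mem_nhds_iff.1 ht
  refine ⟨⟨min (ε / 2) (1 / 2), lt_min (by positivity) (by norm_num),
    (min_le_right _ _).trans_lt (by norm_num)⟩, h ?_⟩
  have h1 : 0 < min (ε / 2) (1 / 2) := lt_min (by positivity) (by norm_num)
  rw [Metric.mem_ball, Real.dist_0_eq_abs, abs_of_pos h1]
  exact (min_le_left _ _).trans_lt (by linarith)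

theorem tendsto_of_norm_sub_le {E : Type*} [SeminormedAddCommGroup E] {f : Set.Ioo (0 : ℝ) 1 → E}
    {a : E} (h : ∀ q : Set.Ioo (0 : ℝ) 1, ‖f q - a‖ ≤ (q : ℝ)) : Tendsto f qToZero (𝓝 a) :=
  tendsto_iff_norm_sub_tendsto_zero.2
    (squeeze_zero (fun _ => norm_nonneg _) h tendsto_qToZero)

/-- The diagonal entries agree at `0` and differ by `q ^ n ≤ q` for `n ≥ 1`, so the convergence is
uniform. -/
theorem tendsto_opD : Tendsto opD qToZero (𝓝 opP) :=
  tendsto_of_norm_sub_le fun q => norm_diagOp_sub_le _ _ q.2.1.le fun n => by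
    cases n with
    | zero => simpa using q.2.1.le
    | succ n =>
      simp only [Nat.succ_ne_zero, if_false, sub_zero, abs_of_nonneg (pow_nonneg q.2.1.le _)]
      exact pow_le_of_le_one q.2.1.le q.2.2.le (Nat.succ_ne_zero n)

/-- The orthogonal projection onto the complement of the span of `x_0`. -/
def opPCompl : L2 ℕ →L[ℂ] L2 ℕ :=
  diagOp (fun n => if n = 0 then 0 else 1) fun n => by by_cases h : n = 0 <;> simp [h]

theorem tendsto_opC : Tendsto opC qToZero (𝓝 opPCompl) :=
  tendsto_of_norm_sub_le fun q => norm_diagOp_sub_le _ _ q.2.1.le fun n => by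
    cases n with
    | zero => simpa using q.2.1.le
    | succ n =>
      have h0 := pow_nonneg q.2.1.le (2 * (n + 1))
      have h1 : (q : ℝ) ^ (2 * (n + 1)) ≤ q := pow_le_of_le_one q.2.1.le q.2.2.le (by omega)
      have h2 : (q : ℝ) ^ (2 * (n + 1)) ≤ 1 := h1.trans q.2.2.le
      have h3 : Real.sqrt (1 - (q : ℝ) ^ (2 * (n + 1))) ≤ 1 := Real.sqrt_le_one.mpr (by linarith)
      -- On `[0, 1]` one has `x ≤ √x`, so the entry differs from `1` by at most `q ^ (2 * (n + 1)) ≤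
      -- q`.
      have h4 : 1 - (q : ℝ) ^ (2 * (n + 1)) ≤ Real.sqrt (1 - (q : ℝ) ^ (2 * (n + 1))) :=
        Real.le_sqrt_of_sq_le (by nlinarith)
      simp only [Nat.succ_ne_zero, if_false]
      rw [abs_sub_comm, abs_of_nonneg (by linarith)]
      linarith

theorem shiftOp_apply_zero (f : L2 ℕ) : shiftOp f 0 = 0 := rfl

theorem shiftOp_apply_succ (f : L2 ℕ) (n : ℕ) : shiftOp f (n + 1) = f n := rfl

theorem star_shiftOp_apply (f : L2 ℕ) (n : ℕ) : star shiftOp f n = f (n + 1) := by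
  have h1 : shiftOp (lp.single 2 n (1 : ℂ)) = lp.single 2 (n + 1) (1 : ℂ) := by
    refine lp.ext (funext fun m => ?_)
    cases m with
    | zero => exact (lp.single_apply_ne (E := fun _ : ℕ => ℂ) 2 _ _ (by omega)).symm
    | succ m =>
      rw [shiftOp_apply_succ]
      by_cases h : m = n
      · subst h
        exact (lp.single_apply_self (E := fun _ : ℕ => ℂ) 2 _ _).trans
          (lp.single_apply_self (E := fun _ : ℕ => ℂ) 2 _ _).symm
      · exact (lp.single_apply_ne (E := fun _ : ℕ => ℂ) 2 _ _ h).trans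
          (lp.single_apply_ne (E := fun _ : ℕ => ℂ) 2 _ _ (by omega)).symm
  rw [← L2.inner_single_one n (star shiftOp f), ContinuousLinearMap.star_eq_adjoint,
    ContinuousLinearMap.adjoint_inner_right, h1, L2.inner_single_one]

/-- The backward shift annihilates `x_0`, so replacing `C_q` by its limit `I - P` leaves just the
shift. -/
theorem star_shiftOp_mul_opPCompl : star shiftOp * opPCompl = star shiftOp :=
  L2.op_ext fun f n => by
    change star shiftOp (opPCompl f) n = _
    rw [star_shiftOp_apply, star_shiftOp_apply]
    change ((if n + 1 = 0 then 0 else 1 : ℝ) : ℂ) * f (n + 1) = _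
    simp

theorem opPCompl_mul_shiftOp : opPCompl * shiftOp = shiftOp :=
  L2.op_ext fun f n => by
    change ((if n = 0 then 0 else 1 : ℝ) : ℂ) * shiftOp f n = _
    cases n <;> simp [shiftOp_apply_zero]

theorem star_opP : star opP = opP := by
  have h : opP = partialPerm (PEquiv.ofSet {0}) := L2.op_ext fun f n => by
    change ((if n = 0 then 1 else 0 : ℝ) : ℂ) * f n = _
    rw [partialPerm_apply, PEquiv.ofSet_symm]
    cases n with
    | zero => simp [PEquiv.ofSet]
    | succ n => simp [PEquiv.ofSet]
  rw [h, star_partialPerm, PEquiv.ofSet_symm]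

theorem tendsto_star_shiftOp_mul_opC :
    Tendsto (fun q => star shiftOp * opC q) qToZero (𝓝 (star shiftOp)) := by
  have h := (tendsto_const_nhds (x := star shiftOp)).mul tendsto_opC
  rwa [star_shiftOp_mul_opPCompl] at h

theorem tendsto_opC_mul_shiftOp : Tendsto (fun q => opC q * shiftOp) qToZero (𝓝 shiftOp) := by
  have h := tendsto_opC.mul (tendsto_const_nhds (x := shiftOp))
  rwa [opPCompl_mul_shiftOp] at h

theorem tendsto_smul_opD :
    Tendsto (fun q : Set.Ioo (0 : ℝ) 1 => ((q : ℝ) : ℂ) • opD q) qToZero (𝓝 0) := by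
  have h := ((Complex.continuous_ofReal.tendsto 0).comp tendsto_qToZero).smul tendsto_opD
  rwa [Complex.ofReal_zero, zero_smul] at h

/-! ### Limits of the Soibelman representation -/

/-- The limit of `(π₁(t_{jk}))` as `q → 0`. -/
def piOneLimit : Matrix (Fin 3) (Fin 3) (L2 ℕ →L[ℂ] L2 ℕ) :=
  !![star shiftOp, 0, 0; -opP, shiftOp, 0; 0, 0, 1]

/-- The limit of `(π₂(t_{jk}))` as `q → 0`. -/
def piTwoLimit : Matrix (Fin 3) (Fin 3) (L2 ℕ →L[ℂ] L2 ℕ) :=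
  !![1, 0, 0; 0, star shiftOp, 0; 0, -opP, shiftOp]

theorem tendsto_piOne : Tendsto piOne qToZero (𝓝 piOneLimit) := by
  refine tendsto_pi_nhds.2 fun i => tendsto_pi_nhds.2 fun j => ?_
  fin_cases i <;> fin_cases j
  exacts [tendsto_star_shiftOp_mul_opC, tendsto_smul_opD, tendsto_const_nhds, tendsto_opD.neg,
    tendsto_opC_mul_shiftOp, tendsto_const_nhds, tendsto_const_nhds, tendsto_const_nhds,
    tendsto_const_nhds]

theorem tendsto_piTwo : Tendsto piTwo qToZero (𝓝 piTwoLimit) := by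
  refine tendsto_pi_nhds.2 fun i => tendsto_pi_nhds.2 fun j => ?_
  fin_cases i <;> fin_cases j
  exacts [tendsto_const_nhds, tendsto_const_nhds, tendsto_const_nhds, tendsto_const_nhds,
    tendsto_star_shiftOp_mul_opC, tendsto_smul_opD, tendsto_const_nhds, tendsto_opD.neg,
    tendsto_opC_mul_shiftOp]

theorem tendsto_soibelman : Tendsto soibelman qToZero
    (𝓝 (piOneLimit.map (fun T => constOp (legOne T)) * piTwoLimit.map (fun T => constOp (legTwo T)) *
      piOneLimit.map (fun T => constOp (legThree T)) * (tauOne * tauTwo))) := by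
  have h1 := ((continuous_id.matrix_map (continuous_constOp.comp continuous_legOne)).tendsto
    _).comp tendsto_piOne
  have h2 := ((continuous_id.matrix_map (continuous_constOp.comp continuous_legTwo)).tendsto
    _).comp tendsto_piTwo
  have h3 := ((continuous_id.matrix_map (continuous_constOp.comp continuous_legThree)).tendsto
    _).comp tendsto_piOne
  exact ((h1.mul h2).mul h3).mul tendsto_const_nhds

theorem legOne_zero : legOne 0 = 0 := rfl
theorem legOne_one : legOne 1 = 1 := rfl
theorem legTwo_zero : legTwo 0 = 0 := rfl
theorem legTwo_one : legTwo 1 = 1 := rfl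
theorem legThree_zero : legThree 0 = 0 := rfl
theorem legThree_one : legThree 1 = 1 := rfl
theorem legOne_neg (T : L2 ℕ →L[ℂ] L2 ℕ) : legOne (-T) = -legOne T := rfl
theorem legTwo_neg (T : L2 ℕ →L[ℂ] L2 ℕ) : legTwo (-T) = -legTwo T := rfl
theorem legThree_neg (T : L2 ℕ →L[ℂ] L2 ℕ) : legThree (-T) = -legThree T := rfl
theorem legOne_smul (c : ℂ) (T : L2 ℕ →L[ℂ] L2 ℕ) : legOne (c • T) = c • legOne T := rfl
theorem legTwo_smul (c : ℂ) (T : L2 ℕ →L[ℂ] L2 ℕ) : legTwo (c • T) = c • legTwo T := rfl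
theorem star_legOne (T : L2 ℕ →L[ℂ] L2 ℕ) : star (legOne T) = legOne (star T) := star_onFibres _ T
theorem star_legTwo (T : L2 ℕ →L[ℂ] L2 ℕ) : star (legTwo T) = legTwo (star T) := star_onFibres _ T
theorem star_legThree (T : L2 ℕ →L[ℂ] L2 ℕ) : star (legThree T) = legThree (star T) :=
  star_onFibres _ T

theorem constOp_zero : constOp 0 = 0 := rfl
theorem constOp_one : constOp 1 = 1 := rfl
theorem constOp_neg (T : OpThree) : constOp (-T) = -constOp T := rfl
theorem constOp_add (T T' : OpThree) : constOp (T + T') = constOp T + constOp T' := rfl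
theorem constOp_mul (T T' : OpThree) : constOp (T * T') = constOp T * constOp T' := rfl
theorem constOp_smul (c : ℂ) (T : OpThree) : constOp (c • T) = c • constOp T := rfl
theorem star_constOp (T : OpThree) : star (constOp T) = constOp (star T) := rfl

theorem coordFun_mul_comm (i : Fin 2) (x : Ambient) : x * coordFun i = coordFun i * x :=
  ContinuousMap.ext fun z => by
    change x z * (((z i : Circle) : ℂ) • (1 : OpThree)) = (((z i : Circle) : ℂ) • (1 : OpThree)) * x z
    rw [mul_smul_comm, smul_mul_assoc, mul_one, one_mul]

/-- The first column of the limit of the Soibelman representation. -/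
theorem soibelmanLimit_first_column (j : Fin 3) :
    (piOneLimit.map (fun T => constOp (legOne T)) * piTwoLimit.map (fun T => constOp (legTwo T)) *
      piOneLimit.map (fun T => constOp (legThree T)) * (tauOne * tauTwo)) j 0 =
    ![constOp (legOne (star shiftOp) * legThree (star shiftOp)),
      constOp (-(legOne opP * legThree (star shiftOp)) -
        legOne shiftOp * legTwo (star shiftOp) * legThree opP),
      constOp (legTwo opP * legThree opP)] j * star (coordFun 0) := by
  fin_cases j <;>
    simp [Matrix.mul_apply, Fin.sum_univ_three, piOneLimit, piTwoLimit, tauOne, tauTwo, legOne_zero,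
      legOne_one, legTwo_zero, legTwo_one, legThree_zero, legThree_one, legOne_neg, legTwo_neg,
      legThree_neg, constOp_zero, constOp_one, constOp_neg, constOp_mul, constOp_add, sub_eq_add_neg]

/-- The third column of the Soibelman representation, with the powers of `q` split off. -/
theorem soibelman_third_column (q : Set.Ioo (0 : ℝ) 1) (j : Fin 3) :
    soibelman q j.rev 2 = (((q : ℝ) : ℂ) ^ (j : ℕ)) •
      (![constOp (legTwo (opC q * shiftOp)), constOp (legOne (opC q * shiftOp) * legTwo (opD q)),
        constOp (legOne (opD q) * legTwo (opD q))] j * coordFun 1) := by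
  fin_cases j <;>
    simp [soibelman, piOne, piTwo, Matrix.mul_apply, Fin.sum_univ_three, tauOne, tauTwo,
      legOne_zero, legOne_one, legTwo_zero, legTwo_one, legThree_zero, legThree_one, legOne_neg,
      legTwo_neg, legThree_neg, constOp_zero, constOp_one, constOp_neg, constOp_mul, legOne_smul,
      legTwo_smul, constOp_smul, smul_smul, pow_two, -Complex.coe_smul]

/-- The factor `q^(-j)` is unbounded, so the limit of the matrix alone does not suffice. The entries
`q D_q` contribute exactly `j` factors of `q` here, and these cancel before the limit is taken. -/
theorem star_soibelmanGen_one (q : Set.Ioo (0 : ℝ) 1) (j : Fin 3) :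
    star (soibelmanGen q 1 j) =
      ![constOp (legTwo (opC q * shiftOp)), constOp (legOne (opC q * shiftOp) * legTwo (opD q)),
        constOp (legOne (opD q) * legTwo (opD q))] j * coordFun 1 := by
  have hq : ((q : ℝ) : ℂ) ^ (j : ℕ) ≠ 0 :=
    pow_ne_zero _ (Complex.ofReal_ne_zero.2 q.2.1.ne')
  have h1 : star (((q : ℝ) : ℂ) ^ (j : ℕ))⁻¹ = (((q : ℝ) : ℂ) ^ (j : ℕ))⁻¹ := by
    rw [star_inv₀, star_pow]
    congr 2
    exact Complex.conj_ofReal _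
  rw [soibelmanGen, if_neg (by decide), star_smul, star_star, soibelman_third_column, h1, smul_smul,
    inv_mul_cancel₀ hq, one_smul]

theorem legOne_shiftOp_apply (ξ : L2 (ℕ × ℕ × ℕ)) (a b c : ℕ) :
    legOne shiftOp ξ (a, b, c) = if a = 0 then 0 else ξ (a - 1, b, c) := rfl

theorem legTwo_shiftOp_apply (ξ : L2 (ℕ × ℕ × ℕ)) (a b c : ℕ) :
    legTwo shiftOp ξ (a, b, c) = if b = 0 then 0 else ξ (a, b - 1, c) := rfl

theorem legThree_shiftOp_apply (ξ : L2 (ℕ × ℕ × ℕ)) (a b c : ℕ) :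
    legThree shiftOp ξ (a, b, c) = if c = 0 then 0 else ξ (a, b, c - 1) := rfl

theorem legOne_star_shiftOp_apply (ξ : L2 (ℕ × ℕ × ℕ)) (a b c : ℕ) :
    legOne (star shiftOp) ξ (a, b, c) = ξ (a + 1, b, c) := star_shiftOp_apply _ _

theorem opP_apply (f : L2 ℕ) (n : ℕ) : opP f n = if n = 0 then f n else 0 := by
  change ((if n = 0 then 1 else 0 : ℝ) : ℂ) * f n = _
  split_ifs <;> simp

theorem legOne_opP_apply (ξ : L2 (ℕ × ℕ × ℕ)) (a b c : ℕ) :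
    legOne opP ξ (a, b, c) = if a = 0 then ξ (a, b, c) else 0 := opP_apply _ _

theorem legTwo_opP_apply (ξ : L2 (ℕ × ℕ × ℕ)) (a b c : ℕ) :
    legTwo opP ξ (a, b, c) = if b = 0 then ξ (a, b, c) else 0 := opP_apply _ _

theorem legThree_opP_apply (ξ : L2 (ℕ × ℕ × ℕ)) (a b c : ℕ) :
    legThree opP ξ (a, b, c) = if c = 0 then ξ (a, b, c) else 0 := opP_apply _ _

theorem opThree_mul_apply (T T' : OpThree) (ξ : L2 (ℕ × ℕ × ℕ)) (p : ℕ × ℕ × ℕ) :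
    (T * T') ξ p = T (T' ξ) p := rfl

/-- The adjoint reverses the order of the tensor legs. The auxiliary identities are the commutations
of different legs that restore the order used in `tensorThree`. -/
theorem star_soibelmanLimit_first_column (j : Fin 3) :
    star (![constOp (legOne (star shiftOp) * legThree (star shiftOp)),
      constOp (-(legOne opP * legThree (star shiftOp)) -
        legOne shiftOp * legTwo (star shiftOp) * legThree opP),
      constOp (legTwo opP * legThree opP)] j * star (coordFun 0)) = limitOp 0 j := by
  have h13 : legThree shiftOp * legOne shiftOp = legOne shiftOp * legThree shiftOp :=
    L2.op_ext fun ξ p => by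
      obtain ⟨_ | a, b, _ | c⟩ := p <;>
        simp [legOne_shiftOp_apply, legThree_shiftOp_apply]
  have h1 : legThree shiftOp * legOne opP = legOne opP * legThree shiftOp :=
    L2.op_ext fun ξ p => by
      obtain ⟨_ | a, b, _ | c⟩ := p <;>
        simp [legOne_opP_apply, legThree_shiftOp_apply]
  have h2 : legThree opP * (legTwo shiftOp * legOne (star shiftOp)) =
      legOne (star shiftOp) * (legTwo shiftOp * legThree opP) :=
    L2.op_ext fun ξ p => by
      obtain ⟨a, _ | b, _ | c⟩ := p <;>
        simp [legOne_star_shiftOp_apply, legTwo_shiftOp_apply,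
          legThree_opP_apply]
  have h3 : legThree opP * legTwo opP = legTwo opP * legThree opP :=
    L2.op_ext fun ξ p => by
      obtain ⟨a, _ | b, _ | c⟩ := p <;>
        simp [legTwo_opP_apply, legThree_opP_apply]
  fin_cases j
  · simp [star_constOp, star_legOne, star_legThree, limitOp, tensorThree, legTwo_one, h13]
  · simp [star_constOp, star_legOne, star_legTwo, star_legThree, limitOp, tensorThree, legTwo_one,
      h1, h2, star_opP, mul_assoc, constOp_neg, constOp_add, sub_eq_add_neg, mul_add]
    abel
  · simp [star_constOp, star_legTwo, star_legThree, limitOp, tensorThree, legOne_one, h3, star_opP]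

theorem tendsto_star_soibelmanGen (i : Fin 2) (j : Fin 3) :
    Tendsto (fun q => star (soibelmanGen q i j)) qToZero (𝓝 (limitOp i j)) := by
  by_cases hi : i = 0
  · subst hi
    have h := (((continuous_apply_apply j (0 : Fin 3)).tendsto _).comp tendsto_soibelman).star
    rw [← star_soibelmanLimit_first_column, ← soibelmanLimit_first_column]
    exact h
  · obtain rfl : i = 1 := by omega
    simp only [star_soibelmanGen_one]
    have h0 : ∀ (f : Set.Ioo (0 : ℝ) 1 → OpThree) (T : OpThree), Tendsto f qToZero (𝓝 T) →
        Tendsto (fun q => constOp (f q) * coordFun 1) qToZero (𝓝 (coordFun 1 * constOp T)) := by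
      intro f T h
      rw [← coordFun_mul_comm]
      exact ((continuous_constOp.tendsto _).comp h).mul tendsto_const_nhds
    have hC1 := (continuous_legOne.tendsto _).comp tendsto_opC_mul_shiftOp
    have hC2 := (continuous_legTwo.tendsto _).comp tendsto_opC_mul_shiftOp
    have hD1 := (continuous_legOne.tendsto _).comp tendsto_opD
    have hD2 := (continuous_legTwo.tendsto _).comp tendsto_opD
    fin_cases j
    · have h := h0 _ _ hC2
      simpa [limitOp, tensorThree, legOne_one, legThree_one] using h
    · have h := h0 _ _ (hC1.mul hD2)
      simpa [limitOp, tensorThree, legOne_one, legThree_one] using h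
    · have h := h0 _ _ (hD1.mul hD2)
      simpa [limitOp, tensorThree, legOne_one, legThree_one] using h

/-! ## The Cuntz-Krieger family of the 2-graph in `SU₀(3)` -/

/-- The color of the edges with a given label. -/
def SULabel.color : SULabel → SUColor
  | .X | .Y | .Z => .blue
  | .A | .B | .C => .red

/-- The label of the edges of a given color that end at a given vertex. -/
def inLabel : SUColor → SUVertex → SULabel
  | .blue, .CZ | .blue, .BZ => .Z
  | .blue, .CY | .blue, .AY => .Y
  | .blue, .BX | .blue, .AX => .X
  | .red, .CZ | .red, .CY => .C
  | .red, .BZ | .red, .BX => .B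
  | .red, .AY | .red, .AX => .A

/-- Whether an edge with a given label starts at a given vertex. -/
def labelSource : SULabel → SUVertex → Bool
  | .X, _ | .A, _ => true
  | .Y, .CZ | .Y, .BZ | .Y, .CY | .Y, .AY => true
  | .Z, .CZ | .Z, .BZ => true
  | .B, .CZ | .B, .BZ | .B, .CY | .B, .BX => true
  | .C, .CZ | .C, .CY => true
  | _, _ => false

theorem label_eq_of_edgeLabel {col : SUColor} {u v : SUVertex} {l : SULabel}
    (h : edgeLabel col u v = some l) : l.color = col ∧ inLabel col v = l ∧ labelSource l u := by
  cases col <;> cases u <;> cases v <;> simp [edgeLabel] at h <;> subst h <;> exact ⟨rfl, rfl, rfl⟩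

theorem edgeLabel_of_labelSource {l : SULabel} {q : ℕ × ℕ × ℕ}
    (h : labelSource l (pointVertex q)) :
    edgeLabel l.color (pointVertex q) (pointVertex (labelMap l q)) = some l := by
  obtain ⟨_ | a, _ | b, _ | c⟩ := q <;> cases l <;>
    first | rfl | (simp [labelSource, pointVertex] at h; done) | (cases a <;> rfl)

open Classical in
/-- The partial permutation of `ℕ × ℕ × ℕ` defined by all edges with a given label. -/
def labelPEquiv (l : SULabel) : PEquiv (ℕ × ℕ × ℕ) (ℕ × ℕ × ℕ) where
  toFun q := if labelSource l (pointVertex q) then some (labelMap l q) else none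
  -- The vertex of `p` determines the label of the only edge of this color that hits `p`.
  invFun p := if inLabel l.color (pointVertex p) = l then some (pointPred l.color p) else none
  inv q p := by
    split_ifs with h1 h2 h2
    · simp only [Option.some.injEq]
      obtain ⟨l', h3, h4⟩ := exists_labelMap_pointPred l.color p
      obtain rfl : l' = l := by rw [← (label_eq_of_edgeLabel h3).2.1, h1]
      constructor
      · rintro rfl
        exact h4
      · rintro rfl
        exact pointPred_labelMap (edgeLabel_of_labelSource h2)
    · obtain ⟨l', h3, h4⟩ := exists_labelMap_pointPred l.color p
      obtain rfl : l' = l := by rw [← (label_eq_of_edgeLabel h3).2.1, h1]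
      simp only [Option.some.injEq, iff_false]
      rintro rfl
      exact h2 (label_eq_of_edgeLabel h3).2.2
    · simp only [Option.some.injEq, false_iff]
      rintro rfl
      exact h1 (label_eq_of_edgeLabel (edgeLabel_of_labelSource h2)).2.1
    · simp

theorem partialPerm_labelPEquiv_apply (l : SULabel) (ξ : L2 (ℕ × ℕ × ℕ)) (p : ℕ × ℕ × ℕ) :
    partialPerm (labelPEquiv l) ξ p =
      if inLabel l.color (pointVertex p) = l then ξ (pointPred l.color p) else 0 := by
  rw [partialPerm_apply]
  change (if inLabel l.color (pointVertex p) = l then some (pointPred l.color p) else none).elim 0 ξ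
    = _
  split_ifs <;> rfl

/-- The operator-valued function `z ↦ z^n T` on the torus. -/
def twistOp (n : Fin 2 → ℕ) (T : OpThree) : Ambient :=
  ⟨fun z => (torusMonomial z n : ℂ) • T, by
    unfold torusMonomial
    fun_prop⟩

theorem twistOp_apply (n : Fin 2 → ℕ) (T : OpThree) (z : Torus) :
    twistOp n T z = (torusMonomial z n : ℂ) • T := rfl

theorem twistOp_mul (m n : Fin 2 → ℕ) (T T' : OpThree) :
    twistOp m T * twistOp n T' = twistOp (m + n) (T * T') :=
  ContinuousMap.ext fun z => by
    rw [ContinuousMap.mul_apply, twistOp_apply, twistOp_apply, twistOp_apply, torusMonomial_add,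
      smul_mul_smul_comm, Circle.coe_mul]

theorem constOp_mul_twistOp (n : Fin 2 → ℕ) (T T' : OpThree) :
    constOp T * twistOp n T' = twistOp n (T * T') :=
  ContinuousMap.ext fun _ => mul_smul_comm _ _ _

theorem twistOp_mul_constOp (n : Fin 2 → ℕ) (T T' : OpThree) :
    twistOp n T * constOp T' = twistOp n (T * T') :=
  ContinuousMap.ext fun _ => smul_mul_assoc _ _ _

theorem star_twistOp_mul_twistOp (n : Fin 2 → ℕ) (T T' : OpThree) :
    star (twistOp n T) * twistOp n T' = constOp (star T * T') :=
  ContinuousMap.ext fun z => by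
    change star ((torusMonomial z n : ℂ) • T) * ((torusMonomial z n : ℂ) • T') = star T * T'
    rw [star_smul, smul_mul_smul_comm]
    exact (congrArg (· • (star T * T')) (circle_conj_mul _)).trans (one_smul _ _)

theorem twistOp_mul_star_twistOp (n : Fin 2 → ℕ) (T T' : OpThree) :
    twistOp n T * star (twistOp n T') = constOp (T * star T') :=
  ContinuousMap.ext fun z => by
    change ((torusMonomial z n : ℂ) • T) * star ((torusMonomial z n : ℂ) • T') = T * star T'
    rw [star_smul, smul_mul_smul_comm]
    exact (congrArg (· • (T * star T')) (circle_mul_conj _)).trans (one_smul _ _)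

theorem coordFun_mul_constOp (col : SUColor) (T : OpThree) :
    coordFun (colorIndex col) * constOp T = twistOp (colorRank col) T :=
  ContinuousMap.ext fun z => by
    change (((z (colorIndex col) : Circle) : ℂ) • (1 : OpThree)) * T = _
    rw [twistOp_apply, smul_mul_assoc, one_mul]
    cases col <;> simp [torusMonomial, colorRank, colorIndex]

/-- The sum of the partial isometries of the edges with a given label. -/
def labelElement (l : SULabel) : Ambient :=
  twistOp (colorRank l.color) (partialPerm (labelPEquiv l))

/-- Both sides are the same coordinate function times a constant operator. Identifying a limit with
a label thus reduces to its coordinates at points, where only the vanishing or not of `a`, `b`, `c`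
matters. -/
theorem labelElement_eq {l : SULabel} {T : OpThree} {i : Fin 2} (hi : colorIndex l.color = i)
    (hT : ∀ ξ p, T ξ p = if inLabel l.color (pointVertex p) = l then ξ (pointPred l.color p) else 0) :
    coordFun i * constOp T = labelElement l := by
  subst hi
  rw [coordFun_mul_constOp, labelElement]
  congr 1
  exact L2.op_ext fun ξ p => by rw [hT, partialPerm_labelPEquiv_apply]

theorem limitOp_zero_zero : limitOp 0 0 = labelElement .X :=
  labelElement_eq rfl fun ξ p => by
    rw [tensorThree, legTwo_one, mul_one]
    obtain ⟨_ | a, _ | b, _ | c⟩ := p <;>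
      simp [legOne_shiftOp_apply, legThree_shiftOp_apply, pointVertex, inLabel, pointPred,
        SULabel.color]

theorem limitOp_zero_one : limitOp 0 1 = -labelElement .Y :=
  congrArg Neg.neg <| labelElement_eq rfl fun ξ p => by
    rw [tensorThree, tensorThree, legTwo_one, mul_one]
    obtain ⟨_ | a, _ | b, _ | c⟩ := p <;>
      simp [legOne_opP_apply, legThree_opP_apply, legOne_star_shiftOp_apply, legTwo_shiftOp_apply,
        legThree_shiftOp_apply, pointVertex, inLabel, pointPred, SULabel.color]

theorem limitOp_zero_two : limitOp 0 2 = labelElement .Z :=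
  labelElement_eq rfl fun ξ p => by
    rw [tensorThree, legOne_one, one_mul]
    obtain ⟨_ | a, _ | b, _ | c⟩ := p <;>
      simp [legTwo_opP_apply, legThree_opP_apply, pointVertex, inLabel, pointPred, SULabel.color]

theorem limitOp_one_zero : limitOp 1 0 = labelElement .A :=
  labelElement_eq rfl fun ξ p => by
    rw [tensorThree, legOne_one, legThree_one, one_mul, mul_one]
    obtain ⟨_ | a, _ | b, _ | c⟩ := p <;>
      simp [legTwo_shiftOp_apply, pointVertex, inLabel, pointPred, SULabel.color]

theorem limitOp_one_one : limitOp 1 1 = labelElement .B :=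
  labelElement_eq rfl fun ξ p => by
    rw [tensorThree, legThree_one, mul_one]
    obtain ⟨_ | a, _ | b, _ | c⟩ := p <;>
      simp [legOne_shiftOp_apply, legTwo_opP_apply, pointVertex, inLabel, pointPred, SULabel.color]

theorem limitOp_one_two : limitOp 1 2 = labelElement .C :=
  labelElement_eq rfl fun ξ p => by
    rw [tensorThree, legThree_one, mul_one]
    obtain ⟨_ | a, _ | b, _ | c⟩ := p <;>
      simp [legOne_opP_apply, legTwo_opP_apply, pointVertex, inLabel, pointPred, SULabel.color]

/-! ### Partial isometries of the arrows -/

/-- The vertex of the quiver underlying a vertex of the 2-graph. -/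
def SUGraph.vertex (v : SUGraph) : SUVertex := v.as

open Classical in
/-- The partial permutation of `ℕ × ℕ × ℕ` defined by an arrow of the 2-graph. -/
def arrowPEquiv {u v : SUGraph} (f : u ⟶ v) : PEquiv (ℕ × ℕ × ℕ) (ℕ × ℕ × ℕ) where
  toFun q := if h : pointVertex q = u.vertex then some (pointAction.map f ⟨q, h⟩).1 else none
  -- Arrows act injectively by `arrow_eq_of_pointAction_eq`, so the chosen preimage is the only one.
  invFun p := if h : ∃ x : pointAction.obj u, (pointAction.map f x).1 = p then some h.choose.1
    else none
  inv q p := by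
    split_ifs with h1 h2 h2
    · simp only [Option.some.injEq]
      constructor
      · rintro rfl
        exact h1.choose_spec
      · intro h
        exact (arrow_eq_of_pointAction_eq _ f f _ ⟨q, h2⟩ rfl rfl (h1.choose_spec.trans h.symm)).2
    · simp only [Option.some.injEq, iff_false]
      rintro rfl
      exact h2 h1.choose.2
    · simp only [Option.some.injEq, false_iff]
      rintro h
      exact h1 ⟨_, h⟩
    · simp

theorem arrowPEquiv_apply {u v : SUGraph} (f : u ⟶ v) (x : pointAction.obj u) :
    arrowPEquiv f x.1 = some (pointAction.map f x).1 :=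
  dif_pos x.2

theorem arrowPEquiv_eq_none {u v : SUGraph} (f : u ⟶ v) {q : ℕ × ℕ × ℕ}
    (h : pointVertex q ≠ u.vertex) : arrowPEquiv f q = none :=
  dif_neg h

theorem isSome_arrowPEquiv_iff {u v : SUGraph} (f : u ⟶ v) (q : ℕ × ℕ × ℕ) :
    (arrowPEquiv f q).isSome ↔ pointVertex q = u.vertex := by
  by_cases h : pointVertex q = u.vertex
  · rw [arrowPEquiv_apply f ⟨q, h⟩]
    exact iff_of_true rfl h
  · rw [arrowPEquiv_eq_none f h]
    simp [h]

theorem isSome_arrowPEquiv_symm_iff {u v : SUGraph} (f : u ⟶ v) (p : ℕ × ℕ × ℕ) :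
    ((arrowPEquiv f).symm p).isSome ↔ ∃ x, (pointAction.map f x).1 = p := by
  rw [Option.isSome_iff_exists]
  constructor
  · rintro ⟨q, hq⟩
    have h1 := (PEquiv.eq_some_iff _).1 hq
    have h2 : pointVertex q = u.vertex := (isSome_arrowPEquiv_iff f q).1 (by rw [h1]; rfl)
    rw [arrowPEquiv_apply f ⟨q, h2⟩] at h1
    exact ⟨⟨q, h2⟩, Option.some.inj h1⟩
  · rintro ⟨x, rfl⟩
    exact ⟨x.1, (PEquiv.eq_some_iff _).2 (arrowPEquiv_apply f x)⟩

theorem arrowPEquiv_trans {u v w : SUGraph} (f : u ⟶ v) (g : v ⟶ w) :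
    (arrowPEquiv f).trans (arrowPEquiv g) = arrowPEquiv (f ≫ g) := by
  refine PEquiv.ext fun q => ?_
  change (arrowPEquiv f q).bind (arrowPEquiv g) = _
  by_cases h : pointVertex q = u.vertex
  · rw [arrowPEquiv_apply f ⟨q, h⟩, arrowPEquiv_apply (f ≫ g) ⟨q, h⟩, pointAction.map_comp]
    exact arrowPEquiv_apply g _
  · rw [arrowPEquiv_eq_none f h, arrowPEquiv_eq_none _ h]
    rfl

theorem partialPerm_ofSet_apply {J : Type} (s : Set J) [DecidablePred (· ∈ s)] (ξ : L2 J) (p : J) :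
    partialPerm (PEquiv.ofSet s) ξ p = if p ∈ s then ξ p else 0 := by
  rw [partialPerm_apply, PEquiv.ofSet_symm]
  change (if p ∈ s then some p else none).elim 0 ξ = _
  split_ifs <;> rfl

theorem star_partialPerm_mul_self {J : Type} (f : PEquiv J J) (s : Set J) [DecidablePred (· ∈ s)]
    (h : ∀ q, (f q).isSome ↔ q ∈ s) :
    star (partialPerm f) * partialPerm f = partialPerm (PEquiv.ofSet s) := by
  rw [star_partialPerm, partialPerm_mul, PEquiv.self_trans_symm]
  congr
  ext q
  exact h q

theorem partialPerm_mul_star_self {J : Type} (f : PEquiv J J) (s : Set J) [DecidablePred (· ∈ s)]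
    (h : ∀ q, (f.symm q).isSome ↔ q ∈ s) :
    partialPerm f * star (partialPerm f) = partialPerm (PEquiv.ofSet s) := by
  rw [star_partialPerm, partialPerm_mul, PEquiv.symm_trans_self]
  congr
  ext q
  exact h q

/-- The projection onto the span of the basis vectors that belong to a vertex. -/
def vertexProj (v : SUVertex) : OpThree := partialPerm (PEquiv.ofSet {p | pointVertex p = v})

theorem vertexProj_apply (v : SUVertex) (ξ : L2 (ℕ × ℕ × ℕ)) (p : ℕ × ℕ × ℕ) :
    vertexProj v ξ p = if pointVertex p = v then ξ p else 0 :=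
  partialPerm_ofSet_apply _ _ _

theorem star_arrow_mul_arrow {u v : SUGraph} (f : u ⟶ v) :
    star (partialPerm (arrowPEquiv f)) * partialPerm (arrowPEquiv f) = vertexProj u.vertex :=
  star_partialPerm_mul_self _ _ (isSome_arrowPEquiv_iff f)

theorem arrow_mul_star_mul {u v : SUGraph} (f : u ⟶ v) :
    partialPerm (arrowPEquiv f) * star (partialPerm (arrowPEquiv f)) * partialPerm (arrowPEquiv f) =
      partialPerm (arrowPEquiv f) := by
  have h : partialPerm (arrowPEquiv (𝟙 u)) = vertexProj u.vertex := by
    rw [vertexProj]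
    congr 1
    refine PEquiv.ext fun q => ?_
    change _ = if pointVertex q = u.vertex then some q else none
    split_ifs with h
    · rw [arrowPEquiv_apply _ ⟨q, h⟩, pointAction.map_id]
      rfl
    · exact arrowPEquiv_eq_none _ h
  rw [mul_assoc, star_arrow_mul_arrow, ← h, partialPerm_mul, arrowPEquiv_trans, Category.id_comp]

/-- The range projection of an arrow projects onto the points in its image. By existence and
uniqueness of preimages the images of the arrows of rank `n` partition the points of `v`. -/
theorem sum_arrow_mul_star (v : SUGraph) (n : Fin 2 → ℕ) (s : Finset (Σ u : SUGraph, u ⟶ v))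
    (hs : ∀ f, f ∈ s ↔ arrowRank suRank f.2 = n) : vertexProj v.vertex =
      ∑ f ∈ s, partialPerm (arrowPEquiv f.2) * star (partialPerm (arrowPEquiv f.2)) := by
  classical
  have h0 : ∀ f : Σ u : SUGraph, u ⟶ v,
      partialPerm (arrowPEquiv f.2) * star (partialPerm (arrowPEquiv f.2)) =
        partialPerm (PEquiv.ofSet {p | ∃ x, (pointAction.map f.2 x).1 = p}) := fun f =>
    partialPerm_mul_star_self _ _ (isSome_arrowPEquiv_symm_iff f.2)
  refine L2.op_ext fun ξ p => ?_
  rw [vertexProj_apply, sum_apply, lp.coeFn_sum, Finset.sum_apply]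
  simp only [h0, partialPerm_ofSet_apply, Set.mem_ofPred_eq]
  split_ifs with hp
  · obtain ⟨u, f, x, hf, hx⟩ := exists_pointAction_eq n (v := v) ⟨p, hp⟩
    rw [Finset.sum_eq_single ⟨u, f⟩, if_pos ⟨x, congrArg Subtype.val hx⟩]
    · intro g hg hne
      refine if_neg ?_
      rintro ⟨y, hy⟩
      exact hne (arrow_eq_of_pointAction_eq n g.2 f y x ((hs g).1 hg) hf
        (hy.trans (congrArg Subtype.val hx).symm)).1
    · exact fun h => absurd ((hs ⟨u, f⟩).2 hf) h
  · refine (Finset.sum_eq_zero fun g _ => if_neg ?_).symm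
    rintro ⟨y, rfl⟩
    exact hp (pointAction.map g.2 y).2

/-- The Cuntz-Krieger family of the 2-graph in the operator-valued functions on the torus. -/
def suFamily : CKFamily suRank Ambient where
  P v := constOp (vertexProj v.vertex)
  S f := twistOp (arrowRank suRank f) (partialPerm (arrowPEquiv f))
  isProj v := by
    constructor
    · change constOp _ * constOp _ = constOp _
      rw [← constOp_mul]
      congr 1
      exact L2.op_ext fun ξ p => by
        rw [opThree_mul_apply, vertexProj_apply, vertexProj_apply]
        split_ifs <;> rfl
    · rw [IsSelfAdjoint, star_constOp, vertexProj, star_partialPerm, PEquiv.ofSet_symm]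
  isPartialIsometry f := by
    rw [twistOp_mul_star_twistOp, constOp_mul_twistOp, arrow_mul_star_mul]
  ck1 v w h := by
    rw [← constOp_mul, ← constOp_zero]
    congr 1
    refine L2.op_ext fun ξ p => ?_
    rw [opThree_mul_apply, vertexProj_apply, vertexProj_apply]
    split_ifs with h1 h2
    · exact absurd (by cases v; cases w; exact congrArg _ (h1.symm.trans h2)) h
    · rfl
    · rfl
  ck2 g f := by
    rw [twistOp_mul, partialPerm_mul, arrowPEquiv_trans, arrowRank_comp]
  ck3 f := by
    rw [star_twistOp_mul_twistOp, star_arrow_mul_arrow]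
  ck4 v n := by
    have hs : arrowsLE suRank v n = ((isRowFinite_suRank v n).toFinset : Set (Σ u, u ⟶ v)) := by
      rw [arrowsLE_eq_of_receivesColor receivesColor_suRank, Set.Finite.coe_toFinset]
    rw [hs, finsum_mem_coe_finset, sum_arrow_mul_star v n (isRowFinite_suRank v n).toFinset
      (fun f => by simp)]
    simp only [twistOp_mul_star_twistOp]
    exact map_sum ({ toFun := constOp, map_zero' := rfl, map_add' := fun _ _ => rfl } :
      OpThree →+ Ambient) _ _

/-! ## The isomorphism -/

theorem labelElement_mem (l : SULabel) : labelElement l ∈ SUZero := by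
  have h : ∀ i j, limitOp i j ∈ SUZero := fun i j =>
    NonUnitalStarSubalgebra.le_topologicalClosure _
      (NonUnitalStarAlgebra.subset_adjoin ℂ _ ⟨i, j, tendsto_star_soibelmanGen i j⟩)
  cases l
  · exact limitOp_one_zero ▸ h 1 0
  · exact limitOp_one_one ▸ h 1 1
  · exact limitOp_one_two ▸ h 1 2
  · exact limitOp_zero_zero ▸ h 0 0
  · have h1 := neg_mem (h 0 1)
    rwa [limitOp_zero_one, neg_neg] at h1
  · exact limitOp_zero_two ▸ h 0 2

/-- The initial projection of the element of a label. -/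
def labelProj (l : SULabel) : OpThree :=
  partialPerm (PEquiv.ofSet {q | labelSource l (pointVertex q) = true})

theorem labelProj_apply (l : SULabel) (ξ : L2 (ℕ × ℕ × ℕ)) (p : ℕ × ℕ × ℕ) :
    labelProj l ξ p = if labelSource l (pointVertex p) then ξ p else 0 :=
  partialPerm_ofSet_apply _ _ _

/-- In `star (labelElement l) * labelElement l` the torus coordinates cancel and the initial
projection remains. -/
theorem constOp_labelProj_mem (l : SULabel) : constOp (labelProj l) ∈ SUZero := by
  have h : star (labelElement l) * labelElement l = constOp (labelProj l) := by
    rw [labelElement, star_twistOp_mul_twistOp, labelProj,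
      star_partialPerm_mul_self _ {q | labelSource l (pointVertex q) = true}]
    intro q
    change (if labelSource l (pointVertex q) then some (labelMap l q) else none).isSome ↔
      labelSource l (pointVertex q) = true
    split_ifs with h <;> simp [h]
  rw [← h]
  exact mul_mem (star_mem (labelElement_mem l)) (labelElement_mem l)

theorem opThree_sub_apply (T T' : OpThree) (ξ : L2 (ℕ × ℕ × ℕ)) (p : ℕ × ℕ × ℕ) :
    (T - T') ξ p = T ξ p - T' ξ p := rfl

/-- The source sets of the labels are nested: `Z` in `Y` in `X`, and `C` in `B` in `A`, with `X` and
`A` starting everywhere. The successive differences form a blue and a red partition of the vertices,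
and each vertex is the intersection of the two parts that its letters name. -/
theorem constOp_vertexProj_mem (v : SUVertex) : constOp (vertexProj v) ∈ SUZero := by
  have key : ∀ T T' : OpThree, constOp T ∈ SUZero → constOp T' ∈ SUZero →
      vertexProj v = T * T' → constOp (vertexProj v) ∈ SUZero := by
    rintro T T' hT hT' h
    rw [h, constOp_mul]
    exact mul_mem hT hT'
  have hsub : ∀ l l', constOp (labelProj l - labelProj l') ∈ SUZero := fun l l' =>
    sub_mem (constOp_labelProj_mem l) (constOp_labelProj_mem l')
  cases v
  · refine key _ _ (constOp_labelProj_mem .C) (constOp_labelProj_mem .Z)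
      (L2.op_ext fun ξ p => ?_)
    rw [vertexProj_apply, opThree_mul_apply, labelProj_apply, labelProj_apply]
    cases pointVertex p <;> simp [labelSource]
  · refine key _ _ (hsub .B .C) (constOp_labelProj_mem .Z) (L2.op_ext fun ξ p => ?_)
    rw [vertexProj_apply, opThree_mul_apply, opThree_sub_apply, labelProj_apply, labelProj_apply,
      labelProj_apply, labelProj_apply]
    cases pointVertex p <;> simp [labelSource]
  · refine key _ _ (constOp_labelProj_mem .C) (hsub .Y .Z) (L2.op_ext fun ξ p => ?_)
    rw [vertexProj_apply, opThree_mul_apply, labelProj_apply, opThree_sub_apply, labelProj_apply,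
      labelProj_apply]
    cases pointVertex p <;> simp [labelSource]
  · refine key _ _ (constOp_labelProj_mem .B) (hsub .X .Y) (L2.op_ext fun ξ p => ?_)
    rw [vertexProj_apply, opThree_mul_apply, labelProj_apply, opThree_sub_apply, labelProj_apply,
      labelProj_apply]
    cases pointVertex p <;> simp [labelSource]
  · refine key _ _ (hsub .A .B) (constOp_labelProj_mem .Y) (L2.op_ext fun ξ p => ?_)
    rw [vertexProj_apply, opThree_mul_apply, opThree_sub_apply, labelProj_apply, labelProj_apply,
      labelProj_apply, labelProj_apply]
    cases pointVertex p <;> simp [labelSource]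
  · refine key _ _ (hsub .A .B) (hsub .X .Y) (L2.op_ext fun ξ p => ?_)
    rw [vertexProj_apply, opThree_mul_apply, opThree_sub_apply, labelProj_apply, labelProj_apply,
      opThree_sub_apply, labelProj_apply, labelProj_apply]
    cases pointVertex p <;> simp [labelSource]

/-- Compression to two vertices isolates a single edge: a point has only one predecessor of the
given color, so the corner of a label is one edge if that edge exists and zero otherwise. -/
theorem cut_label_apply (l : SULabel) (u v : SUVertex) (ξ : L2 (ℕ × ℕ × ℕ)) (p : ℕ × ℕ × ℕ) :
    (vertexProj v * (partialPerm (labelPEquiv l) * vertexProj u)) ξ p =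
      if edgeLabel l.color u v = some l ∧ pointVertex p = v ∧
        pointVertex (pointPred l.color p) = u then ξ (pointPred l.color p) else 0 := by
  rw [opThree_mul_apply, vertexProj_apply, opThree_mul_apply, partialPerm_labelPEquiv_apply,
    vertexProj_apply]
  obtain ⟨l', h1, -⟩ := exists_labelMap_pointPred l.color p
  by_cases hv : pointVertex p = v
  swap
  · rw [if_neg hv, if_neg fun h => hv h.2.1]
  by_cases hu : pointVertex (pointPred l.color p) = u
  swap
  · rw [if_neg hu, ite_self, ite_self, if_neg fun h => hu h.2.2]
  rw [hu, hv] at h1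
  rw [if_pos hv, if_pos hu, hv]
  by_cases hl : edgeLabel l.color u v = some l
  · rw [if_pos (label_eq_of_edgeLabel hl).2.1, if_pos ⟨hl, rfl, hu⟩]
  · rw [if_neg, if_neg fun h => hl h.1]
    intro h2
    apply hl
    rw [h1, ← (label_eq_of_edgeLabel h1).2.1, h2]

theorem partialPerm_edgeArrow {u v : SUVertex} (e : SUEdge u v) :
    partialPerm (arrowPEquiv (edgeArrow e)) =
      vertexProj v * (partialPerm (labelPEquiv e.label) * vertexProj u) := by
  obtain ⟨col, l, he⟩ := e
  obtain ⟨rfl, -, -⟩ := label_eq_of_edgeLabel he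
  refine L2.op_ext fun ξ p => ?_
  rw [cut_label_apply, partialPerm_apply]
  dsimp only
  split_ifs with h
  · obtain ⟨-, rfl, rfl⟩ := h
    have h1 : arrowPEquiv (edgeArrow ⟨l.color, l, he⟩) (pointPred l.color p) = some p := by
      refine (arrowPEquiv_apply _ ⟨pointPred l.color p, rfl⟩).trans (congrArg some ?_)
      obtain ⟨l', h2, h3⟩ := exists_labelMap_pointPred l.color p
      obtain rfl : l' = l := Option.some.inj (h2.symm.trans he)
      exact h3
    rw [(PEquiv.eq_some_iff _).2 h1]
    rfl
  · have h1 : ¬ ((arrowPEquiv (edgeArrow ⟨l.color, l, he⟩)).symm p).isSome := by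
      rw [isSome_arrowPEquiv_symm_iff]
      rintro ⟨⟨q, hq⟩, rfl⟩
      have hq' : pointVertex q = u := hq
      have he' : edgeLabel l.color (pointVertex q) v = some l := by rw [hq', he]
      refine h ⟨he, pointVertex_labelMap he', ?_⟩
      have h3 := pointPred_labelMap he'
      exact (congrArg pointVertex h3).trans hq'
    rw [Option.not_isSome_iff_eq_none] at h1
    rw [h1]
    rfl

theorem suFamily_edgeArrow {u v : SUVertex} (e : SUEdge u v) :
    suFamily.S (edgeArrow e) =
      constOp (vertexProj v) * (labelElement e.label * constOp (vertexProj u)) := by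
  change twistOp (arrowRank suRank (edgeArrow e)) (partialPerm (arrowPEquiv (edgeArrow e))) = _
  rw [labelElement, twistOp_mul_constOp, constOp_mul_twistOp, partialPerm_edgeArrow,
    arrowRank_edgeArrow, (label_eq_of_edgeLabel e.isEdge).1]

theorem suFamily_S_mem {u v : SUGraph} (f : u ⟶ v) : suFamily.S f ∈ SUZero := by
  induction f using SUGraph.arrow_induction with
  | id =>
    have h : suFamily.S (𝟙 u) = suFamily.P u :=
      (suFamily.isCKFamily receivesColor_suRank).map_id u
    rw [h]
    exact constOp_vertexProj_mem u.vertex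
  | comp f e hf =>
    rw [← suFamily.ck2, suFamily_edgeArrow]
    exact mul_mem (mul_mem (constOp_vertexProj_mem _)
      (mul_mem (labelElement_mem _) (constOp_vertexProj_mem _))) hf

theorem sum_constOp_vertexProj [Fintype SUVertex] : ∑ v, constOp (vertexProj v) = 1 := by
  have h : ∑ v, vertexProj v = 1 := L2.op_ext fun ξ p => by
    rw [sum_apply, lp.coeFn_sum, Finset.sum_apply]
    simp only [vertexProj_apply]
    rw [Finset.sum_ite_eq, if_pos (Finset.mem_univ _)]
    rfl
  rw [← constOp_one, ← h]
  exact (map_sum ({ toFun := constOp, map_zero' := rfl, map_add' := fun _ _ => rfl } :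
    OpThree →+ Ambient) _ _).symm

/-- Inserting `1 = ∑ P v` on both sides cuts a label into corners, each of which is an edge of the
family or zero. -/
theorem labelElement_mem_of_suFamily_mem {W : NonUnitalStarSubalgebra ℂ Ambient}
    (hW : ∀ {u v : SUGraph} (f : u ⟶ v), suFamily.S f ∈ W) (l : SULabel) : labelElement l ∈ W := by
  have := Fintype.ofFinite SUVertex
  rw [← mul_one (labelElement l), ← one_mul (labelElement l * 1), ← sum_constOp_vertexProj,
    Finset.sum_mul]
  refine sum_mem fun v _ => ?_
  rw [Finset.mul_sum, Finset.mul_sum]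
  refine sum_mem fun u _ => ?_
  by_cases h : edgeLabel l.color u v = some l
  · have h1 := hW (edgeArrow (⟨l.color, l, h⟩ : SUEdge u v))
    rwa [suFamily_edgeArrow] at h1
  · have h1 : vertexProj v * (partialPerm (labelPEquiv l) * vertexProj u) = 0 :=
      L2.op_ext fun ξ p => by
        rw [cut_label_apply, if_neg fun h' => h h'.1]
        rfl
    have h2 : twistOp (colorRank l.color) 0 = 0 := ContinuousMap.ext fun _ => smul_zero _
    rw [labelElement, twistOp_mul_constOp, constOp_mul_twistOp, h1, h2]
    exact zero_mem W

/-! ### The homomorphism from the universal algebra -/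

/-- The right action of an element of the torus as a ⋆-homomorphism. -/
def rightActionHom (t : Torus) : Ambient →⋆ₙₐ[ℂ] Ambient where
  toFun := rightAction t
  map_smul' _ _ := rfl
  map_zero' := rfl
  map_add' _ _ := rfl
  map_mul' _ _ := rfl
  map_star' _ := rfl

theorem rightAction_twistOp (t : Torus) (n : Fin 2 → ℕ) (T : OpThree) :
    rightAction t (twistOp n T) = (torusMonomial t n : ℂ) • twistOp n T :=
  ContinuousMap.ext fun z => by
    change (torusMonomial (t * z) n : ℂ) • T = (torusMonomial t n : ℂ) • (torusMonomial z n : ℂ) • T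
    rw [smul_smul, ← Circle.coe_mul]
    congr 2
    unfold torusMonomial
    rw [← Finset.prod_mul_distrib]
    exact Finset.prod_congr rfl fun i _ => mul_pow (t i) (z i) (n i)

/-- The evaluation at a Cuntz-Krieger family. -/
def evalHom {k : ℕ} {Λ : Type} [Category.{0} Λ] {F : Λ ⥤ RankCat k} (R : CKRep F) :
    CKProduct F →⋆ₙₐ[ℂ] R.carrier where
  toFun x := x R
  map_smul' _ _ := rfl
  map_zero' := rfl
  map_add' _ _ := rfl
  map_mul' _ _ := rfl
  map_star' _ := rfl

/-- The Cuntz-Krieger family of the 2-graph together with its C⋆-algebra. -/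
def suRep : CKRep suRank := ⟨Ambient, suFamily⟩

/-- The homomorphism of the universal C⋆-algebra that is defined by the Cuntz-Krieger family. -/
def suHom : CKProduct suRank →⋆ₙₐ[ℂ] Ambient := evalHom suRep

theorem NonUnitalStarAlgHom.continuous_of_cstar {A B : Type*} [NonUnitalCStarAlgebra A]
    [NonUnitalCStarAlgebra B] (f : A →⋆ₙₐ[ℂ] B) : Continuous f :=
  AddMonoidHomClass.continuous_of_bound f 1 fun x => by
    rw [one_mul]
    exact NonUnitalStarAlgHom.norm_apply_le f x

theorem suHom_univP (v : SUGraph) : suHom (univP suRank v) = constOp (vertexProj v.vertex) := rfl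

theorem suHom_univS {u v : SUGraph} (f : u ⟶ v) : suHom (univS suRank f) = suFamily.S f := rfl

theorem suHom_univP_ne_zero (v : SUGraph) : suHom (univP suRank v) ≠ 0 := by
  obtain ⟨p, hp⟩ := nonempty_pointAction v
  intro h
  rw [suHom_univP] at h
  have h1 : vertexProj v.vertex (lp.single 2 p (1 : ℂ)) p = 0 := by
    have h2 : vertexProj v.vertex = 0 := congrArg (fun f : Ambient => f 1) h
    rw [h2]
    rfl
  rw [vertexProj_apply, if_pos (show pointVertex p = v.vertex from hp)] at h1
  exact one_ne_zero ((lp.single_apply_self (E := fun _ : ℕ × ℕ × ℕ => ℂ) 2 p 1).symm.trans h1)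

/-- The uniqueness theorem applies on the dense ⋆-algebra, with the right action as the compatible
torus action, and equality of norms is a closed condition. -/
theorem norm_suHom {x : CKProduct suRank} (hx : x ∈ graphCStar suRank) : ‖suHom x‖ = ‖x‖ := by
  have hcl : IsClosed {x : CKProduct suRank | ‖suHom x‖ = ‖x‖} :=
    isClosed_eq (NonUnitalStarAlgHom.continuous_of_cstar suHom).norm continuous_norm
  refine closure_minimal (fun y hy => ?_) hcl hx
  exact (isCKFamily_univ receivesColor_suRank).norm_map_eq isKGraph_suRank isRowFinite_suRank suHom
    suHom_univP_ne_zero rightActionHom (fun t u v f => rightAction_twistOp t _ _) hy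

theorem suHom_mem {x : CKProduct suRank} (hx : x ∈ graphCStar suRank) : suHom x ∈ SUZero := by
  have hle : NonUnitalStarAlgebra.adjoin ℂ (univGenerators suRank) ≤ SUZero.comap suHom := by
    refine NonUnitalStarAlgebra.adjoin_le ?_
    rintro y (⟨v, rfl⟩ | ⟨u, v, f, rfl⟩)
    · exact constOp_vertexProj_mem v.vertex
    · exact suFamily_S_mem f
  have hcl : IsClosed (suHom ⁻¹' (SUZero : Set Ambient)) :=
    (NonUnitalStarSubalgebra.isClosed_topologicalClosure _).preimage
      (NonUnitalStarAlgHom.continuous_of_cstar suHom)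
  exact closure_minimal (fun y hy => hle hy) hcl hx

theorem suHom_gaugeProduct (t : Torus) {x : CKProduct suRank} (hx : x ∈ graphCStar suRank) :
    suHom (gaugeProduct suRank t x) = rightAction t (suHom x) := by
  have hle : NonUnitalStarAlgebra.adjoin ℂ (univGenerators suRank) ≤
      NonUnitalStarAlgHom.equalizer (suHom.comp (gaugeProduct suRank t))
        ((rightActionHom t).comp suHom) := by
    refine NonUnitalStarAlgebra.adjoin_le ?_
    rintro y (⟨v, rfl⟩ | ⟨u, v, f, rfl⟩)
    · rfl
    · change suHom (gaugeProduct suRank t (univS suRank f)) = rightAction t (suFamily.S f)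
      rw [gaugeProduct_univS, map_smul, suHom_univS]
      exact (rightAction_twistOp t _ _).symm
  have hcl : IsClosed {x | (suHom.comp (gaugeProduct suRank t)) x =
      ((rightActionHom t).comp suHom) x} :=
    isClosed_eq (NonUnitalStarAlgHom.continuous_of_cstar _)
      (NonUnitalStarAlgHom.continuous_of_cstar _)
  exact closure_minimal (fun y hy => hle hy) hcl hx

/-- The image of a complete space under an isometry is closed. An image that contains the limits
therefore contains the closed algebra that they generate. -/
theorem isClosed_map_suHom : IsClosed ((graphCStar suRank).map suHom : Set Ambient) := by
  have hcl : IsClosed (graphCStar suRank : Set (CKProduct suRank)) :=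
    NonUnitalStarSubalgebra.isClosed_topologicalClosure _
  have := hcl.completeSpace_coe
  have hiso : Isometry (fun x : graphCStar suRank => suHom x) :=
    AddMonoidHomClass.isometry_of_norm
      (suHom.comp (NonUnitalStarSubalgebraClass.subtype (graphCStar suRank)))
      fun x => norm_suHom x.2
  have h := hiso.isClosedEmbedding.isClosed_range
  have heq : ((graphCStar suRank).map suHom : Set Ambient) =
      Set.range (fun x : graphCStar suRank => suHom x) :=
    Set.ext fun y => ⟨fun ⟨x, hx, hxy⟩ => ⟨⟨x, hx⟩, hxy⟩, fun ⟨x, hxy⟩ => ⟨x.1, x.2, hxy⟩⟩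
  rw [heq]
  exact h

theorem SUZero_le_map_suHom : SUZero ≤ (graphCStar suRank).map suHom := by
  have hS : ∀ {u v : SUGraph} (f : u ⟶ v), suFamily.S f ∈ (graphCStar suRank).map suHom :=
    fun {u v} f => ⟨univS suRank f, NonUnitalStarSubalgebra.le_topologicalClosure _
      (NonUnitalStarAlgebra.subset_adjoin ℂ _ (Or.inr ⟨u, v, f, rfl⟩)), rfl⟩
  have hl := labelElement_mem_of_suFamily_mem hS
  have hle : NonUnitalStarAlgebra.adjoin ℂ limitGenerators ≤ (graphCStar suRank).map suHom := by
    refine NonUnitalStarAlgebra.adjoin_le ?_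
    rintro L ⟨i, j, hL⟩
    -- Uniqueness of limits identifies an arbitrary element of `limitGenerators` with one of the six
    -- explicit operators, each a label up to sign.
    rw [tendsto_nhds_unique hL (tendsto_star_soibelmanGen i j)]
    fin_cases i <;> fin_cases j
    · exact limitOp_zero_zero ▸ hl _
    · exact limitOp_zero_one ▸ neg_mem (hl _)
    · exact limitOp_zero_two ▸ hl _
    · exact limitOp_one_zero ▸ hl _
    · exact limitOp_one_one ▸ hl _
    · exact limitOp_one_two ▸ hl _
  exact closure_minimal (fun y hy => hle hy) isClosed_map_suHom

/-- The isomorphism of `C⋆(𝒢)` and `SU₀(3)`. -/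
def suEquiv : graphCStar suRank ≃⋆ₐ[ℂ] SUZero :=
  StarAlgEquiv.ofBijective
    ({ toFun := fun x => ⟨suHom x, suHom_mem x.2⟩
       map_smul' := fun _ _ => rfl
       map_zero' := rfl
       map_add' := fun _ _ => rfl
       map_mul' := fun _ _ => rfl
       map_star' := fun _ => rfl } : graphCStar suRank →⋆ₙₐ[ℂ] SUZero)
    ⟨fun x y h => by
      have h1 : suHom (x - y : graphCStar suRank) = 0 := by
        have h2 : suHom x = suHom y := congrArg Subtype.val h
        change suHom ((x : CKProduct suRank) - y) = 0
        rw [map_sub, h2, sub_self]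
      have h3 := norm_suHom (x - y).2
      rw [h1, norm_zero] at h3
      exact sub_eq_zero.1 (Subtype.ext (norm_eq_zero.1 h3.symm)),
    fun y => by
      obtain ⟨x, hx, hxy⟩ := SUZero_le_map_suHom y.2
      exact ⟨⟨x, hx⟩, Subtype.ext hxy⟩⟩

theorem mainTheorem2 :
    IsKGraph suRank ∧ IsRowFinite suRank ∧ IsLocallyConvex suRank ∧
    (∀ (i : Fin 2) (j : Fin 3),
      Tendsto (fun q => star (soibelmanGen q i j)) qToZero (𝓝 (limitOp i j))) ∧
    ∃ φ : graphCStar suRank ≃⋆ₐ[ℂ] SUZero,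
      ∀ (t : Fin 2 → Circle) (a : graphCStar suRank),
        ((φ (gaugeAction suRank t a) : SUZero) : Ambient) =
          rightAction t ((φ a : SUZero) : Ambient) :=
  ⟨isKGraph_suRank, isRowFinite_suRank, isLocallyConvex_suRank, tendsto_star_soibelmanGen, suEquiv,
    fun t a => suHom_gaugeProduct t a.2⟩

end
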